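/- For a finite multiset $X=\{x_1,\dots,x_k\}$ of complex numbers let $\sigma_X(n)=\sum_{n_1\cdots n_k=n}n_1^{-x_1}\cdots n_k^{-x_k}$ and $-X=\{-x_1,\dots,-x_k\}$; let $\mathcal Z_{X,Y}(s)$ be the analytic (meromorphic) continuation of $\sum_{n\ge1}\sigma_X(n)\sigma_Y(n)n^{-1-s}$. Let $\mathcal I=\{a_1,a_2,a_3\}$, $\mathcal J=\{b_1,b_2,b_3\}$, and for real $t$ put $$g_{\mathcal I,\mathcal J}(s,t)=\prod_{i=1}^3\frac{\Gamma\big(\frac{\frac12+a_i+s+it}{2}\big)\Gamma\big(\frac{\frac12+b_i+s-it}{2}\big)}{\Gamma\big(\frac{\frac12+a_i+it}{2}\big)\Gamma\big(\frac{\frac12+b_i-it}{2}\big)},\qquad X_{\mathcal I,\mathcal J;t}=\pi^{\sum_{i}(a_i+b_i)}\prod_{i=1}^3\frac{\Gamma\big(\frac{\frac12-a_i-it}{2}\big)\Gamma\big(\frac{\frac12-b_i+it}{2}\big)}{\Gamma\big(\frac{\frac12+a_i+it}{2}\big)\Gamma\big(\frac{\frac12+b_i-it}{2}\big)}.$$ Let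 $G$ be an even entire function with $G(0)=1$ and of rapid decay, $|G(s)|\le K(A,B)(1+|s|)^{-B}$ for $|\Re s|\le A$, for all $A,B>0$. Let $\omega$ be a smooth function supported in $[c_1T,c_2T]$, $0<c_1<c_2$, with $|\omega^{(j)}(t)|\le M_jT_0^{-j}$ for all $j\ge0$, where $T^{3/4}\le T_0\le M_0T$. Define the diagonal terms $$I_D^{(1)}=\sum_{n=1}^\infty\frac{\sigma_{\mathcal I}(n)\sigma_{\mathcal J}(n)}{n}\,\frac1{2\pi i}\int_{(1)}\frac{G(s)}{s}(\pi^3n^2)^{-s}\int_{-\infty}^\infty g_{\mathcal I,\mathcal J}(s,t)\omega(t)\,dt\,ds,$$ $$I_D^{(2)}=\sum_{n=1}^\infty\frac{\sigma_{-\mathcal J}(n)\sigma_{-\mathcal I}(n)}{n}\,\frac1{2\pi i}\int_{(1)}\frac{G(s)}{s}(\pi^3n^2)^{-s}\int_{-\infty}^\infty X_{\mathcal I,\mathcal J;t}\,g_{-\mathcal J,-\mathcal I}(s,t)\omega(t)\,dt\,ds.$$ Then for every $\varepsilon>0$ and $c>0$ there is $T_\varepsilon>1$ such that for all $T\ge T_\varepsilon$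 and all $a_i,b_j$ with $|a_i|,|b_j|\le c/\log T$ for which the nine sums $a_i+b_j$ are non-zero and pairwise distinct, the continuations $\mathcal Z_{\mathcal I,\mathcal J}$, $\mathcal Z_{-\mathcal J,-\mathcal I}$ exist (at least in $\Re s>-\frac14$, holomorphic except possibly at $-(a_i+b_j)$, respectively $a_i+b_j$), the sums over $n$ and the integrals over $\Re s=1$ defining $I_D^{(1)}$, $I_D^{(2)}$ converge absolutely, and $$I_D^{(1)}=\int_{-\infty}^\infty\mathcal Z_{\mathcal I,\mathcal J}(0)\,\omega(t)\,dt+\sum_{i,j=1}^3\operatorname*{Res}_{s=\frac{-a_i-b_j}2}\mathcal Z_{\mathcal I,\mathcal J}(2s)\;\frac{G\big(\frac{-a_i-b_j}2\big)}{\frac{-a_i-b_j}2}\int_{-\infty}^\infty\omega(t)\Big(\frac t{2\pi}\Big)^{-\frac32(a_i+b_j)}dt+O(T^{\frac14+\varepsilon}),$$ $$I_D^{(2)}=\int_{-\infty}^\infty\Big(\frac t{2\pi}\Big)^{-\sum_{k=1}^3(a_k+b_k)}\mathcal Z_{-\mathcal J,-\mathcal I}(0)\,\omega(t)\,dt+\sum_{i,j=1}^3\operatorname*{Res}_{s=\frac{a_i+b_j}2}\mathcal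 Z_{-\mathcal J,-\mathcal I}(2s)\;\frac{G\big(\frac{a_i+b_j}2\big)}{\frac{a_i+b_j}2}\int_{-\infty}^\infty\omega(t)\Big(\frac t{2\pi}\Big)^{-\sum_{k=1}^3(a_k+b_k)+\frac32(a_i+b_j)}dt+O(T^{\frac14+\varepsilon}).$$ Here $T_\varepsilon$ and the implied constants depend only on $\varepsilon,c,c_1,c_2,M_0,(M_j)_j$ and $K$; in particular they are uniform in the shifts $a_i,b_j$. -/

import Mathlib

noncomputable section

namespace SixthMoment

/-- The shifted divisor function `σ_X(n) = ∑_{n₁ ⋯ n_k = n} n₁^{-x₁} ⋯ n_k^{-x_k}` of the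
multiset `X = {x₁, …, x_k}`, given as a tuple (the value does not depend on the ordering).
It is the coefficient of `n^{-s}` in `ζ(s + x₁) ⋯ ζ(s + x_k)`. With this definition
`σ_X(0) = 0`, so that sums over `n : ℕ` below are sums over `n ≥ 1`. -/
def sigma {k : ℕ} (x : Fin k → ℂ) (n : ℕ) : ℂ :=
  ∑ d ∈ Nat.finMulAntidiag k n, ∏ i, (d i : ℂ) ^ (-x i)

/-- `Z` is the analytic continuation of the Dirichlet series
`𝒵_{X,Y}(w) = ∑_{n ≥ 1} σ_X(n) σ_Y(n) / n^{1 + w}`: it agrees with the series in some right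
half-plane of absolute convergence, and is holomorphic in the half-plane `Re w > -1/4` apart from
possible singularities at the nine points `-(x_i + y_j)`. The half-plane without these points is
connected, hence `Z` is determined there by the series. -/
def IsContinuation (X Y : Fin 3 → ℂ) (Z : ℂ → ℂ) : Prop :=
  (∃ σ₁ : ℝ, ∀ w : ℂ, σ₁ < w.re →
    LSeriesSummable (fun n => sigma X n * sigma Y n) (1 + w) ∧
    Z w = LSeries (fun n => sigma X n * sigma Y n) (1 + w)) ∧
  DifferentiableOn ℂ Z ({w : ℂ | -(1 / 4 : ℝ) < w.re} \ {w : ℂ | ∃ i j, w = -(X i + Y j)})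

/-- The function `𝒵_{X,Y}`: the analytic continuation of `∑_{n ≥ 1} σ_X(n) σ_Y(n) / n^{1 + w}`
(a junk function if there were no continuation). -/
def calZ (X Y : Fin 3 → ℂ) : ℂ → ℂ :=
  Classical.epsilon (IsContinuation X Y)

/-- The residue of `f` at an isolated singularity `c`:
`(1 / 2πi) ∮_{|z - c| = r} f(z) dz` for small `r > 0`. -/
def residue (f : ℂ → ℂ) (c : ℂ) : ℂ :=
  Filter.limUnder (nhdsWithin (0 : ℝ) (Set.Ioi 0))
    (fun r : ℝ => (2 * (Real.pi : ℂ) * Complex.I)⁻¹ * ∮ z in C(c, r), f z)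

/-- `(1 / 2πi) ∫_{(σ)} F(s) ds`, the integral over the vertical line `Re s = σ`, upwards. -/
def lineIntegral (σ : ℝ) (F : ℂ → ℂ) : ℂ :=
  (1 / (2 * (Real.pi : ℂ))) * ∫ u : ℝ, F ((σ : ℂ) + (u : ℂ) * Complex.I)

/-- Absolute convergence of the integral of `F` over the vertical line `Re s = σ`. -/
def LineIntegrable (σ : ℝ) (F : ℂ → ℂ) : Prop :=
  MeasureTheory.Integrable (fun u : ℝ => F ((σ : ℂ) + (u : ℂ) * Complex.I))

/-- The Gamma quotient `g_{I,J}(s,t)`. -/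
def gFactor (a b : Fin 3 → ℂ) (s : ℂ) (t : ℝ) : ℂ :=
  ∏ i : Fin 3,
    (Complex.Gamma ((1 / 2 + a i + s + Complex.I * t) / 2) *
        Complex.Gamma ((1 / 2 + b i + s - Complex.I * t) / 2)) /
      (Complex.Gamma ((1 / 2 + a i + Complex.I * t) / 2) *
        Complex.Gamma ((1 / 2 + b i - Complex.I * t) / 2))

/-- The factor `X_{I,J;t}` of the functional equation. -/
def XFactor (a b : Fin 3 → ℂ) (t : ℝ) : ℂ :=
  (Real.pi : ℂ) ^ (∑ i : Fin 3, (a i + b i)) *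
    ∏ i : Fin 3,
      (Complex.Gamma ((1 / 2 - a i - Complex.I * t) / 2) *
          Complex.Gamma ((1 / 2 - b i + Complex.I * t) / 2)) /
        (Complex.Gamma ((1 / 2 + a i + Complex.I * t) / 2) *
          Complex.Gamma ((1 / 2 + b i - Complex.I * t) / 2))

/-- The function of `s` under the line integral in the `n`-th term of `I_D^{(1)}`. -/
def diagIntegrand₁ (a b : Fin 3 → ℂ) (G : ℂ → ℂ) (ω : ℝ → ℂ) (n : ℕ) (s : ℂ) : ℂ :=
  G s / s * ((Real.pi : ℂ) ^ 3 * (n : ℂ) ^ 2) ^ (-s) * ∫ t : ℝ, gFactor a b s t * ω t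

/-- The `n`-th term of `I_D^{(1)}`. -/
def diagTerm₁ (a b : Fin 3 → ℂ) (G : ℂ → ℂ) (ω : ℝ → ℂ) (n : ℕ) : ℂ :=
  sigma a n * sigma b n / (n : ℂ) * lineIntegral 1 (diagIntegrand₁ a b G ω n)

/-- The diagonal term `I_D^{(1)}`. -/
def diag₁ (a b : Fin 3 → ℂ) (G : ℂ → ℂ) (ω : ℝ → ℂ) : ℂ :=
  ∑' n : ℕ, diagTerm₁ a b G ω n

/-- The function of `s` under the line integral in the `n`-th term of `I_D^{(2)}`. -/
def diagIntegrand₂ (a b : Fin 3 → ℂ) (G : ℂ → ℂ) (ω : ℝ → ℂ) (n : ℕ) (s : ℂ) : ℂ :=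
  G s / s * ((Real.pi : ℂ) ^ 3 * (n : ℂ) ^ 2) ^ (-s) *
    ∫ t : ℝ, XFactor a b t * gFactor (-b) (-a) s t * ω t

/-- The `n`-th term of `I_D^{(2)}`. -/
def diagTerm₂ (a b : Fin 3 → ℂ) (G : ℂ → ℂ) (ω : ℝ → ℂ) (n : ℕ) : ℂ :=
  sigma (-b) n * sigma (-a) n / (n : ℂ) * lineIntegral 1 (diagIntegrand₂ a b G ω n)

/-- The diagonal term `I_D^{(2)}`. -/
def diag₂ (a b : Fin 3 → ℂ) (G : ℂ → ℂ) (ω : ℝ → ℂ) : ℂ :=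
  ∑' n : ℕ, diagTerm₂ a b G ω n

/-- `G` is an even entire function with `G(0) = 1`, of rapid decay in every vertical strip,
with decay constants `K`. Every even entire `G` of rapid decay with `G(0) = 1` satisfies this for
some `K`; naming `K` makes estimates uniform over functions `G` that depend on the shifts. -/
structure IsKernel (K : ℝ → ℝ → ℝ) (G : ℂ → ℂ) : Prop where
  entire : Differentiable ℂ G
  even : ∀ s, G (-s) = G s
  map_zero : G 0 = 1
  decay : ∀ A > 0, ∀ B > 0, ∀ s : ℂ, |s.re| ≤ A → ‖G s‖ ≤ K A B * (1 + ‖s‖) ^ (-B)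

/-- `ω` is a smooth weight supported in `[c₁ T, c₂ T]` with `ω^{(j)} ≪_j T₀^{-j}`, where
`T^{3/4} ≤ T₀ ≪ T`. The implied constants are `M₀` and `M j`. -/
structure IsWeight (c₁ c₂ M₀ : ℝ) (M : ℕ → ℝ) (T T₀ : ℝ) (ω : ℝ → ℂ) : Prop where
  smooth : ContDiff ℝ ((⊤ : ℕ∞) : WithTop ℕ∞) ω
  support_subset : Function.support ω ⊆ Set.Icc (c₁ * T) (c₂ * T)
  lower : T ^ (3 / 4 : ℝ) ≤ T₀
  upper : T₀ ≤ M₀ * T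
  deriv_bound : ∀ (j : ℕ) (t : ℝ), ‖iteratedDeriv j ω t‖ ≤ M j * T₀ ^ (-(j : ℝ))

end SixthMoment

end

/-! ### Polynomial growth of `(s - 1) ζ(s)` in the half-plane `Re s > 1/4`. -/

section

open Complex Filter Topology

namespace SixthMoment

/-- The `n`-th term of the series for `(s - 1) ζ(s) - 1` that converges for `Re s > 0`. -/
noncomputable def zetaTerm (n : ℕ) (s : ℂ) : ℂ :=
  (s - 1) * ((n + 1 : ℝ) : ℂ) ^ (-s) + ((n + 2 : ℝ) : ℂ) ^ (1 - s) - ((n + 1 : ℝ) : ℂ) ^ (1 - s)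

lemma hasDerivAt_ofReal_cpow' (r : ℂ) {x : ℝ} (hx : 0 < x) :
    HasDerivAt (fun y : ℝ => (y : ℂ) ^ r) (r * (x : ℂ) ^ (r - 1)) x := by
  have h := (hasStrictDerivAt_id (x : ℂ)).cpow_const (c := r) (Or.inl (by simpa using hx))
  simpa using h.hasDerivAt.comp_ofReal

lemma norm_cpow_sub_cpow_le (s : ℂ) (hs : 0 ≤ s.re) {m x : ℝ} (hm : 0 < m) (hx : m ≤ x)
    (hx1 : x ≤ m + 1) :
    ‖(m : ℂ) ^ (-s) - (x : ℂ) ^ (-s)‖ ≤ ‖s‖ * m ^ (-s.re - 1) := by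
  have key : ∀ y ∈ Set.Icc m x, ‖(y : ℂ) ^ (-s) - (m : ℂ) ^ (-s)‖ ≤
      (‖s‖ * m ^ (-s.re - 1)) * (y - m) := by
    refine norm_image_sub_le_of_norm_deriv_le_segment' (f' := fun y => -s * (y : ℂ) ^ (-s - 1)) ?_ ?_
    · intro y hy
      exact (hasDerivAt_ofReal_cpow' (-s) (hm.trans_le hy.1)).hasDerivWithinAt
    · intro y hy
      have hy0 : 0 < y := hm.trans_le hy.1
      rw [norm_mul, norm_neg, norm_cpow_eq_rpow_re_of_pos hy0]
      refine mul_le_mul_of_nonneg_left ?_ (norm_nonneg _)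
      simpa using Real.rpow_le_rpow_of_nonpos hm hy.1 (by simp; linarith)
  have := key x ⟨hx, le_rfl⟩
  rw [norm_sub_rev]
  refine this.trans ?_
  have h0 : 0 ≤ ‖s‖ * m ^ (-s.re - 1) := by positivity
  nlinarith

/-- With `m = n + 1` the term is `(s - 1) ∫_m^{m+1} (m^{-s} - x^{-s}) dx`, and the difference in the
integrand saves one power of `m`. The mean value inequality replaces the integral. -/
lemma norm_zetaTerm_le (n : ℕ) (s : ℂ) (hs : 0 ≤ s.re) :
    ‖zetaTerm n s‖ ≤ ‖s - 1‖ * ‖s‖ * (n + 1 : ℝ) ^ (-s.re - 1) := by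
  have hm : (0 : ℝ) < n + 1 := by positivity
  set m : ℝ := n + 1 with hmdef
  have key : ∀ y ∈ Set.Icc m (m + 1),
      ‖((s - 1) * (m : ℂ) ^ (-s) * (y : ℂ) + (y : ℂ) ^ (1 - s)) -
        ((s - 1) * (m : ℂ) ^ (-s) * (m : ℂ) + (m : ℂ) ^ (1 - s))‖ ≤
      (‖s - 1‖ * ‖s‖ * m ^ (-s.re - 1)) * (y - m) := by
    refine norm_image_sub_le_of_norm_deriv_le_segment'
      (f := fun y : ℝ => (s - 1) * (m : ℂ) ^ (-s) * (y : ℂ) + (y : ℂ) ^ (1 - s))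
      (f' := fun y => (s - 1) * ((m : ℂ) ^ (-s) - (y : ℂ) ^ (-s))) ?_ ?_
    · intro y hy
      have h1 := hasDerivAt_ofReal_cpow' (1 - s) (hm.trans_le hy.1)
      have h2 : HasDerivAt (fun y : ℝ => (y : ℂ)) 1 y := ofRealCLM.hasDerivAt
      have h3 := (h2.const_mul ((s - 1) * (m : ℂ) ^ (-s))).add h1
      refine (h3.congr_deriv ?_).hasDerivWithinAt
      rw [show (1 - s - 1 : ℂ) = -s by ring]
      ring
    · intro y hy
      rw [norm_mul, mul_assoc]
      exact mul_le_mul_of_nonneg_left (norm_cpow_sub_cpow_le s hs hm hy.1 hy.2.le) (norm_nonneg _)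
  have h := key (m + 1) ⟨by linarith, le_rfl⟩
  have e : zetaTerm n s = ((s - 1) * (m : ℂ) ^ (-s) * ((m + 1 : ℝ) : ℂ) + ((m + 1 : ℝ) : ℂ) ^ (1 - s)) -
        ((s - 1) * (m : ℂ) ^ (-s) * (m : ℂ) + (m : ℂ) ^ (1 - s)) := by
    rw [zetaTerm, show (n + 2 : ℝ) = m + 1 by rw [hmdef]; ring, ← hmdef]
    push_cast
    ring
  rw [e]
  refine h.trans (le_of_eq ?_)
  ring

lemma summable_rpow_succ {r : ℝ} (hr : 1 < r) : Summable (fun n : ℕ => (n + 1 : ℝ) ^ (-r)) := by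
  have := (summable_nat_add_iff 1).2 (Real.summable_nat_rpow_inv.2 hr)
  refine this.congr fun n => ?_
  rw [Real.rpow_neg (by positivity)]
  push_cast
  rfl

lemma differentiable_zetaTerm (n : ℕ) : Differentiable ℂ (zetaTerm n) := by
  have h1 : ((n + 1 : ℝ) : ℂ) ≠ 0 := by exact_mod_cast (by positivity : (0 : ℝ) < n + 1).ne'
  have h2 : ((n + 2 : ℝ) : ℂ) ≠ 0 := by exact_mod_cast (by positivity : (0 : ℝ) < n + 2).ne'
  unfold zetaTerm
  intro s
  refine DifferentiableAt.sub (DifferentiableAt.add (DifferentiableAt.mul (by fun_prop) ?_) ?_) ?_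
  · exact (differentiableAt_id.neg).const_cpow (Or.inl h1)
  · exact (DifferentiableAt.const_cpow (by fun_prop) (Or.inl h2))
  · exact (DifferentiableAt.const_cpow (by fun_prop) (Or.inl h1))

lemma norm_zetaTerm_le' (n : ℕ) {s : ℂ} (hs : 1 / 4 < s.re) :
    ‖zetaTerm n s‖ ≤ (1 + ‖s‖) ^ 2 * (n + 1 : ℝ) ^ (-(5 / 4 : ℝ)) := by
  refine (norm_zetaTerm_le n s (by linarith)).trans ?_
  have h1 : ‖s - 1‖ ≤ 1 + ‖s‖ := by
    have := norm_sub_le s 1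
    simp at this
    linarith
  have h2 : (n + 1 : ℝ) ^ (-s.re - 1) ≤ (n + 1 : ℝ) ^ (-(5 / 4 : ℝ)) :=
    Real.rpow_le_rpow_of_exponent_le (by linarith [n.cast_nonneg (α := ℝ)]) (by linarith)
  have h3 : ‖s - 1‖ * ‖s‖ ≤ (1 + ‖s‖) ^ 2 := by nlinarith [norm_nonneg s, norm_nonneg (s - 1)]
  gcongr

/-- For `Re s > 1` the first part of the terms sums to `(s - 1) ζ(s)` and the rest telescopes to
`-1`. -/
lemma riemannZeta₁_eq_tsum_of_one_lt {s : ℂ} (hs : 1 < s.re) :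
    riemannZeta₁ s = 1 + ∑' n, zetaTerm n s := by
  have hs1 : s ≠ 1 := by rintro rfl; simp at hs
  have h1 : HasSum (fun n : ℕ => (s - 1) * ((n + 1 : ℝ) : ℂ) ^ (-s)) ((s - 1) * riemannZeta s) := by
    have hsum : Summable (fun n : ℕ => 1 / (n + 1 : ℂ) ^ s) := by
      have := (summable_nat_add_iff 1).2 (Complex.summable_one_div_nat_cpow.2 hs)
      simpa using this
    have h2 := hsum.hasSum
    rw [← zeta_eq_tsum_one_div_nat_add_one_cpow hs] at h2
    refine (h2.mul_left (s - 1)).congr_fun ?_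
    intro n
    rw [cpow_neg]
    push_cast
    simp
  have h2 : HasSum (fun n : ℕ => ((n + 2 : ℝ) : ℂ) ^ (1 - s) - ((n + 1 : ℝ) : ℂ) ^ (1 - s)) (-1) := by
    -- Convergence of the telescoping partial sums is not enough for `HasSum`; absolute convergence
    -- is inherited from the two other series.
    have hsm : Summable (fun n : ℕ => ((n + 2 : ℝ) : ℂ) ^ (1 - s) - ((n + 1 : ℝ) : ℂ) ^ (1 - s)) := by
      have ha : Summable (fun n => zetaTerm n s) := by
        refine Summable.of_norm_bounded ((summable_rpow_succ (r := 5 / 4) (by norm_num)).mul_left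
          ((1 + ‖s‖) ^ 2)) fun n => norm_zetaTerm_le' n (by linarith)
      refine (ha.sub h1.summable).congr fun n => ?_
      rw [zetaTerm]; ring
    refine (hsm.hasSum_iff_tendsto_nat).2 ?_
    have e : ∀ N : ℕ, ∑ n ∈ Finset.range N,
        (((n + 2 : ℝ) : ℂ) ^ (1 - s) - ((n + 1 : ℝ) : ℂ) ^ (1 - s)) =
        ((N + 1 : ℝ) : ℂ) ^ (1 - s) - 1 := by
      intro N
      have := Finset.sum_range_sub (fun n : ℕ => ((n + 1 : ℝ) : ℂ) ^ (1 - s)) N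
      simp only [Nat.cast_zero, zero_add, ofReal_one, one_cpow] at this
      rw [← this]
      refine Finset.sum_congr rfl fun n _ => ?_
      push_cast
      ring_nf
    simp_rw [e]
    have : Tendsto (fun N : ℕ => ((N + 1 : ℝ) : ℂ) ^ (1 - s)) atTop (𝓝 0) := by
      rw [tendsto_zero_iff_norm_tendsto_zero]
      have h3 : Tendsto (fun N : ℕ => (N + 1 : ℝ) ^ (-(s.re - 1))) atTop (𝓝 0) :=
        (tendsto_rpow_neg_atTop (by linarith : 0 < s.re - 1)).comp
          (tendsto_atTop_add_const_right _ _ tendsto_natCast_atTop_atTop)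
      refine h3.congr fun N => ?_
      rw [norm_cpow_eq_rpow_re_of_pos (by positivity)]
      simp
    simpa using this.sub_const 1
  have h3 := h1.add h2
  have h4 : HasSum (fun n => zetaTerm n s) ((s - 1) * riemannZeta s + -1) := by
    refine h3.congr_fun fun n => ?_
    rw [zetaTerm]; ring
  rw [h4.tsum_eq, riemannZeta_eq_inv_sub_mul hs1, ← mul_assoc, mul_inv_cancel₀ (sub_ne_zero.2 hs1)]
  ring

lemma riemannZeta₁_eq_tsum {s : ℂ} (hs : 1 / 4 < s.re) :
    riemannZeta₁ s = 1 + ∑' n, zetaTerm n s := by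
  -- The majorant of the terms grows with `‖s‖`, so the identity theorem is applied on a bounded
  -- convex piece of the half-plane that contains both `s` and `2`.
  set R := ‖s‖ + 3
  set U : Set ℂ := {z | 1 / 4 < z.re} ∩ Metric.ball 0 R
  have hUo : IsOpen U := (isOpen_lt continuous_const continuous_re).inter Metric.isOpen_ball
  have hUc : Convex ℝ U := (convex_halfSpace_re_gt _).inter (convex_ball _ _)
  have hd : DifferentiableOn ℂ (fun z => 1 + ∑' n, zetaTerm n z) U := by
    refine (differentiableOn_const _).add ?_
    refine differentiableOn_tsum_of_summable_norm
      ((summable_rpow_succ (r := 5 / 4) (by norm_num)).mul_left ((1 + R) ^ 2))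
      (fun n => (differentiable_zetaTerm n).differentiableOn) hUo ?_
    intro n z hz
    refine (norm_zetaTerm_le' n hz.1).trans ?_
    have : ‖z‖ ≤ R := by simpa using (mem_ball_zero_iff.1 hz.2).le
    gcongr
  have h2U : (2 : ℂ) ∈ U := by
    refine ⟨by norm_num, ?_⟩
    simp only [Metric.mem_ball, dist_zero_right, R, norm_ofNat]
    linarith [norm_nonneg s]
  have hsU : s ∈ U := ⟨hs, by simp [R]⟩
  refine (differentiable_riemannZeta₁.differentiableOn.analyticOnNhd hUo).eqOn_of_preconnected_of_eventuallyEq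
    (hd.analyticOnNhd hUo) hUc.isPreconnected h2U ?_ hsU
  have : ∀ᶠ z : ℂ in 𝓝 2, 1 < z.re :=
    (isOpen_lt continuous_const continuous_re).mem_nhds (by norm_num)
  filter_upwards [this] with z hz using riemannZeta₁_eq_tsum_of_one_lt hz

/-- The abscissa `1/4` leaves room: the arguments `1 + 2s + a_i + b_j` met on the shifted contour
have real part above `1/2`. -/
lemma exists_norm_riemannZeta₁_le :
    ∃ C : ℝ, 1 ≤ C ∧ ∀ s : ℂ, 1 / 4 < s.re → ‖riemannZeta₁ s‖ ≤ C * (1 + ‖s‖) ^ 2 := by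
  have hS := summable_rpow_succ (r := 5 / 4) (by norm_num)
  refine ⟨1 + ∑' n : ℕ, (n + 1 : ℝ) ^ (-(5 / 4 : ℝ)), ?_, fun s hs => ?_⟩
  · have : 0 ≤ ∑' n : ℕ, (n + 1 : ℝ) ^ (-(5 / 4 : ℝ)) := tsum_nonneg fun n => by positivity
    linarith
  rw [riemannZeta₁_eq_tsum hs]
  have h1 : ‖∑' n, zetaTerm n s‖ ≤ (1 + ‖s‖) ^ 2 * ∑' n : ℕ, (n + 1 : ℝ) ^ (-(5 / 4 : ℝ)) :=
    tsum_of_norm_bounded (hS.hasSum.mul_left _) fun n => norm_zetaTerm_le' n hs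
  have h2 : (1 : ℝ) ≤ (1 + ‖s‖) ^ 2 := one_le_pow₀ (by linarith [norm_nonneg s])
  refine (norm_add_le _ _).trans ?_
  rw [norm_one, add_mul, one_mul, mul_comm (∑' n : ℕ, _)]
  exact add_le_add h2 h1

end SixthMoment

end

/-! ### The Dirichlet series of `σ_a σ_b` and its factorisation into zeta functions and a correction
series. -/

section

open Complex Filter Topology ArithmeticFunction

namespace SixthMoment

/-- The arithmetic function `n ↦ n^{-x}`. -/
noncomputable def powAF (x : ℂ) : ArithmeticFunction ℂ :=
  ⟨fun n => if n = 0 then 0 else (n : ℂ) ^ (-x), by simp⟩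

/-- The arithmetic function `n ↦ μ(n) n^{-x}`. -/
noncomputable def moebiusPowAF (x : ℂ) : ArithmeticFunction ℂ :=
  pmul (moebius : ArithmeticFunction ℂ) (powAF x)

lemma powAF_apply {x : ℂ} {n : ℕ} (hn : n ≠ 0) : powAF x n = (n : ℂ) ^ (-x) := by
  simp [powAF, hn]

lemma powAF_mul_apply (x : ℂ) (m n : ℕ) : powAF x (m * n) = powAF x m * powAF x n := by
  rcases eq_or_ne m 0 with rfl | hm
  · simp
  rcases eq_or_ne n 0 with rfl | hn
  · simp
  rw [powAF_apply hm, powAF_apply hn, powAF_apply (mul_ne_zero hm hn), Nat.cast_mul,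
    natCast_mul_natCast_cpow]

lemma powAF_one_apply (x : ℂ) : powAF x 1 = 1 := by
  rw [powAF_apply one_ne_zero]; simp

lemma isMultiplicative_powAF (x : ℂ) : (powAF x).IsMultiplicative :=
  ⟨powAF_one_apply x, fun _ => powAF_mul_apply x _ _⟩

lemma isMultiplicative_moebiusPowAF (x : ℂ) : (moebiusPowAF x).IsMultiplicative :=
  isMultiplicative_moebius.intCast.pmul (isMultiplicative_powAF x)

/-- Complete multiplicativity pulls `n^{-x}` out of the convolution, which leaves `μ * 1`. -/
lemma moebiusPowAF_mul_powAF (x : ℂ) : moebiusPowAF x * powAF x = 1 := by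
  ext n
  have h : ((moebius : ArithmeticFunction ℂ) * (zeta : ArithmeticFunction ℂ)) n =
      (1 : ArithmeticFunction ℂ) n := by rw [coe_moebius_mul_coe_zeta]
  rw [mul_apply] at h ⊢
  have e : ∀ p ∈ n.divisorsAntidiagonal, moebiusPowAF x p.1 * powAF x p.2 =
      powAF x n * ((moebius : ArithmeticFunction ℂ) p.1 * (zeta : ArithmeticFunction ℂ) p.2) := by
    intro p hp
    obtain ⟨h1, h2⟩ := Nat.mem_divisorsAntidiagonal.1 hp
    have hp2 : p.2 ≠ 0 := by rintro h0; simp [h0] at h1; exact h2 h1.symm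
    rw [← h1, powAF_mul_apply, moebiusPowAF, pmul_apply]
    simp [natCoe_apply, zeta_apply, hp2]
    ring
  rw [Finset.sum_congr rfl e, ← Finset.mul_sum, h]
  rcases eq_or_ne n 1 with rfl | hn
  · simp [powAF_one_apply]
  · simp [one_apply_ne hn]

/-- This identifies the sum over tuples that defines `sigma` with a product in the ring of
arithmetic functions, where multiplicativity is available. -/
lemma prod_arithmeticFunction_apply {k : ℕ} (f : Fin k → ArithmeticFunction ℂ) (n : ℕ) :
    (∏ i, f i) n = ∑ d ∈ Nat.finMulAntidiag k n, ∏ i, f i (d i) := by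
  induction k generalizing n with
  | zero =>
    rcases eq_or_ne n 1 with rfl | hn
    · simp [Nat.finMulAntidiag_one]
    · simp [Nat.finMulAntidiag_zero_left hn, one_apply_ne hn]
  | succ k ih =>
    rw [Fin.prod_univ_succ, mul_apply]
    simp_rw [ih, Finset.mul_sum]
    rw [Finset.sum_sigma']
    refine Finset.sum_bij' (fun p _ => Fin.cons p.1.1 p.2)
      (fun d _ => ⟨(d 0, ∏ i : Fin k, d i.succ), fun i => d i.succ⟩) ?_ ?_ ?_ ?_ ?_
    · rintro ⟨⟨x, y⟩, d⟩ h
      simp only [Finset.mem_sigma, Nat.mem_divisorsAntidiagonal, Nat.mem_finMulAntidiag] at h ⊢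
      rw [Fin.prod_univ_succ]
      simp [h]
    · intro d h
      simp only [Finset.mem_sigma, Nat.mem_divisorsAntidiagonal, Nat.mem_finMulAntidiag] at h ⊢
      rw [Fin.prod_univ_succ] at h
      refine ⟨h, trivial, fun h0 => h.2 ?_⟩
      rw [← h.1, h0, mul_zero]
    · rintro ⟨⟨x, y⟩, d⟩ h
      simp only [Finset.mem_sigma, Nat.mem_divisorsAntidiagonal, Nat.mem_finMulAntidiag] at h
      simp [h]
    · intro d h
      exact Fin.cons_self_tail d
    · rintro ⟨⟨x, y⟩, d⟩ h
      rw [Fin.prod_univ_succ]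
      simp

/-- The shifted divisor function as an arithmetic function. -/
noncomputable def sigmaAF (x : Fin 3 → ℂ) : ArithmeticFunction ℂ := ∏ i, powAF (x i)

lemma sigma_eq_sigmaAF (x : Fin 3 → ℂ) (n : ℕ) : sigma x n = sigmaAF x n := by
  rw [sigmaAF, prod_arithmeticFunction_apply, sigma]
  refine Finset.sum_congr rfl fun d hd => Finset.prod_congr rfl fun i _ => ?_
  rw [powAF_apply (Nat.ne_zero_of_mem_finMulAntidiag hd i)]

lemma isMultiplicative_sigmaAF (x : Fin 3 → ℂ) : (sigmaAF x).IsMultiplicative :=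
  isMultiplicative_finsetProd _ _ fun i _ => isMultiplicative_powAF (x i)

/-- The coefficients of `𝒵_{a,b}(s - 1) / ∏ ζ(s + a_i + b_j)`. -/
noncomputable def corrAF (a b : Fin 3 → ℂ) : ArithmeticFunction ℂ :=
  pmul (sigmaAF a) (sigmaAF b) * ∏ p : Fin 3 × Fin 3, moebiusPowAF (a p.1 + b p.2)

lemma isMultiplicative_corrAF (a b : Fin 3 → ℂ) : (corrAF a b).IsMultiplicative :=
  ((isMultiplicative_sigmaAF a).pmul (isMultiplicative_sigmaAF b)).mul
    (isMultiplicative_finsetProd _ _ fun _ _ => isMultiplicative_moebiusPowAF _)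

lemma corrAF_mul_prod_powAF (a b : Fin 3 → ℂ) :
    corrAF a b * ∏ p : Fin 3 × Fin 3, powAF (a p.1 + b p.2) = pmul (sigmaAF a) (sigmaAF b) := by
  rw [corrAF, mul_assoc, ← Finset.prod_mul_distrib]
  simp [moebiusPowAF_mul_powAF]

/-! ### Values at primes -/

lemma mul_apply_prime (f g : ArithmeticFunction ℂ) {p : ℕ} (hp : p.Prime) :
    (f * g) p = f 1 * g p + f p * g 1 := by
  rw [mul_apply, Nat.sum_divisorsAntidiagonal (fun i j => f i * g j), Nat.Prime.sum_divisors hp,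
    Nat.div_self hp.pos, Nat.div_one, add_comm]

lemma prod_apply_one {ι : Type*} (s : Finset ι) (f : ι → ArithmeticFunction ℂ)
    (hf : ∀ i, f i 1 = 1) : (∏ i ∈ s, f i) 1 = 1 := by
  classical
  induction s using Finset.induction with
  | empty => simp
  | insert i s hi ih => rw [Finset.prod_insert hi, mul_apply]; simp [ih, hf]

lemma prod_apply_prime {ι : Type*} (s : Finset ι) (f : ι → ArithmeticFunction ℂ)
    (hf : ∀ i, f i 1 = 1) {p : ℕ} (hp : p.Prime) : (∏ i ∈ s, f i) p = ∑ i ∈ s, f i p := by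
  classical
  induction s using Finset.induction with
  | empty => simp [one_apply_ne hp.one_lt.ne']
  | insert i s hi ih =>
    rw [Finset.prod_insert hi, Finset.sum_insert hi, mul_apply_prime _ _ hp, ih,
      prod_apply_one s f hf, hf]
    ring

/-- A Dirichlet product of functions with value `1` at `1` is additive at primes. The contribution
`∑ p^{-a_i} ∑ p^{-b_j}` of the divisor functions cancels against the nine terms `-p^{-(a_i + b_j)}`.
This moves the abscissa of convergence from `1` to `1/2`. -/
lemma corrAF_apply_prime (a b : Fin 3 → ℂ) {p : ℕ} (hp : p.Prime) : corrAF a b p = 0 := by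
  have hm : ∀ x, moebiusPowAF x p = -powAF x p := by
    intro x
    simp [moebiusPowAF, pmul_apply, moebius_apply_prime hp]
  have hadd : ∀ x y, powAF (x + y) p = powAF x p * powAF y p := by
    intro x y
    rw [powAF_apply hp.ne_zero, powAF_apply hp.ne_zero, powAF_apply hp.ne_zero, neg_add,
      cpow_add _ _ (by exact_mod_cast hp.ne_zero)]
  rw [corrAF, mul_apply_prime _ _ hp,
    prod_apply_one _ _ fun q : Fin 3 × Fin 3 => (isMultiplicative_moebiusPowAF (a q.1 + b q.2)).1,
    prod_apply_prime _ _ (fun q : Fin 3 × Fin 3 => (isMultiplicative_moebiusPowAF (a q.1 + b q.2)).1) hp,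
    pmul_apply, pmul_apply, (isMultiplicative_sigmaAF a).1, (isMultiplicative_sigmaAF b).1,
    sigmaAF, sigmaAF, prod_apply_prime _ _ (fun i => powAF_one_apply (a i)) hp,
    prod_apply_prime _ _ (fun i => powAF_one_apply (b i)) hp, Finset.sum_mul_sum,
    ← Finset.univ_product_univ, Finset.sum_product]
  simp [hm, hadd]

/-! ### Growth at prime powers -/

/-- `‖f(p^k)‖ ≤ (k+1)^m p^{ηk}` for all prime powers. -/
def PrimePowBound (m : ℕ) (η : ℝ) (f : ArithmeticFunction ℂ) : Prop :=
  ∀ p k : ℕ, p.Prime → ‖f (p ^ k)‖ ≤ (k + 1 : ℝ) ^ m * (p : ℝ) ^ (η * k)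

/-- The additional factor `k + 1` counts the divisors of `p^k`. -/
lemma PrimePowBound.mul {m m' : ℕ} {η : ℝ} {f g : ArithmeticFunction ℂ}
    (hf : PrimePowBound m η f) (hg : PrimePowBound m' η g) :
    PrimePowBound (m + m' + 1) η (f * g) := by
  intro p k hp
  have hp0 : (0 : ℝ) < p := by exact_mod_cast hp.pos
  rw [mul_apply, Nat.sum_divisorsAntidiagonal (fun i j => f i * g j), Nat.sum_divisors_prime_pow hp]
  have : ∀ j ∈ Finset.range (k + 1), ‖f (p ^ j) * g (p ^ k / p ^ j)‖ ≤
      (k + 1 : ℝ) ^ (m + m') * (p : ℝ) ^ (η * k) := by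
    intro j hj
    have hjk : j ≤ k := Nat.lt_succ_iff.1 (Finset.mem_range.1 hj)
    rw [Nat.pow_div hjk hp.pos, norm_mul]
    refine (mul_le_mul (hf p j hp) (hg p (k - j) hp) (norm_nonneg _) (by positivity)).trans ?_
    have e : (p : ℝ) ^ (η * k) = (p : ℝ) ^ (η * j) * (p : ℝ) ^ (η * ((k - j : ℕ) : ℝ)) := by
      rw [← Real.rpow_add hp0]; congr 1; push_cast [hjk]; ring
    have hj1 : (j : ℝ) + 1 ≤ k + 1 := by exact_mod_cast Nat.succ_le_succ hjk
    have hj2 : ((k - j : ℕ) : ℝ) + 1 ≤ k + 1 := by exact_mod_cast Nat.succ_le_succ (Nat.sub_le k j)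
    rw [e, pow_add]
    calc _ = ((j + 1 : ℝ) ^ m * (((k - j : ℕ) : ℝ) + 1) ^ m') *
          ((p : ℝ) ^ (η * j) * (p : ℝ) ^ (η * ((k - j : ℕ) : ℝ))) := by ring
      _ ≤ _ := by gcongr
  refine (norm_sum_le_of_le _ this).trans (le_of_eq ?_)
  rw [Finset.sum_const, Finset.card_range, nsmul_eq_mul]
  push_cast
  ring

lemma PrimePowBound.pmul {m m' : ℕ} {η η' : ℝ} {f g : ArithmeticFunction ℂ}
    (hf : PrimePowBound m η f) (hg : PrimePowBound m' η' g) :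
    PrimePowBound (m + m') (η + η') (ArithmeticFunction.pmul f g) := by
  intro p k hp
  have hp0 : (0 : ℝ) < p := by exact_mod_cast hp.pos
  rw [pmul_apply, norm_mul]
  refine (mul_le_mul (hf p k hp) (hg p k hp) (norm_nonneg _) (by positivity)).trans (le_of_eq ?_)
  rw [add_mul, Real.rpow_add hp0, pow_add]
  ring

lemma primePowBound_powAF {η : ℝ} {x : ℂ} (hx : ‖x‖ ≤ η) : PrimePowBound 0 η (powAF x) := by
  intro p k hp
  have hp1 : (1 : ℝ) ≤ p := by exact_mod_cast hp.one_lt.le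
  have hpk : 0 < p ^ k := pow_pos hp.pos k
  rw [powAF_apply hpk.ne', norm_natCast_cpow_of_pos hpk, pow_zero, one_mul, mul_comm η,
    Real.rpow_mul (by positivity), Real.rpow_natCast]
  push_cast
  refine Real.rpow_le_rpow_of_exponent_le (one_le_pow₀ hp1) ?_
  have := abs_re_le_norm x
  rw [neg_re]
  linarith [neg_abs_le x.re]

lemma primePowBound_moebiusPowAF {η : ℝ} {x : ℂ} (hx : ‖x‖ ≤ η) :
    PrimePowBound 0 η (moebiusPowAF x) := by
  intro p k hp
  refine le_trans ?_ (primePowBound_powAF hx p k hp)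
  rw [moebiusPowAF, pmul_apply, norm_mul]
  refine mul_le_of_le_one_left (norm_nonneg _) ?_
  rw [intCoe_apply, Complex.norm_intCast]
  exact_mod_cast abs_moebius_le_one

lemma primePowBound_one {η : ℝ} (hη : 0 ≤ η) : PrimePowBound 0 η 1 := by
  intro p k hp
  have hp1 : (1 : ℝ) ≤ p := by exact_mod_cast hp.one_lt.le
  have h1 : (1 : ℝ) ≤ (p : ℝ) ^ (η * k) := Real.one_le_rpow hp1 (by positivity)
  rw [one_apply]
  split_ifs <;> simp <;> linarith

lemma primePowBound_prod {ι : Type*} (s : Finset ι) {η : ℝ} (hη : 0 ≤ η)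
    (f : ι → ArithmeticFunction ℂ) (hf : ∀ i, PrimePowBound 0 η (f i)) :
    PrimePowBound s.card η (∏ i ∈ s, f i) := by
  classical
  induction s using Finset.induction with
  | empty => simpa using primePowBound_one hη
  | insert i s hi ih =>
    rw [Finset.prod_insert hi, Finset.card_insert_of_notMem hi]
    simpa using (hf i).mul ih

lemma primePowBound_sigmaAF {η : ℝ} {x : Fin 3 → ℂ} (hx : ∀ i, ‖x i‖ ≤ η) :
    PrimePowBound 3 η (sigmaAF x) :=
  primePowBound_prod Finset.univ ((norm_nonneg _).trans (hx 0)) _ fun i => primePowBound_powAF (hx i)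

/-- The exponent is `16 = (3 + 3) + 9 + 1`: two divisor functions, nine Möbius factors and one more
convolution. -/
lemma primePowBound_corrAF {η : ℝ} {a b : Fin 3 → ℂ} (ha : ∀ i, ‖a i‖ ≤ η) (hb : ∀ i, ‖b i‖ ≤ η) :
    PrimePowBound 16 (2 * η) (corrAF a b) := by
  have h0 : 0 ≤ η := (norm_nonneg _).trans (ha 0)
  have h1 := (primePowBound_sigmaAF ha).pmul (primePowBound_sigmaAF hb)
  have h2 := primePowBound_prod (Finset.univ : Finset (Fin 3 × Fin 3)) (η := 2 * η) (by linarith)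
    (fun p => moebiusPowAF (a p.1 + b p.2)) fun p => primePowBound_moebiusPowAF
      ((norm_add_le _ _).trans (by linarith [ha p.1, hb p.2]))
  rw [show η + η = 2 * η by ring] at h1
  have h3 := h1.mul h2
  simpa [corrAF] using h3

/-! ### Summation over all integers -/

lemma summable_shift_pow_mul_geometric (m k₀ : ℕ) {r : ℝ} (hr : 0 ≤ r) (hr1 : r < 1) :
    Summable (fun k : ℕ => ((k + k₀ : ℕ) + 1 : ℝ) ^ m * r ^ k) := by
  rcases eq_or_lt_of_le hr with rfl | hr0
  · refine summable_of_ne_finset_zero (s := {0}) fun k hk => ?_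
    simp at hk
    simp [hk]
  have h := (summable_nat_add_iff (k₀ + 1)).2 (summable_pow_mul_geometric_of_norm_lt_one (R := ℝ) m
    (r := r) (by rwa [Real.norm_of_nonneg hr]))
  refine (h.mul_right ((r ^ (k₀ + 1))⁻¹)).congr fun k => ?_
  rw [pow_add r k (k₀ + 1)]
  field_simp
  push_cast
  ring

/-- A nonnegative multiplicative function that is small at prime powers and vanishes at `p^k` for
`0 < k < k₀` is summable, with an explicit bound. -/
lemma exists_tsum_le_of_multiplicative (m k₀ : ℕ) (hk₀ : 0 < k₀) {θ : ℝ} (hθ0 : 0 < θ)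
    (hθ : 1 < θ * k₀) :
    ∃ B : ℝ, 0 ≤ B ∧ ∀ F : ℕ → ℝ, (∀ n, 0 ≤ F n) → F 0 = 0 → F 1 = 1 →
      (∀ {x y : ℕ}, Nat.Coprime x y → F (x * y) = F x * F y) →
      (∀ p k : ℕ, p.Prime → F (p ^ k) ≤ (k + 1 : ℝ) ^ m * (p : ℝ) ^ (-θ * k)) →
      (∀ p k : ℕ, p.Prime → 0 < k → k < k₀ → F (p ^ k) = 0) →
      Summable F ∧ ∑' n, F n ≤ B := by
  -- Since `p^{-θ} ≤ 2^{-θ}` for all primes, the tails `k ≥ k₀` of all local factors are at most `c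
  -- p^{-θ k₀}` with one constant `c`.
  set r : ℝ := (2 : ℝ) ^ (-θ) with hr
  have hr0 : 0 ≤ r := by positivity
  have hr1 : r < 1 := Real.rpow_lt_one_of_one_lt_of_neg (by norm_num) (by linarith)
  have hs := summable_shift_pow_mul_geometric m k₀ hr0 hr1
  set c := ∑' k : ℕ, ((k + k₀ : ℕ) + 1 : ℝ) ^ m * r ^ k with hc
  have hc0 : 0 ≤ c := tsum_nonneg fun k => by positivity
  have hzs : Summable (fun n : ℕ => (n : ℝ) ^ (-(θ * k₀))) := by
    simpa [Real.rpow_neg] using Real.summable_nat_rpow_inv.2 hθ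
  -- The bound comes from `∏ (1 + c p^{-θ k₀}) ≤ exp (c ∑ p^{-θ k₀})`, with the sum enlarged to all
  -- integers.
  refine ⟨Real.exp (c * ∑' n : ℕ, (n : ℝ) ^ (-(θ * k₀))), (Real.exp_pos _).le, ?_⟩
  intro F hF hF0 hF1 hmul hb hv
  have hpp : ∀ p : ℕ, p.Prime → ∀ k : ℕ, F (p ^ (k + k₀)) ≤
      (p : ℝ) ^ (-(θ * k₀)) * (((k + k₀ : ℕ) + 1 : ℝ) ^ m * r ^ k) := by
    intro p hp k
    have hp0 : (0 : ℝ) < p := by exact_mod_cast hp.pos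
    refine (hb p _ hp).trans ?_
    have h1 : (p : ℝ) ^ (-θ * ((k + k₀ : ℕ) : ℝ)) = (p : ℝ) ^ (-(θ * k₀)) * ((p : ℝ) ^ (-θ)) ^ k := by
      rw [← Real.rpow_natCast, ← Real.rpow_mul hp0.le, ← Real.rpow_add hp0]
      congr 1; push_cast; ring
    have h2 : (p : ℝ) ^ (-θ) ≤ r :=
      Real.rpow_le_rpow_of_nonpos (by norm_num) (by exact_mod_cast hp.two_le) (by linarith)
    rw [h1]
    calc _ = (p : ℝ) ^ (-(θ * k₀)) * (((k + k₀ : ℕ) + 1 : ℝ) ^ m * ((p : ℝ) ^ (-θ)) ^ k) := by ring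
      _ ≤ _ := by gcongr
  have hsp : ∀ p : ℕ, p.Prime → Summable (fun k => F (p ^ k)) := by
    intro p hp
    refine (summable_nat_add_iff k₀).1 ?_
    exact Summable.of_nonneg_of_le (fun k => hF _) (hpp p hp) (hs.mul_left _)
  have htp : ∀ p : ℕ, p.Prime → ∑' k, F (p ^ k) ≤ Real.exp (c * (p : ℝ) ^ (-(θ * k₀))) := by
    intro p hp
    rw [← (hsp p hp).sum_add_tsum_nat_add k₀]
    have h1 : ∑ k ∈ Finset.range k₀, F (p ^ k) = 1 := by
      rw [Finset.sum_eq_single 0]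
      · simpa using hF1
      · intro k hk hk0
        exact hv p k hp (Nat.pos_of_ne_zero hk0) (Finset.mem_range.1 hk)
      · intro h; exact absurd (Finset.mem_range.2 hk₀) h
    have h2 : ∑' k, F (p ^ (k + k₀)) ≤ (p : ℝ) ^ (-(θ * k₀)) * c := by
      rw [hc, ← tsum_mul_left]
      exact Summable.tsum_le_tsum (hpp p hp) ((summable_nat_add_iff k₀).2 (hsp p hp)) (hs.mul_left _)
    rw [h1]
    refine le_trans ?_ (Real.add_one_le_exp _)
    rw [mul_comm c]
    linarith
  have key : ∀ u : Finset ℕ, ∑ n ∈ u, F n ≤ Real.exp (c * ∑' n : ℕ, (n : ℝ) ^ (-(θ * k₀))) := by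
    intro u
    -- Every nonzero element of `u` has all its prime factors below `N`, so the finite sum is
    -- dominated by a finite Euler product, and no prior convergence over all integers is needed.
    obtain ⟨N, hN⟩ : ∃ N, ∀ n ∈ u, n < N := ⟨u.sup id + 1, fun n hn =>
      Nat.lt_succ_of_le (Finset.le_sup (f := id) hn)⟩
    obtain ⟨-, hsum⟩ := EulerProduct.summable_and_hasSum_factoredNumbers_prod_filter_prime_tsum
      hF1 hmul (fun {p} hp => (hsp p hp).norm) (Finset.range N)
    have h1 : ∑ n ∈ u, F n ≤ ∏ p ∈ Finset.range N with p.Prime, ∑' n : ℕ, F (p ^ n) := by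
      rw [← hsum.tsum_eq, tsum_subtype (Nat.factoredNumbers (Finset.range N)) F]
      have hs' : Summable ((Nat.factoredNumbers (Finset.range N)).indicator F) :=
        summable_subtype_iff_indicator.1 hsum.summable
      refine le_trans (Finset.sum_le_sum fun n hn => ?_)
        (hs'.sum_le_tsum u fun n _ => Set.indicator_nonneg (fun n _ => hF n) n)
      rcases eq_or_ne n 0 with rfl | hn0
      · rw [hF0]; exact Set.indicator_nonneg (fun n _ => hF n) 0
      · rw [Set.indicator_of_mem]
        refine Nat.mem_factoredNumbers'.2 fun p hp hpn => Finset.mem_range.2 ?_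
        exact (Nat.le_of_dvd (Nat.pos_of_ne_zero hn0) hpn).trans_lt (hN n hn)
    refine h1.trans ?_
    refine (Finset.prod_le_prod (fun p _ => tsum_nonneg fun k => hF _)
      fun p hp => htp p (Finset.mem_filter.1 hp).2).trans ?_
    rw [← Real.exp_sum, ← Finset.mul_sum]
    refine Real.exp_le_exp.2 (mul_le_mul_of_nonneg_left ?_ hc0)
    exact hzs.sum_le_tsum _ fun n _ => by positivity
  have hS : Summable F := summable_of_sum_le hF key
  exact ⟨hS, hS.tsum_le_of_sum_le key⟩

lemma exists_tsum_norm_term_le (m k₀ : ℕ) (hk₀ : 0 < k₀) {θ : ℝ} (hθ0 : 0 < θ) (hθ : 1 < θ * k₀) :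
    ∃ B : ℝ, 0 ≤ B ∧ ∀ (f : ArithmeticFunction ℂ) (η : ℝ) (s : ℂ), f.IsMultiplicative →
      PrimePowBound m η f → (∀ p k : ℕ, p.Prime → 0 < k → k < k₀ → f (p ^ k) = 0) →
      θ + η ≤ s.re →
      Summable (fun n => ‖LSeries.term f s n‖) ∧ ∑' n, ‖LSeries.term f s n‖ ≤ B := by
  obtain ⟨B, hB, h⟩ := exists_tsum_le_of_multiplicative m k₀ hk₀ hθ0 hθ
  refine ⟨B, hB, fun f η s hf hb hv hs => h _ (fun n => norm_nonneg _) (by simp) ?_ ?_ ?_ ?_⟩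
  · simp [hf.1]
  · intro x y hxy
    rcases eq_or_ne x 0 with rfl | hx
    · simp
    rcases eq_or_ne y 0 with rfl | hy
    · simp
    rw [LSeries.term_of_ne_zero hx, LSeries.term_of_ne_zero hy,
      LSeries.term_of_ne_zero (mul_ne_zero hx hy), hf.2 hxy, Nat.cast_mul, natCast_mul_natCast_cpow,
      ← norm_mul, mul_div_mul_comm]
  · intro p k hp
    have hp0 : (0 : ℝ) < p := by exact_mod_cast hp.pos
    have hp1 : (1 : ℝ) ≤ p := by exact_mod_cast hp.one_lt.le
    have hpk : 0 < p ^ k := pow_pos hp.pos k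
    rw [LSeries.term_of_ne_zero hpk.ne', norm_div, norm_natCast_cpow_of_pos hpk, div_le_iff₀ (by positivity)]
    refine (hb p k hp).trans ?_
    rw [mul_assoc]
    refine mul_le_mul_of_nonneg_left ?_ (by positivity)
    push_cast
    rw [← Real.rpow_natCast, ← Real.rpow_mul hp0.le, ← Real.rpow_add hp0]
    refine Real.rpow_le_rpow_of_exponent_le hp1 ?_
    have : (0 : ℝ) ≤ k := k.cast_nonneg
    nlinarith
  · intro p k hp h1 h2
    have hpk : 0 < p ^ k := pow_pos hp.pos k
    rw [LSeries.term_of_ne_zero hpk.ne', hv p k hp h1 h2]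
    simp

/-- Uniform convergence of the correction factor to the right of `Re s = 1/2`. -/
lemma exists_corrAF_bound {δ : ℝ} (hδ : 0 < δ) :
    ∃ B : ℝ, 0 ≤ B ∧ ∀ a b : Fin 3 → ℂ, (∀ i, ‖a i‖ ≤ δ / 4) → (∀ i, ‖b i‖ ≤ δ / 4) →
      ∀ s : ℂ, 1 / 2 + δ ≤ s.re → LSeriesSummable (corrAF a b) s ∧ ‖LSeries (corrAF a b) s‖ ≤ B := by
  -- Vanishing at primes allows `k₀ = 2`, so `2θ = 1 + δ > 1` suffices. The shifts cost `η = 2 ·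
  -- δ/4`, and `θ + η = 1/2 + δ`.
  obtain ⟨B, hB, h⟩ := exists_tsum_norm_term_le 16 2 (by norm_num) (θ := 1 / 2 + δ / 2)
    (by linarith) (by push_cast; linarith)
  refine ⟨B, hB, fun a b ha hb s hs => ?_⟩
  obtain ⟨h1, h2⟩ := h (corrAF a b) (2 * (δ / 4)) s (isMultiplicative_corrAF a b)
    (primePowBound_corrAF ha hb) (fun p k hp hk hk2 => by
      obtain rfl : k = 1 := by omega
      rw [pow_one, corrAF_apply_prime a b hp]) (by linarith)
  exact ⟨h1.of_norm, (norm_tsum_le_tsum_norm h1).trans h2⟩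

lemma LSeriesSummable_sigma_mul_sigma {η : ℝ} {a b : Fin 3 → ℂ} (ha : ∀ i, ‖a i‖ ≤ η)
    (hb : ∀ i, ‖b i‖ ≤ η) {s : ℂ} (hs : 1 + 2 * η < s.re) :
    LSeriesSummable (fun n => sigma a n * sigma b n) s := by
  have h0 : 0 ≤ η := (norm_nonneg _).trans (ha 0)
  -- With `k₀ = 1` no vanishing is demanded, and the condition on `θ` becomes `θ > 1`.
  obtain ⟨B, hB, h⟩ := exists_tsum_norm_term_le 6 1 (by norm_num) (θ := s.re - 2 * η)
    (by linarith) (by push_cast; linarith)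
  have hpb := (primePowBound_sigmaAF ha).pmul (primePowBound_sigmaAF hb)
  obtain ⟨h1, -⟩ := h (pmul (sigmaAF a) (sigmaAF b)) _ s
    ((isMultiplicative_sigmaAF a).pmul (isMultiplicative_sigmaAF b)) hpb
    (fun p k _ h1 h2 => by omega) (by linarith)
  have h2 : LSeriesSummable (fun n => pmul (sigmaAF a) (sigmaAF b) n) s := h1.of_norm
  simpa only [sigma_eq_sigmaAF, pmul_apply] using h2

/-! ### The Dirichlet series -/

lemma LSeriesHasSum_powAF {x s : ℂ} (hs : 1 < (s + x).re) :
    LSeriesHasSum (powAF x) s (riemannZeta (s + x)) := by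
  have h := LSeriesHasSum_one hs
  rw [LSeriesHasSum] at h ⊢
  refine h.congr_fun fun n => ?_
  rcases eq_or_ne n 0 with rfl | hn
  · simp
  rw [LSeries.term_of_ne_zero hn, LSeries.term_of_ne_zero hn, powAF_apply hn, cpow_neg,
    cpow_add _ _ (by exact_mod_cast hn)]
  simp only [Pi.one_apply]
  field_simp

lemma LSeriesHasSum_prod {ι : Type*} (u : Finset ι) (f : ι → ArithmeticFunction ℂ) (L : ι → ℂ) (s : ℂ)
    (h : ∀ i, LSeriesHasSum (f i) s (L i)) :
    LSeriesHasSum (∏ i ∈ u, f i : ArithmeticFunction ℂ) s (∏ i ∈ u, L i) := by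
  classical
  induction u using Finset.induction with
  | empty =>
    simp only [Finset.prod_empty]
    rw [LSeriesHasSum]
    have h1 : LSeries.term (fun n => (1 : ArithmeticFunction ℂ) n) s 1 = 1 := by
      simp
    have h2 := hasSum_single (f := LSeries.term (fun n => (1 : ArithmeticFunction ℂ) n) s) 1
      fun n hn => by simp [LSeries.term_def, one_apply_ne hn]
    rwa [h1] at h2
  | insert i u hi ih =>
    rw [Finset.prod_insert hi, Finset.prod_insert hi]
    exact LSeriesHasSum_mul (h i) ih

/-- The explicit analytic continuation of `∑ σ_a(n) σ_b(n) n^{-1-w}` to `Re w > -1/2`. -/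
noncomputable def eulerZ (a b : Fin 3 → ℂ) (w : ℂ) : ℂ :=
  (∏ p : Fin 3 × Fin 3, riemannZeta (1 + w + (a p.1 + b p.2))) * LSeries (corrAF a b) (1 + w)

lemma eulerZ_eq_LSeries {δ : ℝ} {a b : Fin 3 → ℂ} (ha : ∀ i, ‖a i‖ ≤ δ / 4)
    (hb : ∀ i, ‖b i‖ ≤ δ / 4) {w : ℂ} (hw : δ < w.re) :
    LSeriesSummable (fun n => sigma a n * sigma b n) (1 + w) ∧
      eulerZ a b w = LSeries (fun n => sigma a n * sigma b n) (1 + w) := by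
  have h0 : 0 ≤ δ / 4 := (norm_nonneg _).trans (ha 0)
  refine ⟨LSeriesSummable_sigma_mul_sigma ha hb (by simp; linarith), ?_⟩
  have hw0 : 0 < w.re := by linarith
  -- This parameter places the boundary of the bound exactly at `Re (1 + w)`; it exceeds `δ`, so the
  -- shifts remain admissible.
  obtain ⟨B, -, hB⟩ := exists_corrAF_bound (δ := 1 / 2 + w.re) (by linarith)
  have hle : δ / 4 ≤ (1 / 2 + w.re) / 4 := by linarith
  obtain ⟨h1, -⟩ := hB a b (fun i => (ha i).trans hle) (fun i => (hb i).trans hle) (1 + w)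
    (by simp; linarith)
  have h2 := LSeriesHasSum_prod (Finset.univ : Finset (Fin 3 × Fin 3))
    (fun p => powAF (a p.1 + b p.2)) (fun p => riemannZeta (1 + w + (a p.1 + b p.2))) (1 + w)
    (fun p => LSeriesHasSum_powAF (by
      have h3 := abs_re_le_norm (a p.1)
      have h4 := abs_re_le_norm (b p.2)
      simp only [add_re, one_re]
      linarith [neg_abs_le (a p.1).re, neg_abs_le (b p.2).re, ha p.1, hb p.2]))
  have h3 := LSeriesHasSum_mul h1.LSeriesHasSum h2
  rw [corrAF_mul_prod_powAF] at h3
  rw [eulerZ, mul_comm, ← h3.LSeries_eq]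
  simp [sigma_eq_sigmaAF, pmul_apply]

end SixthMoment

end

/-! ### Existence and uniqueness of the continuation `𝒵`, its residues, and growth after removal of
the poles. -/

section

open Complex Filter Topology ArithmeticFunction

namespace SixthMoment

lemma differentiableOn_LSeries_corrAF {δ : ℝ} (hδ : 0 < δ) {a b : Fin 3 → ℂ}
    (ha : ∀ i, ‖a i‖ ≤ δ / 4) (hb : ∀ i, ‖b i‖ ≤ δ / 4) :
    DifferentiableOn ℂ (LSeries (corrAF a b)) {s | 1 / 2 + δ < s.re} := by
  obtain ⟨B, -, h⟩ := exists_corrAF_bound hδ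
  obtain ⟨h1, -⟩ := h a b ha hb ((1 / 2 + δ : ℝ) : ℂ) (by rw [ofReal_re])
  refine (LSeries_differentiableOn _).mono fun s hs => ?_
  refine lt_of_le_of_lt h1.abscissaOfAbsConv_le ?_
  rw [ofReal_re]
  exact_mod_cast hs

/-- The nine possible poles of `𝒵_{a,b}`. -/
def poleSet (a b : Fin 3 → ℂ) : Set ℂ := {w : ℂ | ∃ i j, w = -(a i + b j)}

lemma finite_poleSet (a b : Fin 3 → ℂ) : (poleSet a b).Finite := by
  refine (Set.finite_range fun p : Fin 3 × Fin 3 => -(a p.1 + b p.2)).subset ?_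
  rintro w ⟨i, j, rfl⟩
  exact ⟨(i, j), rfl⟩

lemma differentiableOn_eulerZ {δ : ℝ} (hδ : 0 < δ) {a b : Fin 3 → ℂ}
    (ha : ∀ i, ‖a i‖ ≤ δ / 4) (hb : ∀ i, ‖b i‖ ≤ δ / 4) :
    DifferentiableOn ℂ (eulerZ a b) ({w : ℂ | -(1 / 2) + δ < w.re} \ poleSet a b) := by
  refine DifferentiableOn.mul ?_ ?_
  · refine DifferentiableOn.fun_finsetProd fun p _ w hw => DifferentiableAt.differentiableWithinAt ?_
    have hne : 1 + w + (a p.1 + b p.2) ≠ 1 := by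
      intro h
      exact hw.2 ⟨p.1, p.2, by linear_combination h⟩
    exact (differentiableAt_riemannZeta hne).comp w (by fun_prop)
  · refine (differentiableOn_LSeries_corrAF hδ ha hb).comp (by fun_prop) fun w hw => ?_
    have := hw.1
    simp only [Set.mem_ofPred_eq, add_re, one_re] at this ⊢
    linarith

lemma isContinuation_eulerZ {δ : ℝ} (hδ : 0 < δ) (hδ1 : δ ≤ 1 / 4) {a b : Fin 3 → ℂ}
    (ha : ∀ i, ‖a i‖ ≤ δ / 4) (hb : ∀ i, ‖b i‖ ≤ δ / 4) :
    IsContinuation a b (eulerZ a b) := by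
  refine ⟨⟨δ, fun w hw => eulerZ_eq_LSeries ha hb hw⟩, ?_⟩
  refine (differentiableOn_eulerZ hδ ha hb).mono fun w hw => ⟨?_, hw.2⟩
  have := hw.1
  simp only [Set.mem_ofPred_eq] at this ⊢
  linarith

/-- The map `x + iy ↦ e^x + c + iy` carries the plane bijectively and continuously onto the
half-plane, and the plane remains connected when a countable set is removed. -/
lemma isPreconnected_halfPlane_diff (c : ℝ) {S : Set ℂ} (hS : S.Countable) :
    IsPreconnected ({w : ℂ | c < w.re} \ S) := by
  set e : ℂ → ℂ := fun z => ((Real.exp z.re + c : ℝ) : ℂ) + (z.im : ℂ) * I with he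
  have hre : ∀ z, (e z).re = Real.exp z.re + c := fun z => by simp [he, -ofReal_exp]
  have him : ∀ z, (e z).im = z.im := fun z => by simp [he, -ofReal_exp]
  have hinj : Function.Injective e := by
    intro z w h
    refine Complex.ext ?_ ?_
    · have := congrArg re h
      rw [hre, hre] at this
      exact Real.exp_injective (by linarith)
    · have := congrArg im h
      rwa [him, him] at this
  have hc : Continuous e := by
    rw [he]; fun_prop
  have hcount : (e ⁻¹' S).Countable := hS.preimage_of_injOn hinj.injOn
  have h := (hcount.isConnected_compl_of_one_lt_rank (by simp)).isPreconnected.image e hc.continuousOn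
  convert h using 1
  ext w
  constructor
  · rintro ⟨h1, h2⟩
    have h1' : 0 < w.re - c := by
      simp only [Set.mem_ofPred_eq] at h1; linarith
    have hw : e (Real.log (w.re - c) + w.im * I) = w := by
      refine Complex.ext ?_ ?_
      · rw [hre]
        simp [Real.exp_log h1']
      · rw [him]; simp
    exact ⟨_, by simpa [hw] using h2, hw⟩
  · rintro ⟨z, hz, rfl⟩
    refine ⟨?_, hz⟩
    simp only [Set.mem_ofPred_eq, hre]
    linarith [Real.exp_pos z.re]

/-- By the identity theorem the choice made in `calZ` is immaterial off the poles, so that `calZ`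
can be replaced by the explicit `eulerZ`. -/
lemma isContinuation_eqOn {a b : Fin 3 → ℂ} {Z Z' : ℂ → ℂ} (h : IsContinuation a b Z)
    (h' : IsContinuation a b Z') :
    Set.EqOn Z Z' ({w : ℂ | -(1 / 4 : ℝ) < w.re} \ poleSet a b) := by
  obtain ⟨⟨σ, hσ⟩, hd⟩ := h
  obtain ⟨⟨σ', hσ'⟩, hd'⟩ := h'
  have hopen : IsOpen ({w : ℂ | -(1 / 4 : ℝ) < w.re} \ poleSet a b) :=
    (isOpen_lt continuous_const continuous_re).sdiff (finite_poleSet a b).isClosed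
  obtain ⟨M, hM⟩ := (finite_poleSet a b).isBounded.exists_norm_le
  -- A base point to the right of both abscissae of convergence and larger in norm than every pole.
  set x : ℝ := max (max σ σ') (max M 0) + 1 with hx
  have hxσ : σ < x := by have := le_max_left σ σ'; have := le_max_left (max σ σ') (max M 0); linarith
  have hxσ' : σ' < x := by
    have := le_max_right σ σ'; have := le_max_left (max σ σ') (max M 0); linarith
  have hxM : M < x := by have := le_max_left M 0; have := le_max_right (max σ σ') (max M 0); linarith
  have hx0 : 0 < x := by have := le_max_right M 0; have := le_max_right (max σ σ') (max M 0); linarith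
  refine (hd.analyticOnNhd hopen).eqOn_of_preconnected_of_eventuallyEq (hd'.analyticOnNhd hopen)
    (isPreconnected_halfPlane_diff _ (finite_poleSet a b).countable) (z₀ := (x : ℂ)) ⟨?_, ?_⟩ ?_
  · simp only [Set.mem_ofPred_eq, ofReal_re]; linarith
  · intro hm
    have := hM _ hm
    rw [norm_real, Real.norm_of_nonneg hx0.le] at this
    linarith
  · have h1 : ∀ᶠ w : ℂ in 𝓝 (x : ℂ), σ < w.re :=
      (isOpen_lt continuous_const continuous_re).mem_nhds (by simpa using hxσ)
    have h2 : ∀ᶠ w : ℂ in 𝓝 (x : ℂ), σ' < w.re :=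
      (isOpen_lt continuous_const continuous_re).mem_nhds (by simpa using hxσ')
    filter_upwards [h1, h2] with w hw hw'
    rw [(hσ w hw).2, (hσ' w hw').2]

lemma isContinuation_calZ {a b : Fin 3 → ℂ} {Z : ℂ → ℂ} (h : IsContinuation a b Z) :
    IsContinuation a b (calZ a b) :=
  Classical.epsilon_spec (p := IsContinuation a b) ⟨Z, h⟩

/-- A simple pole: the residue of `h(z)/(z - c)` at `c` is `h(c)`. -/
lemma residue_eq_of_eq_div {f h : ℂ → ℂ} {c : ℂ} {r : ℝ} (hr : 0 < r)
    (hh : DifferentiableOn ℂ h (Metric.ball c r))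
    (hf : ∀ z ∈ Metric.ball c r, z ≠ c → f z = h z / (z - c)) : residue f c = h c := by
  refine Tendsto.limUnder_eq ?_
  -- By Cauchy's formula the integral does not depend on the radius once the closed disc lies in the
  -- ball, so the limit is that of an eventually constant function.
  refine tendsto_const_nhds.congr' ?_
  have h1 : ∀ᶠ ρ : ℝ in 𝓝[>] 0, ρ ∈ Set.Ioo 0 r := Ioo_mem_nhdsGT hr
  filter_upwards [h1] with ρ hρ
  have hsub : Metric.closedBall c ρ ⊆ Metric.ball c r := Metric.closedBall_subset_ball hρ.2
  have hC := (hh.mono hsub).circleIntegral_sub_inv_smul (Metric.mem_ball_self hρ.1)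
  have e : (∮ z in C(c, ρ), f z) = ∮ z in C(c, ρ), (z - c)⁻¹ • h z := by
    refine circleIntegral.integral_congr hρ.1.le fun z hz => ?_
    have hz' : z ∈ Metric.ball c r := hsub (Metric.sphere_subset_closedBall hz)
    have hne : z ≠ c := by
      rintro rfl
      simp at hz
      exact hρ.1.ne hz
    simp only [hf z hz' hne, smul_eq_mul]
    rw [div_eq_mul_inv, mul_comm]
  rw [e, hC, smul_eq_mul, ← mul_assoc, inv_mul_cancel₀ two_pi_I_ne_zero, one_mul]

/-- The product of `𝒵_{a,b}(2s)` with its nine polar factors `2s + a_i + b_j`. -/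
noncomputable def regZ (a b : Fin 3 → ℂ) (s : ℂ) : ℂ :=
  (∏ p : Fin 3 × Fin 3, riemannZeta₁ (1 + 2 * s + (a p.1 + b p.2))) * LSeries (corrAF a b) (1 + 2 * s)

/-- The poles of `𝒵_{a,b}(2s)`. -/
noncomputable def poleAt (a b : Fin 3 → ℂ) (p : Fin 3 × Fin 3) : ℂ := (-a p.1 - b p.2) / 2

lemma eulerZ_two_mul {a b : Fin 3 → ℂ} {s : ℂ} (hs : ∀ p, s ≠ poleAt a b p) :
    eulerZ a b (2 * s) = regZ a b s / ∏ p : Fin 3 × Fin 3, (2 * (s - poleAt a b p)) := by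
  have h : ∀ p : Fin 3 × Fin 3, riemannZeta (1 + 2 * s + (a p.1 + b p.2)) =
      riemannZeta₁ (1 + 2 * s + (a p.1 + b p.2)) / (2 * (s - poleAt a b p)) := by
    intro p
    have hne : 1 + 2 * s + (a p.1 + b p.2) ≠ 1 := by
      intro h0
      apply hs p
      rw [poleAt]
      linear_combination h0 / 2
    rw [riemannZeta_eq_inv_sub_mul hne, div_eq_inv_mul]
    congr 2
    rw [poleAt]; ring
  rw [eulerZ, regZ, Finset.prod_congr rfl fun p _ => h p, Finset.prod_div_distrib]
  ring

lemma differentiableOn_regZ {δ : ℝ} (hδ : 0 < δ) {a b : Fin 3 → ℂ}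
    (ha : ∀ i, ‖a i‖ ≤ δ / 4) (hb : ∀ i, ‖b i‖ ≤ δ / 4) :
    DifferentiableOn ℂ (regZ a b) {s : ℂ | -(1 / 4) + δ / 2 < s.re} := by
  refine DifferentiableOn.mul ?_ ?_
  · refine DifferentiableOn.fun_finsetProd fun p _ => Differentiable.differentiableOn ?_
    exact differentiable_riemannZeta₁.comp (by fun_prop)
  · refine (differentiableOn_LSeries_corrAF hδ ha hb).comp (by fun_prop) fun w hw => ?_
    simp only [Set.mem_ofPred_eq, add_re, one_re, mul_re, re_ofNat, im_ofNat, zero_mul, sub_zero] at hw ⊢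
    linarith

/-- Nine zeta factors of quadratic growth give the exponent `18`; the correction series is bounded.
-/
lemma exists_norm_regZ_le {δ : ℝ} (hδ : 0 < δ) (hδ1 : δ ≤ 1 / 4) :
    ∃ C : ℝ, 0 ≤ C ∧ ∀ a b : Fin 3 → ℂ, (∀ i, ‖a i‖ ≤ δ / 4) → (∀ i, ‖b i‖ ≤ δ / 4) →
      ∀ s : ℂ, -(1 / 4) + δ / 2 ≤ s.re → ‖regZ a b s‖ ≤ C * (1 + ‖s‖) ^ 18 := by
  obtain ⟨B, hB, h⟩ := exists_corrAF_bound hδ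
  obtain ⟨C, hC, hz⟩ := exists_norm_riemannZeta₁_le
  refine ⟨(C * 9) ^ 9 * B, by positivity, fun a b ha hb s hs => ?_⟩
  have h1 : ∀ p ∈ (Finset.univ : Finset (Fin 3 × Fin 3)),
      ‖riemannZeta₁ (1 + 2 * s + (a p.1 + b p.2))‖ ≤ C * 9 * (1 + ‖s‖) ^ 2 := by
    intro p _
    have ha' := ha p.1
    have hb' := hb p.2
    have h3 := abs_re_le_norm (a p.1)
    have h4 := abs_re_le_norm (b p.2)
    refine (hz _ ?_).trans ?_
    · simp only [add_re, one_re, mul_re, re_ofNat, im_ofNat, zero_mul, sub_zero]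
      linarith [neg_abs_le (a p.1).re, neg_abs_le (b p.2).re]
    · have h5 : ‖1 + 2 * s + (a p.1 + b p.2)‖ ≤ 1 + 2 * ‖s‖ + (δ / 4 + δ / 4) := by
        refine (norm_add_le _ _).trans (add_le_add ((norm_add_le _ _).trans (by simp)) ?_)
        exact (norm_add_le _ _).trans (add_le_add ha' hb')
      have h6 : 1 + ‖1 + 2 * s + (a p.1 + b p.2)‖ ≤ 3 * (1 + ‖s‖) := by
        linarith [norm_nonneg s]
      have h7 : (1 + ‖1 + 2 * s + (a p.1 + b p.2)‖) ^ 2 ≤ (3 * (1 + ‖s‖)) ^ 2 := by gcongr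
      calc _ ≤ C * (3 * (1 + ‖s‖)) ^ 2 := by gcongr
        _ = _ := by ring
  rw [regZ, norm_mul, norm_prod]
  have h2 := Finset.prod_le_prod (fun p _ => norm_nonneg _) h1
  rw [Finset.prod_const, show (Finset.univ : Finset (Fin 3 × Fin 3)).card = 9 by simp] at h2
  have h3 := (h a b ha hb (1 + 2 * s) (by
    simp only [add_re, one_re, mul_re, re_ofNat, im_ofNat, zero_mul, sub_zero]; linarith)).2
  calc _ ≤ (C * 9 * (1 + ‖s‖) ^ 2) ^ 9 * B := by gcongr
    _ = _ := by ring

end SixthMoment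

end

section

open Complex Filter Topology

namespace SixthMoment

/-! ### Stirling's formula -/

/-- The arguments of `w` and `1 + v` are at most `π/2` in absolute value, the second one strictly,
so their sum does not leave the principal branch. The closed half-plane is allowed because `w = ±i`
occurs below. -/
lemma log_mul_one_add {w v : ℂ} (hw : 0 ≤ w.re) (hw0 : w ≠ 0) (hv : ‖v‖ < 1) :
    log (w * (1 + v)) = log w + log (1 + v) := by
  have hre : 0 < (1 + v).re := by
    have := abs_re_le_norm v
    simp only [add_re, one_re]
    linarith [neg_abs_le v.re]
  have h0 : (1 + v) ≠ 0 := by rintro h; simp [h] at hre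
  refine log_mul hw0 h0 ?_
  have h1 := abs_le.1 (abs_arg_le_pi_div_two_iff.2 hw)
  have h2 := abs_lt.1 (abs_arg_lt_pi_div_two_iff.2 (Or.inl hre))
  exact ⟨by linarith [h1.1, h2.1], by linarith [h1.2, h2.2]⟩

/-- The `n`-th term of Gudermann's series is `stirlingTerm (z + n)`. -/
noncomputable def stirlingTerm (w : ℂ) : ℂ := (w + 1 / 2) * (log (w + 1) - log w) - 1

/-- With `u = 1/w` the term is `(w + 1/2) log(1 + u) - 1`. The summand `1/2` cancels the
contribution of order `u`, so that `-u²/4` and a cubic Taylor remainder multiplied by `w + 1/2` are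
left. -/
lemma norm_stirlingTerm_le {w : ℂ} (hw : 0 ≤ w.re) (hw2 : 2 ≤ ‖w‖) :
    ‖stirlingTerm w‖ ≤ 2 * ‖w‖⁻¹ ^ 2 := by
  have hn : 0 < ‖w‖ := by linarith
  have hw0 : w ≠ 0 := norm_pos_iff.1 hn
  set u := w⁻¹ with hu
  have hun : ‖u‖ = ‖w‖⁻¹ := norm_inv w
  have hu2 : ‖u‖ ≤ 1 / 2 := by
    rw [hun, one_div]
    exact inv_anti₀ (by norm_num) hw2
  have hwu : w * u = 1 := mul_inv_cancel₀ hw0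
  have h1 : log (w + 1) = log w + log (1 + u) := by
    rw [← log_mul_one_add hw hw0 (by linarith)]
    congr 1
    rw [mul_add, hwu, mul_one]
  have h2 := norm_log_sub_logTaylor_le 2 (z := u) (by linarith)
  have h3 : logTaylor 3 u = u - u ^ 2 / 2 := by
    simp [logTaylor, Finset.sum_range_succ]
    ring
  norm_num at h2
  rw [h3] at h2
  set r := log (1 + u) - (u - u ^ 2 / 2) with hr
  have hrb : ‖r‖ ≤ 2 / 3 * ‖u‖ ^ 3 := by
    refine h2.trans ?_
    have : (1 - ‖u‖)⁻¹ ≤ 2 := by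
      rw [show (2 : ℝ) = (1 / 2)⁻¹ by norm_num]
      exact inv_anti₀ (by norm_num) (by linarith)
    have h5 : 0 ≤ ‖u‖ ^ 3 := by positivity
    nlinarith
  have h4 : stirlingTerm w = -(u ^ 2) / 4 + (w + 1 / 2) * r := by
    rw [stirlingTerm, h1, hr]
    linear_combination (1 + (-u) / 2) * hwu
  rw [h4, ← hun]
  refine (norm_add_le _ _).trans ?_
  rw [norm_mul, norm_div, norm_neg, norm_pow]
  have h5 : ‖w + 1 / 2‖ ≤ 5 / 4 * ‖w‖ := by
    refine (norm_add_le _ _).trans ?_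
    norm_num
    linarith
  have hnu : ‖w‖ * ‖u‖ = 1 := by rw [hun, mul_inv_cancel₀ hn.ne']
  have h6 : ‖w + 1 / 2‖ * ‖r‖ ≤ (5 / 4 * ‖w‖) * (2 / 3 * ‖u‖ ^ 3) := by gcongr
  have h7 : (5 / 4 * ‖w‖) * (2 / 3 * ‖u‖ ^ 3) = 5 / 6 * ‖u‖ ^ 2 := by
    calc _ = 5 / 6 * (‖w‖ * ‖u‖) * ‖u‖ ^ 2 := by ring
      _ = _ := by rw [hnu]; ring
  norm_num
  nlinarith [sq_nonneg ‖u‖]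

lemma norm_add_natCast_sq {z : ℂ} (hz : 0 ≤ z.re) (n : ℕ) : (‖z‖ + n) ^ 2 / 2 ≤ ‖z + n‖ ^ 2 := by
  have h1 : ‖z + n‖ ^ 2 = ‖z‖ ^ 2 + 2 * z.re * n + n ^ 2 := by
    rw [← normSq_eq_norm_sq, ← normSq_eq_norm_sq, normSq_apply, normSq_apply]
    simp
    ring
  have : (0 : ℝ) ≤ z.re * n := mul_nonneg hz n.cast_nonneg
  nlinarith [sq_nonneg (‖z‖ - n)]

/-- With `x = ‖z‖ + n`, the bound `1/x² ≤ 1/(x - 1) - 1/x` gives a telescoping majorant, whose sum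
is `O(1/‖z‖)`. -/
lemma norm_stirlingTerm_add_le {z : ℂ} (hz : 0 ≤ z.re) (hz2 : 2 ≤ ‖z‖) (n : ℕ) :
    ‖stirlingTerm (z + n)‖ ≤ 4 * ((‖z‖ + n - 1)⁻¹ - (‖z‖ + (n + 1 : ℕ) - 1)⁻¹) := by
  have hn : (0 : ℝ) ≤ n := n.cast_nonneg
  have h0 := norm_add_natCast_sq hz n
  have h2 : ‖z‖ ≤ ‖z + n‖ := by
    refine (sq_le_sq₀ (norm_nonneg _) (norm_nonneg _)).1 ?_
    have h1 : ‖z + n‖ ^ 2 = ‖z‖ ^ 2 + 2 * z.re * n + n ^ 2 := by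
      rw [← normSq_eq_norm_sq, ← normSq_eq_norm_sq, normSq_apply, normSq_apply]
      simp
      ring
    have : (0 : ℝ) ≤ z.re * n := mul_nonneg hz n.cast_nonneg
    nlinarith
  refine (norm_stirlingTerm_le (by simp; positivity) (hz2.trans h2)).trans ?_
  push_cast
  have e : (‖z‖ + n - 1)⁻¹ - (‖z‖ + (n + 1) - 1)⁻¹ = ((‖z‖ + n - 1) * (‖z‖ + n))⁻¹ := by
    have : ‖z‖ + n - 1 ≠ 0 := by linarith
    have : ‖z‖ + n ≠ 0 := by linarith
    rw [show ‖z‖ + (n + 1) - 1 = ‖z‖ + n by ring]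
    field_simp
    ring
  rw [e, inv_pow]
  have h3 : (‖z + n‖ ^ 2)⁻¹ ≤ ((‖z‖ + n) ^ 2 / 2)⁻¹ := inv_anti₀ (by positivity) h0
  have h4 : ((‖z‖ + n) ^ 2)⁻¹ ≤ ((‖z‖ + n - 1) * (‖z‖ + n))⁻¹ := by
    refine inv_anti₀ (mul_pos (by linarith) (by linarith)) ?_
    nlinarith
  rw [inv_div] at h3
  rw [div_eq_mul_inv] at h3
  linarith

lemma sum_norm_stirlingTerm_le {z : ℂ} (hz : 0 ≤ z.re) (hz2 : 2 ≤ ‖z‖) (N : ℕ) :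
    ∑ n ∈ Finset.range N, ‖stirlingTerm (z + n)‖ ≤ 8 / ‖z‖ := by
  refine (Finset.sum_le_sum fun n _ => norm_stirlingTerm_add_le hz hz2 n).trans ?_
  rw [← Finset.mul_sum, Finset.sum_range_sub']
  have h1 : 0 ≤ (‖z‖ + N - 1)⁻¹ := inv_nonneg.2 (by linarith [N.cast_nonneg (α := ℝ)])
  have h2 : (‖z‖ + (0 : ℕ) - 1)⁻¹ ≤ (‖z‖ / 2)⁻¹ := inv_anti₀ (by linarith) (by push_cast; linarith)
  rw [inv_div] at h2
  have : 8 / ‖z‖ = 4 * (2 / ‖z‖) := by ring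
  rw [this]
  linarith

/-- The remainder in Stirling's formula. -/
noncomputable def stirlingRem (z : ℂ) : ℂ := ∑' n : ℕ, stirlingTerm (z + n)

lemma norm_stirlingRem_le {z : ℂ} (hz : 0 ≤ z.re) (hz2 : 2 ≤ ‖z‖) : ‖stirlingRem z‖ ≤ 8 / ‖z‖ := by
  have h := sum_norm_stirlingTerm_le hz hz2
  have hs := summable_of_sum_range_le (fun n => norm_nonneg _) h
  exact (norm_tsum_le_tsum_norm hs).trans (hs.tsum_le_of_sum_range_le h)

lemma sum_stirlingTerm (z : ℂ) (N : ℕ) :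
    ∑ n ∈ Finset.range N, stirlingTerm (z + n) =
      (z + N - 1 / 2) * log (z + N) - (z - 1 / 2) * log z -
        ∑ n ∈ Finset.range N, log (z + n) - N := by
  induction N with
  | zero => simp
  | succ N ih =>
    rw [Finset.sum_range_succ, ih, Finset.sum_range_succ, stirlingTerm]
    push_cast
    rw [add_assoc z (N : ℂ) 1]
    ring

lemma tendsto_one_add_div_cpow (z : ℂ) :
    Tendsto (fun N : ℕ => exp ((z + N + 1 / 2) * log (1 + z / N))) atTop (𝓝 (exp z)) := by
  have h1 : Tendsto (fun N : ℕ => z / (N : ℂ)) atTop (𝓝 0) := by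
    simpa using tendsto_const_div_atTop_nhds_zero_nat z
  have h2 : Tendsto (fun N : ℕ => log (1 + z / N)) atTop (𝓝 0) := by
    have : ContinuousAt (fun v : ℂ => log (1 + v)) 0 := by
      refine ContinuousAt.clog (by fun_prop) ?_
      simp
    have h := this.tendsto.comp h1
    simp only [add_zero, log_one] at h
    exact h
  have h3 : Tendsto (fun N : ℕ => (N : ℂ) * log (1 + z / N)) atTop (𝓝 z) := by
    refine tendsto_nat_mul_log_one_add_of_tendsto ?_
    refine tendsto_const_nhds.congr' ?_
    filter_upwards [eventually_ne_atTop 0] with N hN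
    have : (N : ℂ) ≠ 0 := by exact_mod_cast hN
    field_simp
  have h4 := h3.add (h2.const_mul (z + 1 / 2))
  rw [mul_zero, add_zero] at h4
  refine (continuous_exp.tendsto z).comp (h4.congr fun N => ?_)
  ring

/-- After exponentiation the sum of logarithms becomes the product in Euler's limit `GammaSeq`, and
choices of branch disappear. As `N` grows, the last factor tends to `e^z / √(2π)` by Stirling's
formula for factorials. -/
lemma exp_sum_stirlingTerm {z : ℂ} (hz : 0 < z.re) {N : ℕ} (hN : N ≠ 0) (hNz : ‖z / N‖ < 1) :
    exp (∑ n ∈ Finset.range N, stirlingTerm (z + n)) =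
      GammaSeq z N * exp (-((z - 1 / 2) * log z)) *
        (exp ((z + N + 1 / 2) * log (1 + z / N)) / (√2 * Stirling.stirlingSeq N : ℝ)) := by
  have hne : ∀ n : ℕ, z + n ≠ 0 := by
    intro n h
    have := congrArg re h
    simp at this
    linarith [n.cast_nonneg (α := ℝ)]
  have hNpos : (0 : ℝ) < N := by exact_mod_cast Nat.pos_of_ne_zero hN
  have hN0 : (N : ℂ) ≠ 0 := by exact_mod_cast hN
  have hprod : exp (∑ n ∈ Finset.range N, log (z + n)) = ∏ n ∈ Finset.range N, (z + n) := by
    rw [exp_sum]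
    exact Finset.prod_congr rfl fun n _ => exp_log (hne n)
  have hP : ∏ n ∈ Finset.range N, (z + (n : ℂ)) ≠ 0 := Finset.prod_ne_zero_iff.2 fun n _ => hne n
  have hlog : log (z + N) = log N + log (1 + z / N) := by
    rw [← log_mul_one_add (by simp) hN0 hNz]
    congr 1
    field_simp
    ring
  have hfac : (N.factorial : ℂ) ≠ 0 := by exact_mod_cast N.factorial_ne_zero
  have hst : ((√2 * Stirling.stirlingSeq N : ℝ) : ℂ) =
      N.factorial / (exp ((N + 1 / 2) * log N) * exp (-N)) := by
    have hr : √2 * Stirling.stirlingSeq N =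
        N.factorial / (Real.exp ((N + 1 / 2) * Real.log N) * Real.exp (-N)) := by
      rw [Stirling.stirlingSeq, Real.sqrt_mul (by norm_num)]
      have e1 : Real.exp ((N + 1 / 2) * Real.log N) = (N : ℝ) ^ N * √N := by
        rw [add_mul, Real.exp_add, Real.sqrt_eq_rpow, Real.rpow_def_of_pos hNpos, mul_comm (N : ℝ),
          Real.exp_mul, Real.exp_log hNpos, Real.rpow_natCast, mul_comm (1 / 2 : ℝ)]
      have e2 : Real.exp (-N) = (Real.exp 1 ^ N)⁻¹ := by
        rw [← Real.exp_nat_mul, mul_one, Real.exp_neg]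
      rw [e1, e2, div_pow]
      have h2 : √2 ≠ 0 := by positivity
      have h3 : √(N : ℝ) ≠ 0 := by positivity
      field_simp
    rw [hr]
    push_cast
    rw [← natCast_log]
  have hcpow : (N : ℂ) ^ z = exp (z * log N) := by
    rw [cpow_def_of_ne_zero hN0, mul_comm]
  rw [sum_stirlingTerm, GammaSeq, Finset.prod_range_succ, hst, hcpow]
  have e1 : (z + N - 1 / 2) * log (z + N) - (z - 1 / 2) * log z -
        ∑ n ∈ Finset.range N, log (z + n) - N =
      ((z + N + 1 / 2) * log (1 + z / N) + z * log N + (N + 1 / 2) * log N + (-N) +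
        -((z - 1 / 2) * log z)) - ∑ n ∈ Finset.range N, log (z + n) - log (z + N) := by
    linear_combination (z + N + 1 / 2) * hlog
  rw [e1, exp_sub, exp_sub, hprod, exp_log (hne N), exp_add, exp_add, exp_add, exp_add]
  have := hne N
  have h5 := exp_ne_zero ((N + 1 / 2) * log N)
  have h6 := exp_ne_zero (-(N : ℂ))
  field_simp

/-- Stirling's formula with an explicit remainder. -/
theorem Gamma_eq_stirling {z : ℂ} (hz : 0 < z.re) (hz2 : 2 ≤ ‖z‖) :
    Gamma z = (√(2 * Real.pi) : ℝ) * exp ((z - 1 / 2) * log z - z + stirlingRem z) := by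
  have hs : Summable fun n : ℕ => stirlingTerm (z + n) := Summable.of_norm
    (summable_of_sum_range_le (fun n => norm_nonneg _) (sum_norm_stirlingTerm_le hz.le hz2))
  have h1 : Tendsto (fun N : ℕ => exp (∑ n ∈ Finset.range N, stirlingTerm (z + n))) atTop
      (𝓝 (exp (stirlingRem z))) := (continuous_exp.tendsto _).comp hs.hasSum.tendsto_sum_nat
  have h3 : Tendsto (fun N : ℕ => ((√2 * Stirling.stirlingSeq N : ℝ) : ℂ)) atTop
      (𝓝 ((√2 * √Real.pi : ℝ) : ℂ)) :=
    (continuous_ofReal.tendsto _).comp (Stirling.tendsto_stirlingSeq_sqrt_pi.const_mul _)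
  have hpi : ((√2 * √Real.pi : ℝ) : ℂ) ≠ 0 := by
    have : √2 * √Real.pi ≠ 0 := by positivity
    exact_mod_cast this
  have h2 := ((GammaSeq_tendsto_Gamma z).mul_const (exp (-((z - 1 / 2) * log z)))).mul
    ((tendsto_one_add_div_cpow z).div h3 hpi)
  have h4 : Tendsto (fun N : ℕ => ‖z / N‖) atTop (𝓝 0) := by
    simpa using (tendsto_const_div_atTop_nhds_zero_nat z).norm
  have h5 : exp (stirlingRem z) = _ := tendsto_nhds_unique h1 (h2.congr' (by
    filter_upwards [eventually_ne_atTop 0, h4.eventually_lt_const one_pos] with N hN hN1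
    exact (exp_sum_stirlingTerm hz hN hN1).symm))
  rw [exp_add, h5, exp_sub, exp_neg, Real.sqrt_mul (by norm_num)]
  have := exp_ne_zero z
  have := exp_ne_zero ((z - 1 / 2) * log z)
  field_simp

end SixthMoment

end

section

open Complex Filter Topology

namespace SixthMoment

/-! ### The size of the Gamma function in vertical strips -/

/-- From `‖z‖ sin(π/2 - |arg z|) = Re z` and Jordan's inequality, the defect `‖z‖ (π/2 - |arg z|)`
is at most `(π/2) Re z`. This yields the factor `e^{-π|Im z|/2}` in the size of `Γ`. -/
lemma im_mul_arg_bounds {z : ℂ} (hz : 0 < z.re) :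
    Real.pi / 2 * |z.im| - Real.pi / 2 * z.re ≤ z.im * arg z ∧
      z.im * arg z ≤ Real.pi / 2 * |z.im| := by
  have hφ : |arg z| < Real.pi / 2 := abs_arg_lt_pi_div_two_iff.2 (Or.inl hz)
  have h1 : z.im * arg z = |z.im| * |arg z| := by
    rcases le_or_gt 0 z.im with h | h
    · rw [abs_of_nonneg h, abs_of_nonneg (arg_nonneg_iff.2 h)]
    · rw [abs_of_neg h, abs_of_neg (arg_neg_iff.2 h)]; ring
  have h2 : ‖z‖ * Real.sin (Real.pi / 2 - |arg z|) = z.re := by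
    rw [Real.sin_pi_div_two_sub, Real.cos_abs, norm_mul_cos_arg]
  have h3 := Real.mul_le_sin (x := Real.pi / 2 - |arg z|) (by linarith)
    (by linarith [abs_nonneg (arg z)])
  have h4 : ‖z‖ * (2 / Real.pi * (Real.pi / 2 - |arg z|)) ≤ z.re := by
    rw [← h2]
    exact mul_le_mul_of_nonneg_left h3 (norm_nonneg _)
  have hpi := Real.pi_pos
  have h5 : ‖z‖ * (Real.pi / 2 - |arg z|) ≤ Real.pi / 2 * z.re := by
    have : ‖z‖ * (Real.pi / 2 - |arg z|) =
        Real.pi / 2 * (‖z‖ * (2 / Real.pi * (Real.pi / 2 - |arg z|))) := by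
      field_simp
    rw [this]
    gcongr
  have h6 : |z.im| * (Real.pi / 2 - |arg z|) ≤ ‖z‖ * (Real.pi / 2 - |arg z|) :=
    mul_le_mul_of_nonneg_right (abs_im_le_norm z) (by linarith)
  rw [h1]
  constructor
  · nlinarith
  · nlinarith [abs_nonneg z.im]

lemma abs_log_sub_log_le {x y k : ℝ} (hx : 0 < x) (hy : 0 < y) (hk : 0 < k) (h1 : x ≤ k * y)
    (h2 : y ≤ k * x) : |Real.log x - Real.log y| ≤ k := by
  have e1 := Real.log_le_log hx h1
  have e2 := Real.log_le_log hy h2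
  rw [Real.log_mul hk.ne' hy.ne'] at e1
  rw [Real.log_mul hk.ne' hx.ne'] at e2
  have e3 := Real.log_le_sub_one_of_pos hk
  rw [abs_le]
  constructor <;> linarith

/-- The main term of `log ‖Γ(z)‖` in vertical strips. -/
noncomputable def logGammaSize (z : ℂ) : ℝ :=
  (z.re - 1 / 2) * Real.log (1 + |z.im|) - Real.pi / 2 * |z.im|

lemma log_norm_Gamma_of_two_le {z : ℂ} (hz : 0 < z.re) (hz4 : z.re ≤ 4) (hz2 : 2 ≤ ‖z‖) :
    |Real.log ‖Gamma z‖ - logGammaSize z| ≤ |Real.log √(2 * Real.pi)| + 40 := by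
  have hn : 0 < ‖z‖ := by linarith
  have hsq : (0 : ℝ) < √(2 * Real.pi) := Real.sqrt_pos.2 (by positivity)
  have h1 : Real.log ‖Gamma z‖ = Real.log √(2 * Real.pi) +
      ((z.re - 1 / 2) * Real.log ‖z‖ - z.im * arg z - z.re + (stirlingRem z).re) := by
    rw [Gamma_eq_stirling hz hz2, norm_mul, norm_exp, norm_real, Real.norm_of_nonneg hsq.le,
      Real.log_mul hsq.ne' (Real.exp_pos _).ne', Real.log_exp]
    simp [log_re, log_im]
  have h2 : |Real.log ‖z‖ - Real.log (1 + |z.im|)| ≤ 4 := by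
    refine abs_log_sub_log_le hn (by positivity) (by norm_num) ?_ ?_
    · have := norm_le_abs_re_add_abs_im z
      rw [abs_of_pos hz] at this
      linarith [abs_nonneg z.im]
    · linarith [abs_im_le_norm z]
  have h3 : |(stirlingRem z).re| ≤ 4 := by
    refine (abs_re_le_norm _).trans ((norm_stirlingRem_le hz.le hz2).trans ?_)
    rw [div_le_iff₀ hn]; linarith
  obtain ⟨h4, h5⟩ := im_mul_arg_bounds hz
  have h6 : |(z.re - 1 / 2) * (Real.log ‖z‖ - Real.log (1 + |z.im|))| ≤ 4 * 4 := by
    rw [abs_mul]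
    refine mul_le_mul (abs_le.2 ⟨by linarith, by linarith⟩) h2 (abs_nonneg _) (by norm_num)
  have h7 : Real.pi / 2 * z.re ≤ 8 := by nlinarith [Real.pi_le_four, Real.pi_pos]
  rw [h1, logGammaSize]
  rw [abs_le] at h3 h6 ⊢
  have h8 := abs_le.1 (le_refl |Real.log √(2 * Real.pi)|)
  constructor <;> linarith [h3.1, h3.2, h6.1, h6.2, h8.1, h8.2]

/-- The recurrence `Γ(z + 2) = (z + 1) z Γ(z)` moves small arguments into the range of Stirling's
formula. Each of the two new factors is comparable with `1 + |Im z|`, which costs `32` in the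
logarithm. -/
lemma exists_abs_log_norm_Gamma_sub_le :
    ∃ C : ℝ, 0 ≤ C ∧ ∀ z : ℂ, 1 / 16 ≤ z.re → z.re ≤ 2 →
      |Real.log ‖Gamma z‖ - logGammaSize z| ≤ C := by
  refine ⟨|Real.log √(2 * Real.pi)| + 40 + 64, by positivity, fun z hz hz2 => ?_⟩
  have hz0 : z ≠ 0 := by rintro rfl; norm_num at hz
  have hz1 : z + 1 ≠ 0 := by
    intro h
    have := congrArg re h
    simp at this; linarith
  have h1 : Gamma (z + 2) = (z + 1) * (z * Gamma z) := by
    rw [show z + 2 = (z + 1) + 1 by ring, Gamma_add_one _ hz1, Gamma_add_one _ hz0]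
  have hG : Gamma z ≠ 0 := Gamma_ne_zero_of_re_pos (by linarith)
  have hre : (z + 2).re = z.re + 2 := by simp
  have him : (z + 2).im = z.im := by simp
  have h2 := log_norm_Gamma_of_two_le (z := z + 2) (by rw [hre]; linarith) (by rw [hre]; linarith)
    (by
      have := re_le_norm (z + 2)
      rw [hre] at this; linarith)
  have h3 : Real.log ‖Gamma (z + 2)‖ = Real.log ‖z + 1‖ + Real.log ‖z‖ + Real.log ‖Gamma z‖ := by
    rw [h1, norm_mul, norm_mul, Real.log_mul (norm_ne_zero_iff.2 hz1)
      (mul_ne_zero (norm_ne_zero_iff.2 hz0) (norm_ne_zero_iff.2 hG)),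
      Real.log_mul (norm_ne_zero_iff.2 hz0) (norm_ne_zero_iff.2 hG)]
    ring
  have h4 : logGammaSize (z + 2) = logGammaSize z + 2 * Real.log (1 + |z.im|) := by
    rw [logGammaSize, logGammaSize, hre, him]; ring
  have hr := norm_le_abs_re_add_abs_im z
  have hr1 := norm_le_abs_re_add_abs_im (z + 1)
  have hp1 : (z + 1).re = z.re + 1 := by simp
  have hp2 : (z + 1).im = z.im := by simp
  rw [hp1, hp2, abs_of_pos (by linarith)] at hr1
  rw [abs_of_pos (by linarith)] at hr
  have hi := abs_im_le_norm z
  have hi1 := abs_im_le_norm (z + 1)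
  have hq := re_le_norm z
  have hq1 := re_le_norm (z + 1)
  rw [hp1] at hq1
  rw [hp2] at hi1
  have ha := abs_nonneg z.im
  have h5 : |Real.log ‖z‖ - Real.log (1 + |z.im|)| ≤ 32 :=
    abs_log_sub_log_le (norm_pos_iff.2 hz0) (by positivity) (by norm_num) (by linarith) (by linarith)
  have h6 : |Real.log ‖z + 1‖ - Real.log (1 + |z.im|)| ≤ 32 :=
    abs_log_sub_log_le (norm_pos_iff.2 hz1) (by positivity) (by norm_num) (by linarith) (by linarith)
  rw [h3, h4] at h2
  rw [abs_le] at h2 h5 h6 ⊢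
  constructor <;> linarith [h2.1, h2.2, h5.1, h5.2, h6.1, h6.2]

lemma log_one_add_abs_le (x y : ℝ) :
    Real.log (1 + |x|) ≤ Real.log (1 + |y|) + Real.log (1 + |x - y|) := by
  rw [← Real.log_mul (by positivity) (by positivity)]
  refine Real.log_le_log (by positivity) ?_
  have h1 : |x| ≤ |y| + |x - y| := by
    have := abs_add_le y (x - y)
    simpa using this
  nlinarith [abs_nonneg y, abs_nonneg (x - y), mul_nonneg (abs_nonneg y) (abs_nonneg (x - y))]

/-- The factor `3/2` is the maximum of `|Re z - 1/2|` in the strip; it multiplies the change of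
`log(1 + |Im|)` between the two heights. -/
lemma exists_log_norm_Gamma_sub_le :
    ∃ C : ℝ, 0 ≤ C ∧ ∀ z w : ℂ, 1 / 16 ≤ z.re → z.re ≤ 2 → 1 / 16 ≤ w.re → w.re ≤ 2 →
      Real.log ‖Gamma z‖ - Real.log ‖Gamma w‖ ≤ C + (z.re - w.re) * Real.log (1 + |w.im|) +
        3 / 2 * Real.log (1 + |z.im - w.im|) - Real.pi / 2 * (|z.im| - |w.im|) := by
  obtain ⟨C, hC, h⟩ := exists_abs_log_norm_Gamma_sub_le
  refine ⟨2 * C, by positivity, fun z w hz hz2 hw hw2 => ?_⟩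
  have h1 := abs_le.1 (h z hz hz2)
  have h2 := abs_le.1 (h w hw hw2)
  have h3 := log_one_add_abs_le z.im w.im
  have h4 := log_one_add_abs_le w.im z.im
  rw [abs_sub_comm] at h4
  have h5 : (0 : ℝ) ≤ Real.log (1 + |z.im - w.im|) :=
    Real.log_nonneg (by linarith [abs_nonneg (z.im - w.im)])
  have h6 : (z.re - 1 / 2) * (Real.log (1 + |z.im|) - Real.log (1 + |w.im|)) ≤
      3 / 2 * Real.log (1 + |z.im - w.im|) := by
    rcases le_total (1 / 2) z.re with h0 | h0 <;> nlinarith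
  simp only [logGammaSize] at h1 h2
  linarith [h1.2, h2.1]

/-- A pair of factors of `g(s,t)`. -/
noncomputable def gammaPair (u v : ℂ) (s : ℂ) (t : ℝ) : ℂ :=
  (Gamma ((u + s + I * t) / 2) * Gamma ((v + s - I * t) / 2)) /
    (Gamma ((u + I * t) / 2) * Gamma ((v - I * t) / 2))

lemma gFactor_eq_prod_gammaPair (a b : Fin 3 → ℂ) (s : ℂ) (t : ℝ) :
    gFactor a b s t = ∏ i, gammaPair (1 / 2 + a i) (1 / 2 + b i) s t := rfl

/-- Upper bound for the Gamma quotient, uniform in the vertical strip. -/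
lemma exists_norm_gammaPair_le :
    ∃ C : ℝ, 1 ≤ C ∧ ∀ (u v s : ℂ) (t : ℝ), ‖u - 1 / 2‖ ≤ 1 / 16 → ‖v - 1 / 2‖ ≤ 1 / 16 →
      -(1 / 4) ≤ s.re → s.re ≤ 1 → 1 ≤ t →
      ‖gammaPair u v s t‖ ≤ C * t ^ s.re * (1 + |s.im|) ^ 3 := by
  obtain ⟨C, hC, h⟩ := exists_log_norm_Gamma_sub_le
  refine ⟨Real.exp (2 * C + 10), Real.one_le_exp (by linarith), fun u v s t hu hv hs hs1 ht => ?_⟩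
  have ht0 : 0 < t := by linarith
  have hur := abs_le.1 ((abs_re_le_norm _).trans hu)
  have hui := abs_le.1 ((abs_im_le_norm _).trans hu)
  have hvr := abs_le.1 ((abs_re_le_norm _).trans hv)
  have hvi := abs_le.1 ((abs_im_le_norm _).trans hv)
  norm_num at hur hui hvr hvi
  set z := (u + s + I * t) / 2 with hz
  set z' := (v + s - I * t) / 2 with hz'
  set w := (u + I * t) / 2 with hw
  set w' := (v - I * t) / 2 with hw'
  have e1 : z.re = (u.re + s.re) / 2 := by simp [hz]
  have e2 : z.im = (u.im + s.im + t) / 2 := by simp [hz]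
  have e3 : z'.re = (v.re + s.re) / 2 := by simp [hz']
  have e4 : z'.im = (v.im + s.im - t) / 2 := by simp [hz']
  have e5 : w.re = u.re / 2 := by simp [hw]
  have e6 : w.im = (u.im + t) / 2 := by simp [hw]
  have e7 : w'.re = v.re / 2 := by simp [hw']
  have e8 : w'.im = (v.im - t) / 2 := by simp [hw']
  have hgp : gammaPair u v s t = (Gamma z * Gamma z') / (Gamma w * Gamma w') := rfl
  clear_value z z' w w'
  have h1 := h z w (by rw [e1]; linarith) (by rw [e1]; linarith) (by rw [e5]; linarith)
    (by rw [e5]; linarith)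
  have h2 := h z' w' (by rw [e3]; linarith) (by rw [e3]; linarith) (by rw [e7]; linarith)
    (by rw [e7]; linarith)
  have hg : ∀ x : ℂ, 0 < x.re → 0 < ‖Gamma x‖ := fun x hx => norm_pos_iff.2 (Gamma_ne_zero_of_re_pos hx)
  have gz := hg z (by rw [e1]; linarith)
  have gz' := hg z' (by rw [e3]; linarith)
  have gw := hg w (by rw [e5]; linarith)
  have gw' := hg w' (by rw [e7]; linarith)
  have a1 : |Real.log (1 + |w.im|) - Real.log t| ≤ 4 := by
    refine abs_log_sub_log_le (by positivity) ht0 (by norm_num) ?_ ?_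
    · rw [e6, abs_of_pos (by linarith)]; linarith
    · rw [e6, abs_of_pos (by linarith)]; linarith
  have a2 : |Real.log (1 + |w'.im|) - Real.log t| ≤ 4 := by
    refine abs_log_sub_log_le (by positivity) ht0 (by norm_num) ?_ ?_
    · rw [e8, abs_of_neg (by linarith)]; linarith
    · rw [e8, abs_of_neg (by linarith)]; linarith
  have a3 : Real.log (1 + |s.im / 2|) ≤ Real.log (1 + |s.im|) := by
    refine Real.log_le_log (by positivity) ?_
    rw [abs_div, abs_two]
    linarith [abs_nonneg s.im]
  -- The exponential factors cannot grow: `|Im z| + |Im z'| ≥ Im z - Im z'`, in which `Im s`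
  -- cancels, and this equals `|Im w| + |Im w'|`.
  have a4 : |w.im| + |w'.im| - |z.im| - |z'.im| ≤ 1 := by
    have b1 : |w.im| = (u.im + t) / 2 := by rw [e6, abs_of_pos (by linarith)]
    have b2 : |w'.im| = -((v.im - t) / 2) := by rw [e8, abs_of_neg (by linarith)]
    have b3 := le_abs_self z.im
    have b4 := neg_le_abs z'.im
    rw [b1, b2]
    rw [e2] at b3
    rw [e4] at b4
    rw [e2, e4]
    linarith
  have a5 : Real.pi / 2 * (|w.im| + |w'.im| - |z.im| - |z'.im|) ≤ 2 := by
    refine (mul_le_mul_of_nonneg_left a4 (by positivity)).trans ?_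
    linarith only [Real.pi_le_four]
  have c1 : z.im - w.im = s.im / 2 := by rw [e2, e6]; ring
  have c2 : z'.im - w'.im = s.im / 2 := by rw [e4, e8]; ring
  have c3 : z.re - w.re = s.re / 2 := by rw [e1, e5]; ring
  have c4 : z'.re - w'.re = s.re / 2 := by rw [e3, e7]; ring
  rw [c1, c3] at h1
  rw [c2, c4] at h2
  have hs2 : |s.re / 2| ≤ 1 / 2 := abs_le.2 ⟨by linarith, by linarith⟩
  have a6 : s.re / 2 * (Real.log (1 + |w.im|) - Real.log t) ≤ 2 := by
    refine (le_abs_self _).trans ?_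
    rw [abs_mul]
    exact (mul_le_mul hs2 a1 (abs_nonneg _) (by norm_num)).trans (by norm_num)
  have a7 : s.re / 2 * (Real.log (1 + |w'.im|) - Real.log t) ≤ 2 := by
    refine (le_abs_self _).trans ?_
    rw [abs_mul]
    exact (mul_le_mul hs2 a2 (abs_nonneg _) (by norm_num)).trans (by norm_num)
  -- Each of the two Gamma ratios contributes `(Re s)/2` to the exponent of `t` and `3/2` to that of
  -- `1 + |Im s|`.
  have key : Real.log ‖gammaPair u v s t‖ ≤
      (2 * C + 10) + s.re * Real.log t + 3 * Real.log (1 + |s.im|) := by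
    rw [hgp, norm_div, norm_mul, norm_mul, Real.log_div (mul_pos gz gz').ne' (mul_pos gw gw').ne',
      Real.log_mul gz.ne' gz'.ne', Real.log_mul gw.ne' gw'.ne']
    linarith only [h1, h2, a3, a5, a6, a7]
  have hpos : 0 < ‖gammaPair u v s t‖ := by
    rw [hgp, norm_div, norm_mul, norm_mul]
    exact div_pos (mul_pos gz gz') (mul_pos gw gw')
  rw [← Real.exp_log hpos]
  refine (Real.exp_le_exp.2 key).trans (le_of_eq ?_)
  rw [Real.exp_add, Real.exp_add, mul_comm s.re, ← Real.rpow_def_of_pos ht0, mul_comm (3 : ℝ),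
    Real.exp_mul, Real.exp_log (by positivity)]
  norm_num

lemma exists_norm_gFactor_le :
    ∃ C : ℝ, 1 ≤ C ∧ ∀ (a b : Fin 3 → ℂ) (s : ℂ) (t : ℝ), (∀ i, ‖a i‖ ≤ 1 / 16) →
      (∀ i, ‖b i‖ ≤ 1 / 16) → -(1 / 4) ≤ s.re → s.re ≤ 1 → 1 ≤ t →
      ‖gFactor a b s t‖ ≤ C * t ^ (3 * s.re) * (1 + |s.im|) ^ 9 := by
  obtain ⟨C, hC, h⟩ := exists_norm_gammaPair_le
  refine ⟨C ^ 3, one_le_pow₀ hC, fun a b s t ha hb hs hs1 ht => ?_⟩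
  have ht0 : 0 < t := by linarith
  rw [gFactor_eq_prod_gammaPair, norm_prod]
  have := Finset.prod_le_prod (s := Finset.univ) (fun i _ => norm_nonneg _)
    fun i _ => h (1 / 2 + a i) (1 / 2 + b i) s t (by simpa using ha i) (by simpa using hb i) hs hs1 ht
  refine this.trans (le_of_eq ?_)
  rw [Finset.prod_const, Finset.card_univ, Fintype.card_fin, mul_comm 3 s.re, Real.rpow_mul ht0.le]
  norm_num
  ring

/-! ### Asymptotics of Gamma quotients -/

/-- With `v = h/z`, the difference of the two Stirling exponents is `h log z` plus `z (log(1 + v) -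
v)`, `(h - 1/2) log(1 + v)` and the two remainders, each of them `O(1/‖z‖)`. -/
lemma exists_Gamma_add_eq :
    ∃ C : ℝ, 0 ≤ C ∧ ∀ z h : ℂ, 0 < z.re → 0 < (z + h).re → ‖h‖ ≤ 1 → 4 ≤ ‖z‖ →
      ∃ ρ : ℂ, ‖ρ‖ ≤ C / ‖z‖ ∧ Gamma (z + h) = Gamma z * exp (h * log z + ρ) := by
  refine ⟨30, by norm_num, fun z h hz hzh hh hz4 => ?_⟩
  have hn : 0 < ‖z‖ := by linarith
  have hz0 : z ≠ 0 := norm_pos_iff.1 hn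
  set v := h / z with hv
  have hvn : ‖v‖ = ‖h‖ / ‖z‖ := norm_div h z
  have hv1 : ‖v‖ ≤ 1 / ‖z‖ := by rw [hvn]; gcongr
  have hv4 : ‖v‖ ≤ 1 / 4 := hv1.trans (by gcongr)
  have hzv : z * v = h := mul_div_cancel₀ h hz0
  have hlog : log (z + h) = log z + log (1 + v) := by
    rw [← log_mul_one_add hz.le hz0 (by linarith), mul_add, hzv, mul_one]
  have hzh2 : ‖z‖ / 2 ≤ ‖z + h‖ := by
    have := norm_sub_le (z + h) h
    rw [add_sub_cancel_right] at this
    linarith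
  have hL : ‖log (1 + v)‖ ≤ 3 / 2 * ‖v‖ := norm_log_one_add_half_le_self (by linarith)
  have hL2 : ‖log (1 + v) - v‖ ≤ ‖v‖ ^ 2 := by
    refine (norm_log_one_add_sub_self_le (by linarith)).trans ?_
    have : (1 - ‖v‖)⁻¹ ≤ 2 := by
      rw [show (2 : ℝ) = (1 / 2)⁻¹ by norm_num]
      exact inv_anti₀ (by norm_num) (by linarith)
    nlinarith [sq_nonneg ‖v‖]
  refine ⟨z * (log (1 + v) - v) + (h - 1 / 2) * log (1 + v) + stirlingRem (z + h) - stirlingRem z,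
    ?_, ?_⟩
  · have b1 : ‖z * (log (1 + v) - v)‖ ≤ 1 / ‖z‖ := by
      rw [norm_mul]
      calc ‖z‖ * ‖log (1 + v) - v‖ ≤ ‖z‖ * (1 / ‖z‖) ^ 2 := by
            gcongr
            exact hL2.trans (by gcongr)
        _ = 1 / ‖z‖ := by field_simp
    have b2 : ‖(h - 1 / 2) * log (1 + v)‖ ≤ 3 / ‖z‖ := by
      rw [norm_mul]
      have : ‖h - 1 / 2‖ ≤ 2 := by
        refine (norm_sub_le _ _).trans ?_
        norm_num
        linarith
      calc ‖h - 1 / 2‖ * ‖log (1 + v)‖ ≤ 2 * (3 / 2 * (1 / ‖z‖)) := by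
            gcongr
            exact hL.trans (by gcongr)
        _ = 3 / ‖z‖ := by ring
    have b3 : ‖stirlingRem (z + h)‖ ≤ 16 / ‖z‖ := by
      refine (norm_stirlingRem_le hzh.le (by linarith)).trans ?_
      rw [div_le_div_iff₀ (by linarith) hn]
      linarith
    have b4 := norm_stirlingRem_le hz.le (by linarith : 2 ≤ ‖z‖)
    have b5 : 30 / ‖z‖ = 1 / ‖z‖ + 3 / ‖z‖ + 16 / ‖z‖ + 8 / ‖z‖ + 2 / ‖z‖ := by ring
    have b6 : 0 ≤ 2 / ‖z‖ := by positivity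
    rw [b5]
    refine (norm_sub_le _ _).trans ?_
    have b7 := norm_add₃_le (a := z * (log (1 + v) - v)) (b := (h - 1 / 2) * log (1 + v))
      (c := stirlingRem (z + h))
    linarith
  · rw [Gamma_eq_stirling hzh (by linarith), Gamma_eq_stirling hz (by linarith), mul_assoc, ← exp_add]
    congr 2
    rw [hlog]
    linear_combination hzv

/-- `Log((u ± it)/2) = log(t/2) ± iπ/2 + O(1/t)`. -/
lemma exists_log_eq {u : ℂ} (hu : ‖u‖ ≤ 1) {t : ℝ} (ht : 2 ≤ t) {ε : ℂ} (hε : ε = I ∨ ε = -I) :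
    ∃ ρ : ℂ, ‖ρ‖ ≤ 2 / t ∧ log ((u + ε * t) / 2) = Real.log (t / 2) + log ε + ρ := by
  have ht0 : 0 < t := by linarith
  have htc : (t : ℂ) ≠ 0 := by exact_mod_cast ht0.ne'
  have hε0 : ε ≠ 0 := by rcases hε with rfl | rfl <;> simp
  have hεn : ‖ε‖ = 1 := by rcases hε with rfl | rfl <;> simp
  have hεr : ε.re = 0 := by rcases hε with rfl | rfl <;> simp
  set v := u / (ε * t) with hv
  have hvn : ‖v‖ ≤ 1 / t := by
    rw [hv, norm_div, norm_mul, hεn, norm_real, Real.norm_of_nonneg ht0.le, one_mul]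
    gcongr
  have hv2 : ‖v‖ ≤ 1 / 2 := hvn.trans (by gcongr)
  refine ⟨log (1 + v), ?_, ?_⟩
  · refine (norm_log_one_add_half_le_self hv2).trans ?_
    have : 2 / t = 2 * (1 / t) := by ring
    rw [this]
    have : 0 ≤ 1 / t := by positivity
    linarith
  · have h1 : (u + ε * t) / 2 = ((t / 2 : ℝ) : ℂ) * (ε * (1 + v)) := by
      rw [hv]
      push_cast
      field_simp
      ring
    have hv0 : 1 + v ≠ 0 := by
      intro h0
      have : v = -1 := by linear_combination h0
      rw [this] at hv2
      norm_num at hv2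
    rw [h1, log_ofReal_mul (by positivity) (mul_ne_zero hε0 hv0),
      log_mul_one_add hεr.ge hε0 (by linarith)]
    ring

/-- The main asymptotic formula for Gamma quotients: the arguments of the Gamma functions are
shifted by the same bounded amount `s / 2`. -/
lemma exists_gammaPair_eq :
    ∃ C : ℝ, 0 ≤ C ∧ ∀ (u v s : ℂ) (t : ℝ), ‖u‖ ≤ 1 → ‖v‖ ≤ 1 → ‖s‖ ≤ 1 → 0 < u.re → 0 < v.re →
      0 < (u + s).re → 0 < (v + s).re → 9 ≤ t →
      ∃ ρ : ℂ, ‖ρ‖ ≤ C / t ∧ gammaPair u v s t = exp (s * Real.log (t / 2) + ρ) := by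
  obtain ⟨C, hC, h⟩ := exists_Gamma_add_eq
  refine ⟨6 * C + 4, by positivity, fun u v s t hu hv hs hur hvr hus hvs ht => ?_⟩
  have ht0 : 0 < t := by linarith
  have key : ∀ (u ε : ℂ), ‖u‖ ≤ 1 → 0 < u.re → 0 < (u + s).re → (ε = I ∨ ε = -I) →
      ∃ ρ : ℂ, ‖ρ‖ ≤ (3 * C + 2) / t ∧ Gamma ((u + ε * t) / 2 + s / 2) =
        Gamma ((u + ε * t) / 2) * exp (s / 2 * (Real.log (t / 2) + log ε) + ρ) := by
    intro u ε hu hur hus hε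
    have hεn : ‖ε‖ = 1 := by rcases hε with rfl | rfl <;> simp
    have hre : (ε * t).re = 0 := by rcases hε with rfl | rfl <;> simp
    have hzt : t / 3 ≤ ‖(u + ε * t) / 2‖ := by
      have h1 := norm_sub_norm_le (ε * t) (-u)
      rw [norm_mul, hεn, norm_real, Real.norm_of_nonneg ht0.le, norm_neg, sub_neg_eq_add,
        add_comm (ε * (t : ℂ))] at h1
      rw [norm_div, norm_ofNat]
      linarith
    -- The condition `t ≥ 9` is chosen so that `(t - 1)/2 ≥ 4`.
    have hz4 : 4 ≤ ‖(u + ε * t) / 2‖ := by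
      have h1 := norm_sub_norm_le (ε * t) (-u)
      rw [norm_mul, hεn, norm_real, Real.norm_of_nonneg ht0.le, norm_neg, sub_neg_eq_add,
        add_comm (ε * (t : ℂ))] at h1
      rw [norm_div, norm_ofNat]
      linarith
    have hzre : ((u + ε * t) / 2).re = u.re / 2 := by
      rw [show (u + ε * t) / 2 = (u + ε * t) / (2 : ℝ) by simp, div_ofReal_re, add_re, hre, add_zero]
    have hsre : (s / 2).re = s.re / 2 := by
      rw [show s / 2 = s / (2 : ℝ) by simp, div_ofReal_re]
    obtain ⟨ρ, hρ, e⟩ := h ((u + ε * t) / 2) (s / 2) (by rw [hzre]; linarith)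
      (by rw [add_re, hzre, hsre]; rw [add_re] at hus; linarith)
      (by rw [norm_div, norm_ofNat]; linarith) hz4
    obtain ⟨ρ', hρ', e'⟩ := exists_log_eq hu (by linarith : 2 ≤ t) hε
    refine ⟨s / 2 * ρ' + ρ, ?_, ?_⟩
    · have b1 : ‖s / 2 * ρ'‖ ≤ 1 * (2 / t) := by
        rw [norm_mul]
        refine mul_le_mul ?_ hρ' (norm_nonneg _) (by norm_num)
        rw [norm_div, norm_ofNat]; linarith
      have b2 : C / ‖(u + ε * t) / 2‖ ≤ C / (t / 3) := by gcongr
      have b3 : C / (t / 3) = 3 * C / t := by field_simp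
      rw [b3] at b2
      refine (norm_add_le _ _).trans ?_
      rw [add_div]
      linarith
    · rw [e, e']
      congr 2
      ring
  obtain ⟨ρ, hρ, e⟩ := key u I hu hur hus (Or.inl rfl)
  obtain ⟨ρ', hρ', e'⟩ := key v (-I) hv hvr hvs (Or.inr rfl)
  refine ⟨ρ + ρ', ?_, ?_⟩
  · refine (norm_add_le _ _).trans ?_
    have : (6 * C + 4) / t = (3 * C + 2) / t + (3 * C + 2) / t := by ring
    rw [this]
    exact add_le_add hρ hρ'
  · have e1 : (u + s + I * t) / 2 = (u + I * t) / 2 + s / 2 := by ring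
    have e2 : (v + s - I * t) / 2 = (v + -I * t) / 2 + s / 2 := by ring
    have e3 : (v - I * t) / 2 = (v + -I * t) / 2 := by ring
    have g1 : Gamma ((u + I * t) / 2) ≠ 0 := by
      refine Gamma_ne_zero_of_re_pos ?_
      simp; exact hur
    have g2 : Gamma ((v + -I * t) / 2) ≠ 0 := by
      refine Gamma_ne_zero_of_re_pos ?_
      simp; exact hvr
    rw [gammaPair, e1, e2, e3, e, e', div_eq_iff (mul_ne_zero g1 g2)]
    -- The rotations `±iπ/2` of the two arguments cancel, so only the real quantity `log(t/2)`
    -- remains.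
    have e4 : s * Real.log (t / 2) + (ρ + ρ') = (s / 2 * (Real.log (t / 2) + log I) + ρ) +
        (s / 2 * (Real.log (t / 2) + log (-I)) + ρ') := by
      rw [log_I, log_neg_I]; ring
    rw [e4, exp_add (s / 2 * (Real.log (t / 2) + log I) + ρ)]
    generalize exp _ = x
    generalize exp _ = y
    ring

end SixthMoment

end

section

open Complex Filter Topology

namespace SixthMoment

/-! ### Residues in rectangles -/

/-- The integral of `f` over the boundary of `[σ₀, σ₁] × [-U, U]`, counterclockwise. -/
noncomputable def rectIntegral (σ₀ σ₁ U : ℝ) (f : ℂ → ℂ) : ℂ :=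
  (∫ x : ℝ in σ₀..σ₁, f (x + (-U : ℝ) * I)) - (∫ x : ℝ in σ₀..σ₁, f (x + U * I)) +
    I • (∫ y : ℝ in (-U)..U, f (σ₁ + y * I)) - I • ∫ y : ℝ in (-U)..U, f (σ₀ + y * I)

/-- The boundary of `[σ₀, σ₁] × [-U, U]`. -/
def rectBoundary (σ₀ σ₁ U : ℝ) : Set ℂ :=
  {z | (z.re ∈ Set.Icc σ₀ σ₁ ∧ |z.im| = U) ∨ ((z.re = σ₀ ∨ z.re = σ₁) ∧ |z.im| ≤ U)}

section
variable {σ₀ σ₁ U : ℝ}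

lemma horizontal_mem_rectBoundary (hU : 0 ≤ U) {x : ℝ} (hx : x ∈ Set.Icc σ₀ σ₁) :
    ((x : ℂ) + (U : ℝ) * I) ∈ rectBoundary σ₀ σ₁ U ∧
      ((x : ℂ) + (-U : ℝ) * I) ∈ rectBoundary σ₀ σ₁ U :=
  ⟨Or.inl ⟨by simpa using hx, by simp [abs_of_nonneg hU]⟩,
    Or.inl ⟨by simpa using hx, by simp [abs_of_nonneg hU]⟩⟩

lemma vertical_mem_rectBoundary {y : ℝ} (hy : y ∈ Set.Icc (-U) U) :
    ((σ₀ : ℂ) + y * I) ∈ rectBoundary σ₀ σ₁ U ∧ ((σ₁ : ℂ) + y * I) ∈ rectBoundary σ₀ σ₁ U :=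
  ⟨Or.inr ⟨Or.inl (by simp), by simpa using abs_le.2 hy⟩,
    Or.inr ⟨Or.inr (by simp), by simpa using abs_le.2 hy⟩⟩

lemma intervalIntegrable_of_continuousOn_rectBoundary (hσ : σ₀ ≤ σ₁) (hU : 0 ≤ U) {f : ℂ → ℂ}
    (hf : ContinuousOn f (rectBoundary σ₀ σ₁ U)) :
    IntervalIntegrable (fun x : ℝ => f (x + (-U : ℝ) * I)) MeasureTheory.volume σ₀ σ₁ ∧
      IntervalIntegrable (fun x : ℝ => f (x + U * I)) MeasureTheory.volume σ₀ σ₁ ∧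
      IntervalIntegrable (fun y : ℝ => f (σ₁ + y * I)) MeasureTheory.volume (-U) U ∧
      IntervalIntegrable (fun y : ℝ => f (σ₀ + y * I)) MeasureTheory.volume (-U) U := by
  have hU' : -U ≤ U := by linarith
  refine ⟨?_, ?_, ?_, ?_⟩ <;> refine ContinuousOn.intervalIntegrable_of_Icc (by assumption) ?_ <;>
    refine hf.comp (by fun_prop) ?_ <;> intro x hx
  · exact (horizontal_mem_rectBoundary hU hx).2
  · exact (horizontal_mem_rectBoundary hU hx).1
  · exact (vertical_mem_rectBoundary hx).2
  · exact (vertical_mem_rectBoundary hx).1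

lemma rectIntegral_congr (hσ : σ₀ ≤ σ₁) (hU : 0 ≤ U) {f g : ℂ → ℂ}
    (h : Set.EqOn f g (rectBoundary σ₀ σ₁ U)) :
    rectIntegral σ₀ σ₁ U f = rectIntegral σ₀ σ₁ U g := by
  have hU' : -U ≤ U := by linarith
  unfold rectIntegral
  congr 1
  · congr 1
    · congr 1
      · refine intervalIntegral.integral_congr fun x hx => h ?_
        rw [Set.uIcc_of_le hσ] at hx
        exact (horizontal_mem_rectBoundary hU hx).2
      · refine intervalIntegral.integral_congr fun x hx => h ?_
        rw [Set.uIcc_of_le hσ] at hx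
        exact (horizontal_mem_rectBoundary hU hx).1
    · congr 1
      refine intervalIntegral.integral_congr fun x hx => h ?_
      rw [Set.uIcc_of_le hU'] at hx
      exact (vertical_mem_rectBoundary hx).2
  · congr 1
    refine intervalIntegral.integral_congr fun x hx => h ?_
    rw [Set.uIcc_of_le hU'] at hx
    exact (vertical_mem_rectBoundary hx).1

lemma rectIntegral_add (hσ : σ₀ ≤ σ₁) (hU : 0 ≤ U) {f g : ℂ → ℂ}
    (hf : ContinuousOn f (rectBoundary σ₀ σ₁ U)) (hg : ContinuousOn g (rectBoundary σ₀ σ₁ U)) :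
    rectIntegral σ₀ σ₁ U (fun z => f z + g z) = rectIntegral σ₀ σ₁ U f + rectIntegral σ₀ σ₁ U g := by
  obtain ⟨f1, f2, f3, f4⟩ := intervalIntegrable_of_continuousOn_rectBoundary hσ hU hf
  obtain ⟨g1, g2, g3, g4⟩ := intervalIntegrable_of_continuousOn_rectBoundary hσ hU hg
  unfold rectIntegral
  rw [intervalIntegral.integral_add f1 g1, intervalIntegral.integral_add f2 g2,
    intervalIntegral.integral_add f3 g3, intervalIntegral.integral_add f4 g4]
  simp only [smul_eq_mul]
  ring

lemma rectIntegral_const_mul (c : ℂ) (f : ℂ → ℂ) :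
    rectIntegral σ₀ σ₁ U (fun z => c * f z) = c * rectIntegral σ₀ σ₁ U f := by
  unfold rectIntegral
  simp only [intervalIntegral.integral_const_mul, smul_eq_mul]
  ring

lemma rectIntegral_sum (hσ : σ₀ ≤ σ₁) (hU : 0 ≤ U) {ι : Type*} (u : Finset ι) {f : ι → ℂ → ℂ}
    (hf : ∀ i, ContinuousOn (f i) (rectBoundary σ₀ σ₁ U)) :
    rectIntegral σ₀ σ₁ U (fun z => ∑ i ∈ u, f i z) = ∑ i ∈ u, rectIntegral σ₀ σ₁ U (f i) := by
  classical
  induction u using Finset.induction with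
  | empty => simp [rectIntegral]
  | insert i u hi ih =>
    simp only [Finset.sum_insert hi]
    rw [rectIntegral_add hσ hU (hf i) (continuousOn_finsetSum _ fun i _ => hf i), ih]

end

lemma log_I_mul {v : ℂ} (hv : 0 < v.re) : log (I * v) = log v + Real.pi / 2 * I := by
  have hv0 : v ≠ 0 := by rintro rfl; simp at hv
  have h2 := abs_lt.1 (abs_arg_lt_pi_div_two_iff.2 (Or.inl hv))
  rw [log_mul I_ne_zero hv0, log_I, add_comm]
  rw [arg_I]
  constructor <;> linarith [h2.1, h2.2, Real.pi_pos]

/-- The factor `c` rotates the segment into the right half-plane, where the principal logarithm is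
an antiderivative. -/
lemma integral_div_linear {a b : ℝ} (hab : a ≤ b) (c p q : ℂ)
    (h : ∀ y ∈ Set.Icc a b, 0 < (c * (p + y * q)).re) :
    ∫ y : ℝ in a..b, q * (p + y * q)⁻¹ = log (c * (p + b * q)) - log (c * (p + a * q)) := by
  have hne : ∀ y ∈ Set.Icc a b, c ≠ 0 ∧ p + y * q ≠ 0 := by
    intro y hy
    have h0 := h y hy
    constructor
    · rintro rfl; simp at h0
    · intro h1; simp [h1] at h0
  refine intervalIntegral.integral_eq_sub_of_hasDerivAt (f := fun y : ℝ => log (c * (p + y * q))) ?_ ?_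
  · intro y hy
    rw [Set.uIcc_of_le hab] at hy
    have h2 : HasDerivAt (fun y : ℝ => c * (p + (y : ℂ) * q)) (c * q) y := by
      have h3 : HasDerivAt (fun y : ℝ => (y : ℂ)) 1 y := ofRealCLM.hasDerivAt
      simpa using ((h3.mul_const q).const_add p).const_mul c
    have h4 := h2.clog_real (Or.inl (h y hy))
    refine h4.congr_deriv ?_
    obtain ⟨h5, h6⟩ := hne y hy
    field_simp
  · refine ContinuousOn.intervalIntegrable_of_Icc hab ?_
    refine continuousOn_const.mul (ContinuousOn.inv₀ (by fun_prop) fun y hy => (hne y hy).2)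

/-- Every side uses its own rotation `±1` or `±I`. At each corner the logarithms of the two adjacent
sides differ by `iπ/2`, and the four corners add up to `2πi`. -/
lemma rectIntegral_inv_sub {σ₀ σ₁ U : ℝ} {w : ℂ} (h0 : σ₀ < w.re) (h1 : w.re < σ₁) (hU : |w.im| < U) :
    rectIntegral σ₀ σ₁ U (fun z => (z - w)⁻¹) = 2 * Real.pi * I := by
  have hσ : σ₀ ≤ σ₁ := by linarith
  obtain ⟨hU1, hU2⟩ := abs_lt.1 hU
  have hUU : -U ≤ U := by linarith
  have b1 := integral_div_linear hσ I ((-U : ℝ) * I - w) 1 (fun x _ => by simp; linarith)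
  have b2 := integral_div_linear hσ (-I) ((U : ℝ) * I - w) 1 (fun x _ => by simp; linarith)
  have b3 := integral_div_linear hUU 1 (σ₁ - w) I (fun x _ => by simp; linarith)
  have b4 := integral_div_linear hUU (-1) (σ₀ - w) I (fun x _ => by simp; linarith)
  rw [intervalIntegral.integral_const_mul] at b1 b2 b3 b4
  have e1 : (∫ x : ℝ in σ₀..σ₁, ((x : ℂ) + (-U : ℝ) * I - w)⁻¹) =
      1 * ∫ x : ℝ in σ₀..σ₁, (((-U : ℝ) * I - w) + x * 1)⁻¹ := by
    rw [one_mul]; congr 1; ext x; congr 1; ring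
  have e2 : (∫ x : ℝ in σ₀..σ₁, ((x : ℂ) + U * I - w)⁻¹) =
      1 * ∫ x : ℝ in σ₀..σ₁, ((U * I - w) + x * 1)⁻¹ := by
    rw [one_mul]; congr 1; ext x; congr 1; ring
  have e3 : (∫ y : ℝ in (-U)..U, ((σ₁ : ℂ) + y * I - w)⁻¹) =
      ∫ y : ℝ in (-U)..U, (((σ₁ : ℂ) - w) + y * I)⁻¹ := by
    congr 1; ext x; congr 1; ring
  have e4 : (∫ y : ℝ in (-U)..U, ((σ₀ : ℂ) + y * I - w)⁻¹) =
      ∫ y : ℝ in (-U)..U, (((σ₀ : ℂ) - w) + y * I)⁻¹ := by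
    congr 1; ext x; congr 1; ring
  rw [rectIntegral, e1, e2, e3, e4, smul_eq_mul, smul_eq_mul, b1, b2, b3, b4]
  have c1 := log_I_mul (v := -I * (U * I - w + σ₁ * 1)) (by simp; linarith)
  have c2 := log_I_mul (v := -1 * (σ₀ - w + U * I)) (by simp; linarith)
  have c3 := log_I_mul (v := I * ((-U : ℝ) * I - w + σ₀ * 1)) (by simp; linarith)
  have c4 := log_I_mul (v := 1 * (σ₁ - w + (-U : ℝ) * I)) (by simp; linarith)
  have d1 : I * (-I * (U * I - w + σ₁ * 1)) = 1 * (σ₁ - w + U * I) := by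
    linear_combination (-(U * I - w + σ₁)) * I_mul_I
  have d2 : I * (-1 * (σ₀ - w + U * I)) = -I * (U * I - w + σ₀ * 1) := by ring
  have d3 : I * (I * ((-U : ℝ) * I - w + σ₀ * 1)) = -1 * (σ₀ - w + (-U : ℝ) * I) := by
    linear_combination ((-U : ℝ) * I - w + σ₀) * I_mul_I
  have d4 : I * (1 * (σ₁ - w + (-U : ℝ) * I)) = I * ((-U : ℝ) * I - w + σ₁ * 1) := by ring
  rw [d1] at c1
  rw [d2] at c2
  rw [d3] at c3
  rw [d4] at c4
  rw [c1, c2, c3, c4]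
  ring

lemma not_mem_rectBoundary {σ₀ σ₁ U : ℝ} {w : ℂ} (h0 : σ₀ < w.re) (h1 : w.re < σ₁)
    (hU : |w.im| < U) : w ∉ rectBoundary σ₀ σ₁ U := by
  rintro (⟨-, h⟩ | ⟨h | h, -⟩) <;> linarith

/-- Cauchy's integral formula for rectangles. -/
lemma rectIntegral_mul_inv_sub {σ₀ σ₁ U : ℝ} {w : ℂ} (h0 : σ₀ < w.re) (h1 : w.re < σ₁)
    (hU : |w.im| < U) {S : Set ℂ} (hS : IsOpen S)
    (hsub : Set.Icc σ₀ σ₁ ×ℂ Set.Icc (-U) U ⊆ S) {Φ : ℂ → ℂ} (hΦ : DifferentiableOn ℂ Φ S) :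
    rectIntegral σ₀ σ₁ U (fun z => Φ z * (z - w)⁻¹) = 2 * Real.pi * I * Φ w := by
  have hσ : σ₀ ≤ σ₁ := by linarith
  have hU0 : 0 ≤ U := (abs_nonneg _).trans hU.le
  have hUU : -U ≤ U := by linarith
  have hwR : w ∈ S := hsub ⟨⟨h0.le, h1.le⟩, abs_le.1 hU.le⟩
  have hB : rectBoundary σ₀ σ₁ U ⊆ S := by
    rintro z (⟨h, h'⟩ | ⟨h | h, h'⟩)
    · exact hsub ⟨h, abs_le.1 h'.le⟩
    · exact hsub ⟨⟨h.ge, by rw [h]; exact hσ⟩, abs_le.1 h'⟩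
    · exact hsub ⟨⟨by rw [h]; exact hσ, h.le⟩, abs_le.1 h'⟩
  have hne : ∀ z ∈ rectBoundary σ₀ σ₁ U, z - w ≠ 0 := by
    intro z hz hzw
    rw [sub_eq_zero] at hzw
    exact not_mem_rectBoundary h0 h1 hU (hzw ▸ hz)
  -- Splitting off `Φ(w)/(z - w)` leaves a holomorphic quotient, whose boundary integral vanishes.
  have hd : DifferentiableOn ℂ (dslope Φ w) S := (differentiableOn_dslope (hS.mem_nhds hwR)).2 hΦ
  have hcongr : Set.EqOn (fun z => Φ z * (z - w)⁻¹) (fun z => dslope Φ w z + Φ w * (z - w)⁻¹)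
      (rectBoundary σ₀ σ₁ U) := by
    intro z hz
    have h := hne z hz
    simp only
    rw [dslope_of_ne _ (sub_ne_zero.1 h), slope_def_field]
    field_simp
    ring
  have hz : rectIntegral σ₀ σ₁ U (dslope Φ w) = 0 := by
    have := integral_boundary_rect_eq_zero_of_differentiableOn (dslope Φ w)
      (σ₀ + (-U : ℝ) * I) (σ₁ + (U : ℝ) * I) (hd.mono (by
        refine Set.Subset.trans ?_ hsub
        simp [Set.uIcc_of_le hσ, Set.uIcc_of_le hUU]))
    simpa [rectIntegral] using this
  have hc : ContinuousOn (fun z => Φ w * (z - w)⁻¹) (rectBoundary σ₀ σ₁ U) :=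
    continuousOn_const.mul (ContinuousOn.inv₀ (by fun_prop) hne)
  rw [rectIntegral_congr hσ hU0 hcongr, rectIntegral_add hσ hU0 (hd.continuousOn.mono hB) hc, hz, zero_add,
    rectIntegral_const_mul, rectIntegral_inv_sub h0 h1 hU]
  ring

/-- Partial fractions, read off from the Lagrange interpolation of the constant polynomial `1`. -/
lemma inv_prod_sub_eq {ι : Type*} [Fintype ι] [Nonempty ι] [DecidableEq ι] {v : ι → ℂ}
    (hv : Function.Injective v) {z : ℂ} (hz : ∀ i, z ≠ v i) :
    (∏ i, (z - v i))⁻¹ = ∑ i, Lagrange.nodalWeight Finset.univ v i * (z - v i)⁻¹ := by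
  have h := Lagrange.eval_interpolate_not_at_node (s := Finset.univ) (v := v) (1 : ι → ℂ) (x := z)
    (fun i _ => hz i)
  rw [Lagrange.interpolate_one hv.injOn Finset.univ_nonempty, Polynomial.eval_one,
    Lagrange.eval_nodal] at h
  simp only [Pi.one_apply, mul_one] at h
  exact inv_eq_of_mul_eq_one_right h.symm

/-- The sum of the residues of `Φ(z) / ∏ (z - v_i)`. -/
noncomputable def residueSum {ι : Type*} [Fintype ι] [DecidableEq ι] (v : ι → ℂ) (Φ : ℂ → ℂ) : ℂ :=
  ∑ i, Lagrange.nodalWeight Finset.univ v i * Φ (v i)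

section
variable {ι : Type*} [Fintype ι] [Nonempty ι] [DecidableEq ι] {v : ι → ℂ}

lemma rectIntegral_div_prod (hv : Function.Injective v) {σ₀ σ₁ U : ℝ} (h0 : ∀ i, σ₀ < (v i).re)
    (h1 : ∀ i, (v i).re < σ₁) (hU : ∀ i, |(v i).im| < U) {S : Set ℂ} (hS : IsOpen S)
    (hsub : Set.Icc σ₀ σ₁ ×ℂ Set.Icc (-U) U ⊆ S) {Φ : ℂ → ℂ} (hΦ : DifferentiableOn ℂ Φ S) :
    rectIntegral σ₀ σ₁ U (fun z => Φ z / ∏ i, (z - v i)) = 2 * Real.pi * I * residueSum v Φ := by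
  obtain ⟨i₀⟩ := ‹Nonempty ι›
  have : Nonempty ι := ⟨i₀⟩
  have hσ : σ₀ ≤ σ₁ := by linarith [h0 i₀, h1 i₀]
  have hU0 : 0 ≤ U := (abs_nonneg _).trans (hU i₀).le
  have hB : rectBoundary σ₀ σ₁ U ⊆ S := by
    rintro z (⟨h, h'⟩ | ⟨h | h, h'⟩)
    · exact hsub ⟨h, abs_le.1 h'.le⟩
    · exact hsub ⟨⟨h.ge, by rw [h]; exact hσ⟩, abs_le.1 h'⟩
    · exact hsub ⟨⟨by rw [h]; exact hσ, h.le⟩, abs_le.1 h'⟩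
  have hne : ∀ i, ∀ z ∈ rectBoundary σ₀ σ₁ U, z - v i ≠ 0 := by
    intro i z hz hzw
    rw [sub_eq_zero] at hzw
    exact not_mem_rectBoundary (h0 i) (h1 i) (hU i) (hzw ▸ hz)
  have e : Set.EqOn (fun z => Φ z / ∏ i, (z - v i))
      (fun z => ∑ i, Lagrange.nodalWeight Finset.univ v i * (Φ z * (z - v i)⁻¹))
      (rectBoundary σ₀ σ₁ U) := by
    intro z hz
    simp only
    rw [div_eq_mul_inv, inv_prod_sub_eq hv fun i => sub_ne_zero.1 (hne i z hz), Finset.mul_sum]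
    exact Finset.sum_congr rfl fun i _ => by ring
  rw [rectIntegral_congr hσ hU0 e, rectIntegral_sum hσ hU0, residueSum, Finset.mul_sum]
  · refine Finset.sum_congr rfl fun i _ => ?_
    rw [rectIntegral_const_mul, rectIntegral_mul_inv_sub (h0 i) (h1 i) (hU i) hS hsub hΦ]
    ring
  · exact fun i => continuousOn_const.mul ((hΦ.continuousOn.mono hB).mul
      (ContinuousOn.inv₀ (by fun_prop) (hne i)))

/-- The contour shift produces the same `residueSum`. Written over a circle far from all nodes, the
sum can be estimated even when single residues are large because nodes nearly collide. -/
lemma circleIntegral_div_prod (hv : Function.Injective v) {r : ℝ} (hr : ∀ i, v i ∈ Metric.ball 0 r)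
    {Φ : ℂ → ℂ} (hΦ : DifferentiableOn ℂ Φ (Metric.closedBall 0 r)) :
    (2 * Real.pi * I)⁻¹ * ∮ z in C(0, r), Φ z / ∏ i, (z - v i) = residueSum v Φ := by
  obtain ⟨i₀⟩ := ‹Nonempty ι›
  have : Nonempty ι := ⟨i₀⟩
  have hr0 : 0 < r := (norm_nonneg _).trans_lt (mem_ball_zero_iff.1 (hr i₀))
  have hne : ∀ i, ∀ z ∈ Metric.sphere (0 : ℂ) r, z - v i ≠ 0 := by
    intro i z hz hzw
    rw [sub_eq_zero] at hzw
    have := hr i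
    rw [← hzw] at this
    simp at this hz
    linarith
  have e : Set.EqOn (fun z => Φ z / ∏ i, (z - v i))
      (fun z => ∑ i, Lagrange.nodalWeight Finset.univ v i * ((z - v i)⁻¹ * Φ z))
      (Metric.sphere 0 r) := by
    intro z hz
    simp only
    rw [div_eq_mul_inv, inv_prod_sub_eq hv fun i => sub_ne_zero.1 (hne i z hz), Finset.mul_sum]
    exact Finset.sum_congr rfl fun i _ => by ring
  rw [circleIntegral.integral_congr hr0.le e, circleIntegral.integral_fun_sum, residueSum,
    Finset.mul_sum]
  · refine Finset.sum_congr rfl fun i _ => ?_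
    have hC := hΦ.circleIntegral_sub_inv_smul (hr i)
    simp only [smul_eq_mul] at hC
    rw [circleIntegral.integral_const_mul, hC]
    field_simp [two_pi_I_ne_zero]
  · intro i _
    refine ContinuousOn.circleIntegrable hr0.le ?_
    exact continuousOn_const.mul ((ContinuousOn.inv₀ (by fun_prop) (hne i)).mul
      (hΦ.continuousOn.mono Metric.sphere_subset_closedBall))

lemma lineIntegrable_of_bound {f : ℂ → ℂ} {σ M : ℝ}
    (hf : Continuous fun y : ℝ => f (σ + y * I))
    (hM : ∀ y : ℝ, ‖f (σ + y * I)‖ ≤ M * (1 + y ^ 2)⁻¹) : LineIntegrable σ f := by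
  refine (integrable_inv_one_add_sq.const_mul M).mono' hf.aestronglyMeasurable ?_
  exact Filter.Eventually.of_forall hM

/-- Moving the line of integration past finitely many simple poles. -/
lemma lineIntegral_sub_lineIntegral (hv : Function.Injective v) {σ₀ σ₁ M : ℝ}
    (h0 : ∀ i, σ₀ < (v i).re) (h1 : ∀ i, (v i).re < σ₁) {S : Set ℂ} (hS : IsOpen S)
    (hsub : ∀ z : ℂ, σ₀ ≤ z.re → z.re ≤ σ₁ → z ∈ S) {Φ : ℂ → ℂ} (hΦ : DifferentiableOn ℂ Φ S)
    (hM : ∀ z : ℂ, σ₀ ≤ z.re → z.re ≤ σ₁ → (z.re = σ₀ ∨ z.re = σ₁ ∨ 1 ≤ |z.im|) →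
      ‖Φ z / ∏ i, (z - v i)‖ ≤ M * (1 + z.im ^ 2)⁻¹) :
    LineIntegrable σ₁ (fun z => Φ z / ∏ i, (z - v i)) ∧
    LineIntegrable σ₀ (fun z => Φ z / ∏ i, (z - v i)) ∧
      lineIntegral σ₁ (fun z => Φ z / ∏ i, (z - v i)) -
        lineIntegral σ₀ (fun z => Φ z / ∏ i, (z - v i)) = residueSum v Φ := by
  obtain ⟨i₀⟩ := ‹Nonempty ι›
  have : Nonempty ι := ⟨i₀⟩
  have hσ : σ₀ ≤ σ₁ := by linarith [h0 i₀, h1 i₀]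
  set f : ℂ → ℂ := fun z => Φ z / ∏ i, (z - v i) with hf
  have hM' : ∀ z : ℂ, σ₀ ≤ z.re → z.re ≤ σ₁ → (z.re = σ₀ ∨ z.re = σ₁ ∨ 1 ≤ |z.im|) →
      ‖f z‖ ≤ M * (1 + z.im ^ 2)⁻¹ := hM
  have hcont : ∀ σ : ℝ, σ₀ ≤ σ → σ ≤ σ₁ → (σ = σ₀ ∨ σ = σ₁) →
      Continuous fun y : ℝ => f (σ + y * I) := by
    intro σ ha hb hc
    have hΦc : Continuous fun y : ℝ => Φ (σ + y * I) := by
      refine continuous_iff_continuousAt.2 fun y => ?_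
      have hm : ((σ : ℂ) + y * I) ∈ S := hsub _ (by simpa using ha) (by simpa using hb)
      have := (hΦ.continuousOn.continuousAt (hS.mem_nhds hm))
      exact ContinuousAt.comp (f := fun y : ℝ => (σ : ℂ) + y * I) this (by fun_prop)
    refine hΦc.div (by fun_prop) fun y => Finset.prod_ne_zero_iff.2 fun i _ h => ?_
    have := congrArg re h
    simp at this
    rcases hc with rfl | rfl
    · linarith [h0 i]
    · linarith [h1 i]
  have hL1 : LineIntegrable σ₁ f := lineIntegrable_of_bound (M := M) (hcont σ₁ hσ le_rfl (Or.inr rfl))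
    fun y => by simpa using hM' (σ₁ + y * I) (by simpa using hσ) (by simp) (Or.inr (Or.inl (by simp)))
  have hL0 : LineIntegrable σ₀ f := lineIntegrable_of_bound (M := M) (hcont σ₀ le_rfl hσ (Or.inl rfl))
    fun y => by simpa using hM' (σ₀ + y * I) (by simp) (by simpa using hσ) (Or.inl (by simp))
  refine ⟨hL1, hL0, ?_⟩
  have hlim : Tendsto (fun U : ℝ => M * (1 + U ^ 2)⁻¹ * |σ₁ - σ₀|) atTop (𝓝 0) := by
    have : Tendsto (fun U : ℝ => (1 + U ^ 2)⁻¹) atTop (𝓝 0) :=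
      tendsto_inv_atTop_zero.comp (tendsto_atTop_add_const_left _ _ (tendsto_pow_atTop two_ne_zero))
    simpa using (this.const_mul M).mul_const |σ₁ - σ₀|
  -- The horizontal sides have fixed length and the integrand on them is `O(U^{-2})`, so they
  -- disappear in the limit.
  have hhor : ∀ ε : ℝ, (ε = 1 ∨ ε = -1) → Tendsto (fun U : ℝ =>
      ∫ x : ℝ in σ₀..σ₁, f (x + (ε * U : ℝ) * I)) atTop (𝓝 0) := by
    intro ε hε
    refine squeeze_zero_norm' ?_ hlim
    filter_upwards [eventually_ge_atTop 1] with U hU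
    refine intervalIntegral.norm_integral_le_of_norm_le_const fun x hx => ?_
    rw [Set.uIoc_of_le hσ] at hx
    have hεU : |ε * U| = U := by
      rcases hε with rfl | rfl <;> simp [abs_of_nonneg (by linarith : (0 : ℝ) ≤ U)]
    have := hM' (x + (ε * U : ℝ) * I) (by simpa using hx.1.le) (by simpa using hx.2)
      (Or.inr (Or.inr (by simpa [-ofReal_mul, hεU] using hU)))
    have him : ((x : ℂ) + (ε * U : ℝ) * I).im = ε * U := by simp
    rwa [him, ← sq_abs, hεU] at this
  have hver : ∀ σ : ℝ, LineIntegrable σ f → Tendsto (fun U : ℝ =>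
      ∫ y : ℝ in (-U)..U, f (σ + y * I)) atTop (𝓝 (∫ y : ℝ, f (σ + y * I))) := fun σ h =>
    MeasureTheory.intervalIntegral_tendsto_integral h tendsto_neg_atTop_atBot tendsto_id
  have hr : Tendsto (fun U : ℝ => rectIntegral σ₀ σ₁ U f) atTop
      (𝓝 (0 - 0 + I • (∫ y : ℝ, f (σ₁ + y * I)) - I • ∫ y : ℝ, f (σ₀ + y * I))) := by
    have h1 := hhor (-1) (Or.inr rfl)
    have h2 := hhor 1 (Or.inl rfl)
    simp only [neg_mul, one_mul] at h1 h2
    exact ((h1.sub h2).add ((hver σ₁ hL1).const_smul I)).sub ((hver σ₀ hL0).const_smul I)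
  have hev : ∀ᶠ U : ℝ in atTop, rectIntegral σ₀ σ₁ U f = 2 * Real.pi * I * residueSum v Φ := by
    have hvU : ∀ᶠ U : ℝ in atTop, ∀ i, |(v i).im| < U :=
      eventually_all.2 fun i => eventually_gt_atTop _
    filter_upwards [hvU] with U hU
    exact rectIntegral_div_prod hv h0 h1 hU hS (fun z hz => hsub z hz.1.1 hz.1.2) hΦ
  have heq := tendsto_nhds_unique hr (tendsto_const_nhds.congr' (hev.mono fun U h => h.symm))
  simp only [smul_eq_mul, sub_zero, zero_add] at heq
  have heq' : (∫ y : ℝ, f (σ₁ + y * I)) - (∫ y : ℝ, f (σ₀ + y * I)) =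
      2 * Real.pi * residueSum v Φ := by
    apply mul_left_cancel₀ I_ne_zero
    linear_combination heq
  have hpi : (Real.pi : ℂ) ≠ 0 := by exact_mod_cast Real.pi_ne_zero
  rw [lineIntegral, lineIntegral, ← mul_sub, heq']
  field_simp

end

end SixthMoment

end

section

open Complex Filter Topology MeasureTheory

namespace SixthMoment

/-! ### Integrals over the weight -/

lemma integral_eq_setIntegral_of_support {f : ℝ → ℂ} {α β : ℝ}
    (hf : Function.support f ⊆ Set.Icc α β) : ∫ t, f t = ∫ t in Set.Icc α β, f t :=
  (setIntegral_eq_integral_of_forall_compl_eq_zero fun t ht => by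
    by_contra h
    exact ht (hf h)).symm

lemma norm_integral_le_of_support {f : ℝ → ℂ} {α β C : ℝ} (hαβ : α ≤ β)
    (hf : Function.support f ⊆ Set.Icc α β) (hC : ∀ t ∈ Set.Icc α β, ‖f t‖ ≤ C) :
    ‖∫ t, f t‖ ≤ C * (β - α) := by
  rw [integral_eq_setIntegral_of_support hf]
  refine (norm_setIntegral_le_of_norm_le_const (by simp) hC).trans (le_of_eq ?_)
  rw [Real.volume_real_Icc_of_le hαβ]

lemma support_mul_subset_right {f g : ℝ → ℂ} {S : Set ℝ} (hg : Function.support g ⊆ S) :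
    Function.support (fun t => f t * g t) ⊆ S := fun t ht => hg fun h0 => ht (by simp [h0])

/-- Differentiation under the integral sign: Cauchy's estimate turns a bound for `F` on a compact
set into a constant majorant of its derivative in `s`. -/
lemma differentiableOn_integral_mul {U : Set ℂ} (hU : IsOpen U) {F : ℂ → ℝ → ℂ} {ω : ℝ → ℂ} {α β : ℝ}
    (hω : ContinuousOn ω (Set.Icc α β)) (hsupp : Function.support ω ⊆ Set.Icc α β)
    (hF : ContinuousOn (fun p : ℂ × ℝ => F p.1 p.2) (U ×ˢ Set.Icc α β))
    (hd : ∀ t ∈ Set.Icc α β, DifferentiableOn ℂ (fun s => F s t) U) :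
    DifferentiableOn ℂ (fun s => ∫ t, F s t * ω t) U := by
  intro s₀ hs₀
  refine DifferentiableAt.differentiableWithinAt ?_
  have e : (fun s => ∫ t, F s t * ω t) = fun s => ∫ t in Set.Icc α β, F s t * ω t := by
    ext s
    exact integral_eq_setIntegral_of_support (support_mul_subset_right hsupp)
  rw [e]
  obtain ⟨R, hR, hRU⟩ := Metric.isOpen_iff.1 hU s₀ hs₀
  set r := R / 3 with hr
  have hr0 : 0 < r := by positivity
  have hcb : Metric.closedBall s₀ (2 * r) ⊆ U :=
    (Metric.closedBall_subset_ball (by rw [hr]; linarith)).trans hRU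
  obtain ⟨M, hM⟩ := ((isCompact_closedBall s₀ (2 * r)).prod (isCompact_Icc (a := α) (b := β))).exists_bound_of_continuousOn
    (hF.mono (Set.prod_mono hcb subset_rfl))
  obtain ⟨N, hN⟩ := isCompact_Icc.exists_bound_of_continuousOn hω
  have hFc : ∀ s ∈ U, ContinuousOn (fun t => F s t) (Set.Icc α β) := fun s hs =>
    hF.comp (by fun_prop : ContinuousOn (fun t : ℝ => (s, t)) (Set.Icc α β)) fun t ht => ⟨hs, ht⟩
  have hmeas : ∀ s ∈ U, AEStronglyMeasurable (fun t => F s t) (volume.restrict (Set.Icc α β)) :=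
    fun s hs => (hFc s hs).aestronglyMeasurable measurableSet_Icc
  have hωm : AEStronglyMeasurable ω (volume.restrict (Set.Icc α β)) :=
    hω.aestronglyMeasurable measurableSet_Icc
  have hdat : ∀ t ∈ Set.Icc α β, ∀ s ∈ U, DifferentiableAt ℂ (fun s => F s t) s := fun t ht s hs =>
    (hd t ht).differentiableAt (hU.mem_nhds hs)
  have hderiv : ∀ t ∈ Set.Icc α β, ∀ s ∈ Metric.ball s₀ r, ‖deriv (fun s => F s t) s‖ ≤ M / r := by
    intro t ht s hs
    have hsub : Metric.closedBall s r ⊆ Metric.closedBall s₀ (2 * r) :=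
      Metric.closedBall_subset_closedBall' (by linarith [Metric.mem_ball.1 hs])
    refine norm_deriv_le_of_forall_mem_sphere_norm_le hr0 ?_ fun z hz =>
      hM (z, t) ⟨hsub (Metric.sphere_subset_closedBall hz), ht⟩
    refine DifferentiableOn.diffContOnCl ?_
    rw [closure_ball _ hr0.ne']
    exact (hd t ht).mono (hsub.trans hcb)
  -- No regularity of the derivative in `t` is assumed; measurability follows because it is a limit
  -- of difference quotients.
  have hF'm : AEStronglyMeasurable (fun t => deriv (fun s => F s t) s₀)
      (volume.restrict (Set.Icc α β)) := by
    refine aestronglyMeasurable_of_tendsto_ae (u := atTop)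
      (f := fun (n : ℕ) t => ((r / (n + 1) : ℝ) : ℂ)⁻¹ * (F (s₀ + (r / (n + 1) : ℝ)) t - F s₀ t)) ?_ ?_
    · intro n
      refine AEStronglyMeasurable.const_mul ((hmeas _ (hcb ?_)).sub (hmeas _ hs₀)) _
      rw [Metric.mem_closedBall, dist_eq_norm, add_sub_cancel_left, norm_real, Real.norm_of_nonneg (by positivity)]
      have : r / (n + 1 : ℝ) ≤ r := div_le_self hr0.le (by linarith [n.cast_nonneg (α := ℝ)])
      linarith
    · refine (ae_restrict_iff' measurableSet_Icc).2 (Eventually.of_forall fun t ht => ?_)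
      have h1 := (hdat t ht s₀ hs₀).hasDerivAt.tendsto_slope_zero
      have h2 : Tendsto (fun n : ℕ => ((r / (n + 1) : ℝ) : ℂ)) atTop (𝓝[≠] 0) := by
        refine tendsto_nhdsWithin_iff.2 ⟨?_, Eventually.of_forall fun n => ?_⟩
        · have h3 : Tendsto (fun n : ℕ => r / ((n : ℝ) + 1)) atTop (𝓝 0) :=
            tendsto_const_nhds.div_atTop
              (tendsto_atTop_add_const_right _ _ tendsto_natCast_atTop_atTop)
          have := (continuous_ofReal.tendsto 0).comp h3
          rwa [ofReal_zero] at this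
        · simp only [Set.mem_compl_iff, Set.mem_singleton_iff, ofReal_eq_zero]
          positivity
      exact h1.comp h2
  refine (hasDerivAt_integral_of_dominated_loc_of_deriv_le (μ := volume.restrict (Set.Icc α β))
    (F := fun s t => F s t * ω t) (F' := fun s t => deriv (fun s => F s t) s * ω t)
    (bound := fun _ => M / r * N) (Metric.ball_mem_nhds s₀ hr0) ?_ ?_ (hF'm.mul hωm) ?_ ?_ ?_).2.differentiableAt
  · filter_upwards [hU.mem_nhds hs₀] with s hs using (hmeas s hs).mul hωm
  · exact ((hFc s₀ hs₀).mul hω).integrableOn_Icc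
  · refine (ae_restrict_iff' measurableSet_Icc).2 (Eventually.of_forall fun t ht s hs => ?_)
    rw [norm_mul]
    have h1 := hderiv t ht s hs
    exact mul_le_mul h1 (hN t ht) (norm_nonneg _) ((norm_nonneg _).trans h1)
  · exact integrable_const _
  · refine (ae_restrict_iff' measurableSet_Icc).2 (Eventually.of_forall fun t ht s hs => ?_)
    have hsU : s ∈ U := hcb (Metric.ball_subset_closedBall.trans
      (Metric.closedBall_subset_closedBall (by linarith)) hs)
    exact (hdat t ht s hsU).hasDerivAt.mul_const _

/-- A bounded weight on `[c₁ T, c₂ T]`. -/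
structure IsBoundedWeight (α β W : ℝ) (ω : ℝ → ℂ) : Prop where
  continuousOn : ContinuousOn ω (Set.Icc α β)
  support_subset : Function.support ω ⊆ Set.Icc α β
  norm_le : ∀ t ∈ Set.Icc α β, ‖ω t‖ ≤ W

lemma differentiableAt_Gamma_of_re_pos {z : ℂ} (hz : 0 < z.re) : DifferentiableAt ℂ Gamma z := by
  refine differentiableAt_Gamma z fun m h => ?_
  have := congrArg re h
  simp at this
  linarith [m.cast_nonneg (α := ℝ)]

lemma continuousAt_Gamma_comp {X : Type*} [TopologicalSpace X] {f : X → ℂ} {x : X}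
    (hf : ContinuousAt f x) (h : 0 < (f x).re) : ContinuousAt (fun y => Gamma (f y)) x := by
  have := (differentiableAt_Gamma_of_re_pos h).continuousAt
  exact ContinuousAt.comp (f := f) this hf

lemma gammaPair_args_re (u v s : ℂ) (t : ℝ) :
    ((u + s + I * t) / 2).re = (u.re + s.re) / 2 ∧ ((v + s - I * t) / 2).re = (v.re + s.re) / 2 ∧
      ((u + I * t) / 2).re = u.re / 2 ∧ ((v - I * t) / 2).re = v.re / 2 := by
  simp

lemma gammaPair_denom_ne_zero {u v : ℂ} (hu : 0 < u.re) (hv : 0 < v.re) (t : ℝ) :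
    Gamma ((u + I * t) / 2) * Gamma ((v - I * t) / 2) ≠ 0 := by
  obtain ⟨-, -, h3, h4⟩ := gammaPair_args_re u v 0 t
  exact mul_ne_zero (Gamma_ne_zero_of_re_pos (by rw [h3]; linarith))
    (Gamma_ne_zero_of_re_pos (by rw [h4]; linarith))

lemma continuousAt_gammaPair {u v : ℂ} (hu : 0 < u.re) (hv : 0 < v.re) {p : ℂ × ℝ}
    (hus : 0 < u.re + p.1.re) (hvs : 0 < v.re + p.1.re) :
    ContinuousAt (fun p : ℂ × ℝ => gammaPair u v p.1 p.2) p := by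
  obtain ⟨h1, h2, h3, h4⟩ := gammaPair_args_re u v p.1 p.2
  unfold gammaPair
  refine ContinuousAt.div ((continuousAt_Gamma_comp (by fun_prop) (by rw [h1]; linarith)).mul
      (continuousAt_Gamma_comp (by fun_prop) (by rw [h2]; linarith)))
    ((continuousAt_Gamma_comp (by fun_prop) (by rw [h3]; linarith)).mul
      (continuousAt_Gamma_comp (by fun_prop) (by rw [h4]; linarith))) (gammaPair_denom_ne_zero hu hv _)

lemma differentiableAt_gammaPair {u v : ℂ} {s : ℂ} (hus : 0 < u.re + s.re)
    (hvs : 0 < v.re + s.re) (t : ℝ) : DifferentiableAt ℂ (fun s => gammaPair u v s t) s := by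
  obtain ⟨h1, h2, -, -⟩ := gammaPair_args_re u v s t
  unfold gammaPair
  refine DifferentiableAt.div_const (DifferentiableAt.mul ?_ ?_) _
  · exact DifferentiableAt.comp (f := fun s : ℂ => (u + s + I * t) / 2) s
      (differentiableAt_Gamma_of_re_pos (by rw [h1]; linarith)) (by fun_prop)
  · exact DifferentiableAt.comp (f := fun s : ℂ => (v + s - I * t) / 2) s
      (differentiableAt_Gamma_of_re_pos (by rw [h2]; linarith)) (by fun_prop)

lemma half_add_re_bounds {x : ℂ} (hx : ‖x‖ ≤ 1 / 16) :
    7 / 16 ≤ (1 / 2 + x).re ∧ (1 / 2 + x).re ≤ 9 / 16 := by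
  have := abs_le.1 ((abs_re_le_norm x).trans hx)
  simp only [add_re, one_div, inv_re, re_ofNat, normSq_ofNat]
  constructor <;> linarith [this.1, this.2]

/-- The inner integral of the diagonal terms. -/
noncomputable def gWeight (a b : Fin 3 → ℂ) (ω : ℝ → ℂ) (s : ℂ) : ℂ := ∫ t : ℝ, gFactor a b s t * ω t

section
variable {a b : Fin 3 → ℂ} {α β W : ℝ} {ω : ℝ → ℂ}

lemma differentiableOn_gWeight (ha : ∀ i, ‖a i‖ ≤ 1 / 16) (hb : ∀ i, ‖b i‖ ≤ 1 / 16)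
    (hω : IsBoundedWeight α β W ω) :
    DifferentiableOn ℂ (gWeight a b ω) {s : ℂ | -(1 / 4) < s.re} := by
  refine differentiableOn_integral_mul (isOpen_lt continuous_const continuous_re) hω.continuousOn
    hω.support_subset ?_ ?_
  · intro p hp
    have hp1 : -(1 / 4) < p.1.re := hp.1
    refine ContinuousAt.continuousWithinAt ?_
    simp only [gFactor_eq_prod_gammaPair]
    refine tendsto_finsetProd _ fun i _ => ?_
    have h1 := (half_add_re_bounds (ha i)).1
    have h2 := (half_add_re_bounds (hb i)).1
    exact continuousAt_gammaPair (by linarith) (by linarith) (by linarith) (by linarith)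
  · intro t ht s hs
    have hs1 : -(1 / 4) < s.re := hs
    refine DifferentiableAt.differentiableWithinAt ?_
    simp only [gFactor_eq_prod_gammaPair]
    refine DifferentiableAt.fun_finsetProd fun i _ => ?_
    have h1 := (half_add_re_bounds (ha i)).1
    have h2 := (half_add_re_bounds (hb i)).1
    exact differentiableAt_gammaPair (by linarith) (by linarith) t

end

/-- The base `1 + c₁⁻¹ + c₂` dominates both `t/T` and `T/t`, so exponents of either sign are
covered. -/
lemma rpow_le_of_mem_Icc {c₁ c₂ T t e : ℝ} (hc₁ : 0 < c₁) (hT : 0 < T)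
    (ht : t ∈ Set.Icc (c₁ * T) (c₂ * T)) (he : |e| ≤ 3) :
    t ^ e ≤ (1 + c₁⁻¹ + c₂) ^ (3 : ℝ) * T ^ e := by
  have ht0 : 0 < t := (mul_pos hc₁ hT).trans_le ht.1
  have hi : 0 < c₁⁻¹ := inv_pos.2 hc₁
  have hc₂ : 0 < c₂ := pos_of_mul_pos_left (ht0.trans_le ht.2) hT.le
  have h1 : t / T ≤ 1 + c₁⁻¹ + c₂ := by
    rw [div_le_iff₀ hT]
    refine ht.2.trans ?_
    gcongr
    linarith
  have h2 : (t / T)⁻¹ ≤ 1 + c₁⁻¹ + c₂ := by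
    rw [inv_div, div_le_iff₀ ht0]
    have : c₁⁻¹ * (c₁ * T) = T := by field_simp
    nlinarith [mul_le_mul_of_nonneg_left ht.1 hi.le]
  have hk : 1 ≤ 1 + c₁⁻¹ + c₂ := by linarith
  have h3 : (t / T) ^ e ≤ (1 + c₁⁻¹ + c₂) ^ (3 : ℝ) := by
    have he' := abs_le.1 he
    rcases le_total 0 e with h | h
    · exact (Real.rpow_le_rpow (by positivity) h1 h).trans
        (Real.rpow_le_rpow_of_exponent_le hk he'.2)
    · have : (t / T) ^ e = ((t / T)⁻¹) ^ (-e) := by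
        rw [Real.inv_rpow (by positivity), Real.rpow_neg (by positivity), inv_inv]
      rw [this]
      exact (Real.rpow_le_rpow (by positivity) h2 (by linarith)).trans
        (Real.rpow_le_rpow_of_exponent_le hk (by linarith))
  rw [Real.div_rpow ht0.le hT.le, div_le_iff₀ (by positivity)] at h3
  exact h3

/-- The upper bound for the inner integral. -/
lemma exists_norm_gWeight_le {c₁ c₂ : ℝ} (hc₁ : 0 < c₁) (hc₂ : c₁ < c₂) :
    ∃ C : ℝ, 0 ≤ C ∧ ∀ (T W : ℝ) (a b : Fin 3 → ℂ) (ω : ℝ → ℂ), 0 < T → 1 ≤ c₁ * T → 0 ≤ W →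
      (∀ i, ‖a i‖ ≤ 1 / 16) → (∀ i, ‖b i‖ ≤ 1 / 16) → IsBoundedWeight (c₁ * T) (c₂ * T) W ω →
      ∀ s : ℂ, -(1 / 4) ≤ s.re → s.re ≤ 1 →
        ‖gWeight a b ω s‖ ≤ C * W * T ^ (1 + 3 * s.re) * (1 + |s.im|) ^ 9 := by
  obtain ⟨C, hC, h⟩ := exists_norm_gFactor_le
  have hi : 0 < c₁⁻¹ := inv_pos.2 hc₁
  set k := (1 + c₁⁻¹ + c₂) ^ (3 : ℝ) with hk
  have hk0 : 0 ≤ k := Real.rpow_nonneg (by linarith) _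
  refine ⟨C * k * (c₂ - c₁), mul_nonneg (by positivity) (by linarith), ?_⟩
  intro T W a b ω hT hcT hW ha hb hω s hs hs1
  have hle : c₁ * T ≤ c₂ * T := by gcongr
  refine (norm_integral_le_of_support hle (support_mul_subset_right hω.support_subset)
    (C := C * (k * T ^ (3 * s.re)) * (1 + |s.im|) ^ 9 * W) fun t ht => ?_).trans (le_of_eq ?_)
  · rw [norm_mul]
    have ht1 : 1 ≤ t := hcT.trans ht.1
    refine mul_le_mul ((h a b s t ha hb hs hs1 ht1).trans ?_) (hω.norm_le t ht) (norm_nonneg _)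
      (by positivity)
    have := rpow_le_of_mem_Icc hc₁ hT ht (e := 3 * s.re) (abs_le.2 ⟨by linarith, by linarith⟩)
    gcongr
  · rw [Real.rpow_add hT, Real.rpow_one]
    ring

/-! ### The main terms -/

/-- The Mellin-type transform `∫ ω(t) (t/2π)^{3s} dt`. -/
noncomputable def mainWeight (ω : ℝ → ℂ) (s : ℂ) : ℂ :=
  ∫ t : ℝ, ((t / (2 * Real.pi) : ℝ) : ℂ) ^ (3 * s) * ω t

lemma differentiable_mainWeight {α β W : ℝ} {ω : ℝ → ℂ} (hα : 0 < α) (hω : IsBoundedWeight α β W ω) :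
    Differentiable ℂ (mainWeight ω) := by
  rw [← differentiableOn_univ]
  have hpos : ∀ t ∈ Set.Icc α β, 0 < t / (2 * Real.pi) := fun t ht =>
    div_pos (hα.trans_le ht.1) (by positivity)
  refine differentiableOn_integral_mul isOpen_univ hω.continuousOn hω.support_subset ?_ ?_
  · refine ContinuousOn.cpow (by fun_prop) (by fun_prop) fun p hp => ?_
    exact Or.inl (by rw [ofReal_re]; exact hpos _ hp.2)
  · intro t ht
    refine Differentiable.differentiableOn fun s => ?_
    refine DifferentiableAt.const_cpow (by fun_prop) (Or.inl ?_)
    exact_mod_cast (hpos t ht).ne'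

/-- Each of the three pairs contributes `(t/2)^s`, and `π^{-3s}` turns the product into
`(t/2π)^{3s}`. -/
lemma exists_gFactor_eq :
    ∃ C : ℝ, 0 ≤ C ∧ ∀ (a b : Fin 3 → ℂ) (s : ℂ) (t : ℝ), (∀ i, ‖a i‖ ≤ 1 / 16) →
      (∀ i, ‖b i‖ ≤ 1 / 16) → ‖s‖ ≤ 1 / 4 → 9 ≤ t →
      ∃ ρ : ℂ, ‖ρ‖ ≤ C / t ∧ ((Real.pi : ℂ) ^ 3) ^ (-s) * gFactor a b s t =
        ((t / (2 * Real.pi) : ℝ) : ℂ) ^ (3 * s) * exp ρ := by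
  obtain ⟨C, hC, h⟩ := exists_gammaPair_eq
  refine ⟨3 * C, by positivity, fun a b s t ha hb hs ht => ?_⟩
  have ht0 : 0 < t := by linarith
  have hsre := abs_le.1 ((abs_re_le_norm s).trans hs)
  have hn : ∀ x : ℂ, ‖x‖ ≤ 1 / 16 → ‖1 / 2 + x‖ ≤ 1 := fun x hx => by
    refine (norm_add_le _ _).trans ?_
    norm_num
    linarith
  have key : ∀ i, ∃ ρ : ℂ, ‖ρ‖ ≤ C / t ∧
      gammaPair (1 / 2 + a i) (1 / 2 + b i) s t = exp (s * Real.log (t / 2) + ρ) := by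
    intro i
    have h1 := (half_add_re_bounds (ha i)).1
    have h2 := (half_add_re_bounds (hb i)).1
    exact h _ _ s t (hn _ (ha i)) (hn _ (hb i)) (by linarith) (by linarith) (by linarith)
      (by rw [add_re]; linarith) (by rw [add_re]; linarith) ht
  choose ρ hρ e using key
  refine ⟨∑ i, ρ i, ?_, ?_⟩
  · refine (norm_sum_le_of_le _ fun i _ => hρ i).trans (le_of_eq ?_)
    simp
    ring
  · have hb0 : ((t / (2 * Real.pi) : ℝ) : ℂ) ≠ 0 := by
      have : t / (2 * Real.pi) ≠ 0 := by positivity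
      exact_mod_cast this
    have hπ : ((Real.pi : ℂ) ^ 3) = ((Real.pi ^ 3 : ℝ) : ℂ) := by push_cast; rfl
    have hπ0 : ((Real.pi ^ 3 : ℝ) : ℂ) ≠ 0 := by
      have : Real.pi ^ 3 ≠ 0 := by positivity
      exact_mod_cast this
    have hl : Real.log (t / (2 * Real.pi)) = Real.log (t / 2) - Real.log Real.pi := by
      rw [← div_div, Real.log_div (by positivity) Real.pi_ne_zero]
    rw [gFactor_eq_prod_gammaPair, Finset.prod_congr rfl fun i _ => e i, ← exp_sum, hπ,
      cpow_def_of_ne_zero hπ0, cpow_def_of_ne_zero hb0, ← ofReal_log (by positivity),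
      ← ofReal_log (by positivity), Real.log_pow, hl, ← exp_add, ← exp_add]
    congr 1
    rw [Finset.sum_add_distrib]
    simp
    ring

/-- Comparison of the inner integral with the main term near `s = 0`. -/
lemma exists_norm_gWeight_sub_mainWeight_le {c₁ c₂ : ℝ} (hc₁ : 0 < c₁) (hc₂ : c₁ < c₂) :
    ∃ C : ℝ, 0 ≤ C ∧ ∃ T₁ : ℝ, ∀ (T W r : ℝ) (a b : Fin 3 → ℂ) (ω ω' : ℝ → ℂ), 1 ≤ T → T₁ ≤ T →
      0 ≤ W → r ≤ 1 / 4 →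
      (∀ i, ‖a i‖ ≤ 1 / 16) → (∀ i, ‖b i‖ ≤ 1 / 16) → IsBoundedWeight (c₁ * T) (c₂ * T) W ω →
      IsBoundedWeight (c₁ * T) (c₂ * T) W ω' →
      (∀ t ∈ Set.Icc (c₁ * T) (c₂ * T), ‖ω t - ω' t‖ ≤ W / T) →
      ∀ s : ℂ, ‖s‖ ≤ r →
        ‖((Real.pi : ℂ) ^ 3) ^ (-s) * gWeight a b ω s - mainWeight ω' s‖ ≤ C * W * T ^ (3 * r) := by
  obtain ⟨C, hC, h⟩ := exists_gFactor_eq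
  have hi : 0 < c₁⁻¹ := inv_pos.2 hc₁
  set k := (1 + c₁⁻¹ + c₂) ^ (3 : ℝ) with hk
  have hk0 : 0 ≤ k := Real.rpow_nonneg (by linarith) _
  refine ⟨k * (2 * (C / c₁) + 1) * (c₂ - c₁), mul_nonneg (by positivity) (by linarith),
    (9 + C) / c₁, ?_⟩
  intro T W r a b ω ω' hT1 hT hW hr ha hb hω hω' hdiff s hs
  have hT0 : 0 < T := by linarith
  -- On the support this gives `t ≥ 9`, as the asymptotic formula requires, and `C/t ≤ 1`, so that
  -- `exp ρ - 1` is `O(‖ρ‖)`.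
  have hcT : 9 + C ≤ c₁ * T := by
    rw [div_le_iff₀ hc₁] at hT; linarith
  have hle : c₁ * T ≤ c₂ * T := by gcongr
  have hs4 : ‖s‖ ≤ 1 / 4 := hs.trans hr
  have hsre := abs_le.1 (abs_re_le_norm s)
  have hα : 0 < c₁ * T := by positivity
  have e : ((Real.pi : ℂ) ^ 3) ^ (-s) * gWeight a b ω s - mainWeight ω' s =
      ∫ t : ℝ, (((Real.pi : ℂ) ^ 3) ^ (-s) * (gFactor a b s t * ω t) -
        ((t / (2 * Real.pi) : ℝ) : ℂ) ^ (3 * s) * ω' t) := by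
    rw [gWeight, mainWeight, ← integral_const_mul, integral_sub]
    · refine Integrable.const_mul ?_ _
      refine (integrableOn_iff_integrable_of_support_subset
        (support_mul_subset_right hω.support_subset)).1 ?_
      refine ContinuousOn.integrableOn_Icc (ContinuousOn.mul ?_ hω.continuousOn)
      change ContinuousOn (fun t => ∏ i, gammaPair (1 / 2 + a i) (1 / 2 + b i) s t) _
      refine continuousOn_finsetProd _ fun i _ t _ => ContinuousAt.continuousWithinAt ?_
      have h1 := (half_add_re_bounds (ha i)).1
      have h2 := (half_add_re_bounds (hb i)).1
      have h3 := continuousAt_gammaPair (u := 1 / 2 + a i) (v := 1 / 2 + b i) (p := (s, t))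
        (by linarith) (by linarith) (by linarith) (by linarith)
      exact ContinuousAt.comp (f := fun t : ℝ => (s, t)) h3 (by fun_prop)
    · refine (integrableOn_iff_integrable_of_support_subset
        (support_mul_subset_right hω'.support_subset)).1 ?_
      refine ContinuousOn.integrableOn_Icc (ContinuousOn.mul ?_ hω'.continuousOn)
      refine ContinuousOn.cpow (by fun_prop) (by fun_prop) fun t ht => ?_
      exact Or.inl (by rw [ofReal_re]; exact div_pos (hα.trans_le ht.1) (by positivity))
  rw [e]
  refine (norm_integral_le_of_support hle ?_
    (C := (k * T ^ (3 * r)) * ((2 * (C / c₁) + 1) * W / T)) fun t ht => ?_).trans (le_of_eq ?_)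
  · intro t ht
    by_contra h0
    have h1 : ω t = 0 := by by_contra h2; exact h0 (hω.support_subset h2)
    have h2 : ω' t = 0 := by by_contra h2; exact h0 (hω'.support_subset h2)
    exact ht (by simp [h1, h2])
  · have ht9 : 9 + C ≤ t := hcT.trans ht.1
    have ht0 : 0 < t := by linarith
    obtain ⟨ρ, hρ, eρ⟩ := h a b s t ha hb hs4 (by linarith)
    have hρ1 : ‖ρ‖ ≤ 1 := hρ.trans ((div_le_one ht0).2 (by linarith))
    have hρT : ‖ρ‖ ≤ C / c₁ / T := by
      refine hρ.trans ?_
      rw [div_div]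
      exact div_le_div_of_nonneg_left hC (by positivity) ht.1
    -- Both the error of Stirling's formula and the change of weight are `O(W/T)`; integration over
    -- an interval of length of order `T` leaves `O(W T^{3r})`.
    have e2 : ((Real.pi : ℂ) ^ 3) ^ (-s) * (gFactor a b s t * ω t) -
        ((t / (2 * Real.pi) : ℝ) : ℂ) ^ (3 * s) * ω' t =
        ((t / (2 * Real.pi) : ℝ) : ℂ) ^ (3 * s) * ((exp ρ - 1) * ω t + (ω t - ω' t)) := by
      rw [← mul_assoc, eρ]; ring
    have hp1 : 1 ≤ t / (2 * Real.pi) := by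
      rw [one_le_div (by positivity)]
      linarith [Real.pi_le_four]
    have hp2 : t / (2 * Real.pi) ≤ t := div_le_self ht0.le (by linarith [Real.pi_gt_three])
    have hr0 : 0 ≤ r := (norm_nonneg _).trans hs
    have h1 : ‖((t / (2 * Real.pi) : ℝ) : ℂ) ^ (3 * s)‖ ≤ k * T ^ (3 * r) := by
      rw [norm_cpow_eq_rpow_re_of_pos (by linarith)]
      have : (3 * s).re = 3 * s.re := by simp
      rw [this]
      calc _ ≤ (t / (2 * Real.pi)) ^ (3 * r) :=
            Real.rpow_le_rpow_of_exponent_le hp1 (by linarith [hsre.2])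
        _ ≤ t ^ (3 * r) := Real.rpow_le_rpow (by linarith) hp2 (by linarith)
        _ ≤ _ := rpow_le_of_mem_Icc hc₁ hT0 ht (abs_le.2 ⟨by linarith, by linarith⟩)
    have h2 : ‖(exp ρ - 1) * ω t + (ω t - ω' t)‖ ≤ (2 * (C / c₁) + 1) * W / T := by
      refine (norm_add_le _ _).trans ?_
      rw [norm_mul]
      have h3 : ‖exp ρ - 1‖ ≤ 2 * (C / c₁ / T) := (norm_exp_sub_one_le hρ1).trans (by linarith)
      have h4 : ‖exp ρ - 1‖ * ‖ω t‖ ≤ 2 * (C / c₁ / T) * W :=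
        mul_le_mul h3 (hω.norm_le t ht) (norm_nonneg _) (by positivity)
      have h5 := hdiff t ht
      have h6 : (2 * (C / c₁) + 1) * W / T = 2 * (C / c₁ / T) * W + W / T := by ring
      rw [h6]
      linarith
    rw [e2, norm_mul]
    exact mul_le_mul h1 h2 (norm_nonneg _) (by positivity)
  · field_simp

end SixthMoment

end

section

open Complex Filter Topology MeasureTheory

namespace SixthMoment

/-! ### The diagonal term as a contour integral -/

lemma lineIntegral_congr {σ : ℝ} {f g : ℂ → ℂ} (h : ∀ z : ℂ, z.re = σ → f z = g z) :
    lineIntegral σ f = lineIntegral σ g := by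
  unfold lineIntegral
  congr 2
  ext u
  exact h _ (by simp)

lemma diagIntegrand₁_eq {a b : Fin 3 → ℂ} {G : ℂ → ℂ} {ω : ℝ → ℂ} (n : ℕ) {s : ℂ} (hs : s ≠ 0) :
    diagIntegrand₁ a b G ω n s =
      (n : ℂ) ^ (-(2 * s)) * (G s / s * (((Real.pi : ℂ) ^ 3) ^ (-s) * gWeight a b ω s)) := by
  have h : ((Real.pi : ℂ) ^ 3 * (n : ℂ) ^ 2) ^ (-s) =
      ((Real.pi : ℂ) ^ 3) ^ (-s) * (n : ℂ) ^ (-(2 * s)) := by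
    -- For `n = 0` both sides vanish, since `0 ^ x = 0` for `x ≠ 0`; hence the condition `s ≠ 0`.
    rcases eq_or_ne n 0 with rfl | hn
    · simp [hs]
    have hn0 : (n : ℂ) ≠ 0 := by exact_mod_cast hn
    have h1 := mul_cpow_ofReal_nonneg (a := Real.pi ^ 3) (b := (n : ℝ) ^ 2) (by positivity)
      (by positivity) (-s)
    push_cast at h1
    rw [h1, sq, natCast_mul_natCast_cpow, ← cpow_add _ _ hn0]
    congr 2
    ring
  rw [diagIntegrand₁, h, gWeight]
  ring

/-- On `Re s = 1` the terms of the Dirichlet series at `1 + 2s` have the same norm as at `3`, where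
the series converges absolutely. The sum of the `L¹` norms is therefore finite, and sum and integral
can be exchanged. -/
lemma diag₁_eq_lineIntegral {δ : ℝ} (hδ1 : δ ≤ 1) {a b : Fin 3 → ℂ}
    (ha : ∀ i, ‖a i‖ ≤ δ / 4) (hb : ∀ i, ‖b i‖ ≤ δ / 4) {G : ℂ → ℂ} {ω : ℝ → ℂ}
    (hH : LineIntegrable 1 fun s => G s / s * (((Real.pi : ℂ) ^ 3) ^ (-s) * gWeight a b ω s)) :
    (∀ n, LineIntegrable 1 (diagIntegrand₁ a b G ω n)) ∧ Summable (diagTerm₁ a b G ω) ∧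
      diag₁ a b G ω = lineIntegral 1 fun s =>
        eulerZ a b (2 * s) * (G s / s * (((Real.pi : ℂ) ^ 3) ^ (-s) * gWeight a b ω s)) := by
  set H : ℂ → ℂ := fun s => G s / s * (((Real.pi : ℂ) ^ 3) ^ (-s) * gWeight a b ω s) with hHdef
  set L : ℝ → ℂ := fun u => ((1 : ℝ) : ℂ) + (u : ℂ) * I with hL
  have hLre : ∀ u, (L u).re = 1 := fun u => by simp [hL]
  have hL0 : ∀ u, L u ≠ 0 := fun u h => by
    have := congrArg re h
    rw [hLre] at this
    simp at this
  have hI : ∀ n, LineIntegrable 1 (diagIntegrand₁ a b G ω n) := by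
    intro n
    have e : (fun u : ℝ => diagIntegrand₁ a b G ω n (L u)) =
        fun u : ℝ => (n : ℂ) ^ (-(2 * L u)) * H (L u) := by
      ext u; exact diagIntegrand₁_eq n (hL0 u)
    rw [LineIntegrable, e]
    rcases eq_or_ne n 0 with rfl | hn
    · have : ∀ u, -(2 * L u) ≠ 0 := fun u => by simpa using hL0 u
      simp [zero_cpow (this _)]
    have hn0 : (n : ℂ) ≠ 0 := by exact_mod_cast hn
    refine Integrable.mono hH (AEStronglyMeasurable.mul ?_ hH.aestronglyMeasurable) ?_
    · refine Continuous.aestronglyMeasurable ?_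
      exact Continuous.const_cpow (by fun_prop) (Or.inl hn0)
    · refine Eventually.of_forall fun u => ?_
      rw [norm_mul, norm_natCast_cpow_of_pos (Nat.pos_of_ne_zero hn)]
      refine mul_le_of_le_one_left (norm_nonneg _) ?_
      refine Real.rpow_le_one_of_one_le_of_nonpos (by exact_mod_cast Nat.one_le_iff_ne_zero.2 hn) ?_
      have : (-(2 * L u)).re = -2 := by rw [neg_re, mul_re, hLre]; simp
      rw [this]; norm_num
  set f : ℕ → ℂ := fun n => sigma a n * sigma b n with hf
  set F : ℕ → ℝ → ℂ := fun n u => LSeries.term f (1 + 2 * L u) n * H (L u) with hF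
  have hFd : ∀ n u, F n u = f n / n * diagIntegrand₁ a b G ω n (L u) := by
    intro n u
    simp only [hF]
    rw [diagIntegrand₁_eq n (hL0 u), ← mul_assoc]
    rcases eq_or_ne n 0 with rfl | hn
    · simp
    have hn0 : (n : ℂ) ≠ 0 := by exact_mod_cast hn
    rw [LSeries.term_of_ne_zero hn, cpow_add _ _ hn0, cpow_one, cpow_neg (n : ℂ)]
    ring
  have hFi : ∀ n, Integrable (F n) := by
    intro n
    have : F n = fun u => f n / n * diagIntegrand₁ a b G ω n (L u) := funext (hFd n)
    rw [this]
    exact (hI n).const_mul _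
  have hFn : ∀ n u, ‖F n u‖ = ‖LSeries.term f 3 n‖ * ‖H (L u)‖ := by
    intro n u
    simp only [hF]
    rw [norm_mul, LSeries.norm_term_eq, LSeries.norm_term_eq]
    have : (1 + 2 * L u).re = (3 : ℂ).re := by
      rw [add_re, mul_re, hLre]; simp; norm_num
    rw [this]
  have hsum3 : LSeriesSummable f 3 := by
    refine LSeriesSummable_sigma_mul_sigma ha hb ?_
    norm_num
    linarith
  have hFs : Summable fun n => ∫ u, ‖F n u‖ := by
    simp_rw [hFn, integral_const_mul]
    exact hsum3.norm.mul_right _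
  have hs := hasSum_integral_of_summable_integral_norm hFi hFs
  have hterm : ∀ n, diagTerm₁ a b G ω n = 1 / (2 * (Real.pi : ℂ)) * ∫ u, F n u := by
    intro n
    simp_rw [hFd, integral_const_mul]
    rw [diagTerm₁, lineIntegral]
    ring
  have hs2 := hs.mul_left (1 / (2 * (Real.pi : ℂ)))
  simp_rw [← hterm] at hs2
  refine ⟨hI, hs2.summable, ?_⟩
  rw [diag₁, hs2.tsum_eq, lineIntegral]
  congr 2
  ext u
  change ∑' n, F n u = eulerZ a b (2 * L u) * H (L u)
  simp only [hF]
  rw [tsum_mul_right, (eulerZ_eq_LSeries ha hb (w := 2 * L u) (by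
    rw [mul_re, hLre]; simp; linarith)).2]
  rfl

/-! ### The integrand with its poles made explicit -/

/-- The ten possible poles of `𝒵_{a,b}(2s) G(s)/s`. -/
noncomputable def node (a b : Fin 3 → ℂ) (o : Option (Fin 3 × Fin 3)) : ℂ := o.elim 0 (poleAt a b)

/-- The numerator of `𝒵_{a,b}(2s) G(s) X(s) / s` over `∏ (s - node)`. -/
noncomputable def contourNum (a b : Fin 3 → ℂ) (G X : ℂ → ℂ) (s : ℂ) : ℂ :=
  regZ a b s * G s * X s / 2 ^ 9

lemma prod_two_mul_sub (a b : Fin 3 → ℂ) (s : ℂ) (u : Finset (Fin 3 × Fin 3)) :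
    ∏ p ∈ u, (2 * (s - poleAt a b p)) = 2 ^ u.card * ∏ p ∈ u, (s - poleAt a b p) := by
  rw [Finset.prod_mul_distrib, Finset.prod_const]

/-- The node `none` supplies the factor `1/s`, and `2 ^ 9` collects the factors `2` in `2s + a_i +
b_j`. -/
lemma contourNum_div_prod {a b : Fin 3 → ℂ} {G X : ℂ → ℂ} {s : ℂ} (hs : ∀ p, s ≠ poleAt a b p) :
    contourNum a b G X s / ∏ o, (s - node a b o) = eulerZ a b (2 * s) * (G s / s * X s) := by
  rw [eulerZ_two_mul hs, prod_two_mul_sub, Fintype.prod_option]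
  simp only [node, Option.elim, sub_zero, contourNum, Finset.card_univ, Fintype.card_prod,
    Fintype.card_fin]
  norm_num
  ring

lemma norm_poleAt_le {δ : ℝ} {a b : Fin 3 → ℂ} (ha : ∀ i, ‖a i‖ ≤ δ / 4) (hb : ∀ i, ‖b i‖ ≤ δ / 4)
    (p : Fin 3 × Fin 3) : ‖poleAt a b p‖ ≤ δ / 4 := by
  rw [poleAt, norm_div, norm_ofNat]
  have := norm_sub_le (-a p.1) (b p.2)
  rw [norm_neg] at this
  linarith [ha p.1, hb p.2]

lemma norm_node_le {δ : ℝ} {a b : Fin 3 → ℂ} (ha : ∀ i, ‖a i‖ ≤ δ / 4)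
    (hb : ∀ i, ‖b i‖ ≤ δ / 4) (o : Option (Fin 3 × Fin 3)) : ‖node a b o‖ ≤ δ / 4 := by
  cases o with
  | none => simpa [node] using (norm_nonneg _).trans (ha 0)
  | some p => exact norm_poleAt_le ha hb p

lemma node_injective {a b : Fin 3 → ℂ} (hne : ∀ i j, a i + b j ≠ 0)
    (hinj : Function.Injective fun p : Fin 3 × Fin 3 => a p.1 + b p.2) :
    Function.Injective (node a b) := by
  have h0 : ∀ p, poleAt a b p ≠ 0 := by
    intro p h
    apply hne p.1 p.2
    rw [poleAt] at h
    linear_combination (-2 : ℂ) * h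
  rintro (_ | p) (_ | q) h
  · rfl
  · exact absurd h.symm (h0 q)
  · exact absurd h (h0 p)
  · congr 1
    apply hinj
    change poleAt a b p = poleAt a b q at h
    rw [poleAt, poleAt] at h
    change a p.1 + b p.2 = a q.1 + b q.2
    linear_combination (-2 : ℂ) * h

/-- The residue of `𝒵_{a,b}(2s)`. -/
lemma residue_calZ {δ : ℝ} (hδ : 0 < δ) (hδ1 : δ ≤ 1 / 16) {a b : Fin 3 → ℂ}
    (ha : ∀ i, ‖a i‖ ≤ δ / 4) (hb : ∀ i, ‖b i‖ ≤ δ / 4)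
    (hinj : Function.Injective (node a b)) (p : Fin 3 × Fin 3) :
    residue (fun s => calZ a b (2 * s)) (poleAt a b p) =
      regZ a b (poleAt a b p) / (2 ^ 9 * ∏ q ∈ Finset.univ.erase p, (poleAt a b p - poleAt a b q)) := by
  classical
  have hne : ∀ q ∈ Finset.univ.erase p, poleAt a b p ≠ poleAt a b q := by
    intro q hq h
    have : (some p : Option (Fin 3 × Fin 3)) = some q := hinj h
    exact (Finset.mem_erase.1 hq).1 (Option.some_injective _ this).symm
  have hcont := isContinuation_eulerZ hδ (by linarith) ha hb
  have heq := isContinuation_eqOn (isContinuation_calZ hcont) hcont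
  -- Inside `O` the other poles are excluded and `2z` lies in the half-plane where the continuation
  -- is unique.
  set O : Set ℂ := {z | -(1 / 8) < z.re} ∩ ⋂ q ∈ Finset.univ.erase p, {z | z ≠ poleAt a b q} with hO
  have hOo : IsOpen O := (isOpen_lt continuous_const continuous_re).inter
    (isOpen_biInter_finset fun q _ => isOpen_ne)
  have hpO : poleAt a b p ∈ O := by
    refine ⟨?_, Set.mem_iInter₂.2 hne⟩
    have := abs_le.1 ((abs_re_le_norm _).trans (norm_poleAt_le ha hb p))
    change -(1 / 8) < (poleAt a b p).re
    linarith [this.1]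
  obtain ⟨r, hr, hrO⟩ := Metric.isOpen_iff.1 hOo _ hpO
  have hOne : ∀ z ∈ O, ∀ q ∈ Finset.univ.erase p, z - poleAt a b q ≠ 0 := fun z hz q hq =>
    sub_ne_zero.2 (Set.mem_iInter₂.1 hz.2 q hq)
  refine residue_eq_of_eq_div (h := fun s => regZ a b s / (2 ^ 9 * ∏ q ∈ Finset.univ.erase p,
    (s - poleAt a b q))) hr ?_ ?_
  · refine DifferentiableOn.div ?_ (by fun_prop) fun z hz => ?_
    · refine (differentiableOn_regZ hδ ha hb).mono fun z hz => ?_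
      have h1 : -(1 / 8) < z.re := (hrO hz).1
      change -(1 / 4) + δ / 2 < z.re
      linarith
    · exact mul_ne_zero (by norm_num) (Finset.prod_ne_zero_iff.2 (hOne z (hrO hz)))
  · intro z hz hzp
    have hzO := hrO hz
    have hzq : ∀ q, z ≠ poleAt a b q := by
      intro q
      rcases eq_or_ne q p with rfl | hq
      · exact hzp
      · exact sub_ne_zero.1 (hOne z hzO q (Finset.mem_erase.2 ⟨hq, Finset.mem_univ q⟩))
    have hmem : 2 * z ∈ {w : ℂ | -(1 / 4 : ℝ) < w.re} \ poleSet a b := by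
      refine ⟨?_, ?_⟩
      · have h1 : -(1 / 8) < z.re := hzO.1
        change -(1 / 4) < (2 * z).re
        simp
        linarith
      · rintro ⟨i, j, h⟩
        apply hzq (i, j)
        rw [poleAt]
        linear_combination h / 2
    rw [heq hmem, eulerZ_two_mul hzq, prod_two_mul_sub, ← Finset.mul_prod_erase _ _ (Finset.mem_univ p)]
    have h1 := sub_ne_zero.2 hzp
    have h2 := Finset.prod_ne_zero_iff.2 (hOne z hzO)
    simp only [Finset.card_univ, Fintype.card_prod, Fintype.card_fin]
    norm_num
    field_simp

lemma calZ_zero {δ : ℝ} (hδ : 0 < δ) (hδ1 : δ ≤ 1 / 16) {a b : Fin 3 → ℂ}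
    (ha : ∀ i, ‖a i‖ ≤ δ / 4) (hb : ∀ i, ‖b i‖ ≤ δ / 4) (hne : ∀ i j, a i + b j ≠ 0) :
    calZ a b 0 = regZ a b 0 / (2 ^ 9 * ∏ p, (0 - poleAt a b p)) := by
  have hcont := isContinuation_eulerZ hδ (by linarith) ha hb
  have heq := isContinuation_eqOn (isContinuation_calZ hcont) hcont
  rw [heq (x := 0)]
  · have h0 : ∀ p, (0 : ℂ) ≠ poleAt a b p := by
      intro p h
      apply hne p.1 p.2
      rw [poleAt] at h
      linear_combination 2 * h
    have := eulerZ_two_mul h0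
    rw [mul_zero, prod_two_mul_sub] at this
    rw [this]
    simp
  · refine ⟨by simp, ?_⟩
    rintro ⟨i, j, h⟩
    exact hne i j (by linear_combination h)

/-- The sum of residues in terms of `𝒵_{a,b}`. -/
lemma residueSum_contourNum {δ : ℝ} (hδ : 0 < δ) (hδ1 : δ ≤ 1 / 16) {a b : Fin 3 → ℂ}
    (ha : ∀ i, ‖a i‖ ≤ δ / 4) (hb : ∀ i, ‖b i‖ ≤ δ / 4) (hne : ∀ i j, a i + b j ≠ 0)
    (hinj : Function.Injective fun p : Fin 3 × Fin 3 => a p.1 + b p.2) {G X : ℂ → ℂ} (hG : G 0 = 1) :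
    residueSum (node a b) (contourNum a b G X) = calZ a b 0 * X 0 +
      ∑ i : Fin 3, ∑ j : Fin 3, residue (fun s => calZ a b (2 * s)) ((-a i - b j) / 2) *
        (G ((-a i - b j) / 2) / ((-a i - b j) / 2)) * X ((-a i - b j) / 2) := by
  classical
  have hinj' := node_injective hne hinj
  rw [residueSum, Fintype.sum_option]
  congr 1
  · rw [calZ_zero hδ hδ1 ha hb hne]
    have e : Lagrange.nodalWeight Finset.univ (node a b) none = (∏ p, (0 - poleAt a b p))⁻¹ := by
      rw [Lagrange.nodalWeight, Finset.prod_inv_distrib]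
      congr 1
    rw [e]
    change _ * contourNum a b G X 0 = _
    rw [contourNum, hG]
    ring
  · rw [← Fintype.sum_prod_type']
    refine Finset.sum_congr rfl fun p _ => ?_
    change Lagrange.nodalWeight Finset.univ (node a b) (some p) * contourNum a b G X (poleAt a b p) =
      residue (fun s => calZ a b (2 * s)) (poleAt a b p) * (G (poleAt a b p) / poleAt a b p) *
        X (poleAt a b p)
    rw [residue_calZ hδ hδ1 ha hb hinj']
    -- The node at `0` contributes the factor `poleAt a b p`, the denominator of `G(s)/s` at the
    -- pole.
    have e : Lagrange.nodalWeight Finset.univ (node a b) (some p) =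
        (poleAt a b p * ∏ q ∈ Finset.univ.erase p, (poleAt a b p - poleAt a b q))⁻¹ := by
      rw [Lagrange.nodalWeight, Finset.prod_inv_distrib]
      congr 1
      have : (Finset.univ : Finset (Option (Fin 3 × Fin 3))).erase (some p) =
          insert none ((Finset.univ.erase p).map Function.Embedding.some) := by
        ext o; cases o <;> simp
      rw [this, Finset.prod_insert (by simp), Finset.prod_map]
      simp [node]
    rw [e, contourNum]
    ring

lemma residueSum_sub {ι : Type*} [Fintype ι] [DecidableEq ι] (v : ι → ℂ) (Φ Ψ : ℂ → ℂ) :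
    residueSum v Φ - residueSum v Ψ = residueSum v (fun z => Φ z - Ψ z) := by
  simp only [residueSum, mul_sub, Finset.sum_sub_distrib]

end SixthMoment

end

section

open Complex Filter Topology MeasureTheory

namespace SixthMoment

/-! ### The diagonal term for bounded weights -/

/-- The weight `(π³)^{-s} ∫ g(s,t) ω(t) dt`. -/
noncomputable def piWeight (a b : Fin 3 → ℂ) (ω : ℝ → ℂ) (s : ℂ) : ℂ :=
  ((Real.pi : ℂ) ^ 3) ^ (-s) * gWeight a b ω s

lemma norm_pi_pow_cpow_le {s : ℂ} (hs : -1 ≤ s.re) :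
    ‖((Real.pi : ℂ) ^ 3) ^ (-s)‖ ≤ Real.pi ^ 3 := by
  have h : ((Real.pi : ℂ) ^ 3) = ((Real.pi ^ 3 : ℝ) : ℂ) := by push_cast; rfl
  rw [h, norm_cpow_eq_rpow_re_of_pos (by positivity)]
  have h1 : 1 ≤ Real.pi ^ 3 := one_le_pow₀ (by linarith [Real.pi_gt_three])
  calc (Real.pi ^ 3) ^ (-s).re ≤ (Real.pi ^ 3) ^ (1 : ℝ) :=
        Real.rpow_le_rpow_of_exponent_le h1 (by rw [neg_re]; linarith)
    _ = _ := Real.rpow_one _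

lemma differentiableOn_piWeight {a b : Fin 3 → ℂ} {ω : ℝ → ℂ} {α β W : ℝ}
    (ha : ∀ i, ‖a i‖ ≤ 1 / 16) (hb : ∀ i, ‖b i‖ ≤ 1 / 16) (hω : IsBoundedWeight α β W ω) :
    DifferentiableOn ℂ (piWeight a b ω) {s : ℂ | -(1 / 4) < s.re} := by
  refine DifferentiableOn.mul ?_ (differentiableOn_gWeight ha hb hω)
  refine Differentiable.differentiableOn fun s => ?_
  refine DifferentiableAt.const_cpow (by fun_prop) (Or.inl ?_)
  exact pow_ne_zero _ (ofReal_ne_zero.2 Real.pi_ne_zero)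

lemma inv_pow_norm_prod_le {ι : Type*} [Fintype ι] {v : ι → ℂ} {z : ℂ} {d : ℝ} (hd : 0 < d)
    (h : ∀ i, d ≤ ‖z - v i‖) : ‖(∏ i, (z - v i))⁻¹‖ ≤ (d ^ Fintype.card ι)⁻¹ := by
  rw [norm_inv, norm_prod]
  refine inv_anti₀ (by positivity) ?_
  rw [← Finset.card_univ, ← Finset.prod_const]
  exact Finset.prod_le_prod (fun i _ => hd.le) fun i _ => h i

/-- The decay exponent is `29 = 18 + 9 + 2`: growth of `regZ`, growth of the Gamma quotients, and
two powers for integrability. -/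
lemma one_add_norm_pow_le (z : ℂ) :
    (1 + ‖z‖) ^ 18 * (1 + |z.im|) ^ 9 * ((1 + ‖z‖) ^ 29)⁻¹ ≤ (1 + z.im ^ 2)⁻¹ := by
  have h0 : 0 < 1 + ‖z‖ := by positivity
  have h1 : (1 + |z.im|) ^ 9 ≤ (1 + ‖z‖) ^ 9 := by
    gcongr
    exact abs_im_le_norm z
  calc (1 + ‖z‖) ^ 18 * (1 + |z.im|) ^ 9 * ((1 + ‖z‖) ^ 29)⁻¹
      ≤ (1 + ‖z‖) ^ 18 * (1 + ‖z‖) ^ 9 * ((1 + ‖z‖) ^ 29)⁻¹ := by gcongr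
    _ = ((1 + ‖z‖) ^ 2)⁻¹ := by field_simp
    _ ≤ _ := by
      refine inv_anti₀ (by positivity) ?_
      have := pow_le_pow_left₀ (abs_nonneg _) (abs_im_le_norm z) 2
      rw [sq_abs] at this
      nlinarith [norm_nonneg z]

/-- The bound for the integrand away from its poles. -/
lemma exists_norm_contourNum_div_le {δ : ℝ} (hδ : 0 < δ) (hδ1 : δ ≤ 1 / 16) {c₁ c₂ : ℝ}
    (hc₁ : 0 < c₁) (hc₂ : c₁ < c₂) {κ : ℝ} (hκ : 0 ≤ κ) :
    ∃ A : ℝ, 0 ≤ A ∧ ∀ (T W : ℝ) (a b : Fin 3 → ℂ) (G : ℂ → ℂ) (ω : ℝ → ℂ), 0 < T → 1 ≤ c₁ * T →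
      0 ≤ W → (∀ i, ‖a i‖ ≤ δ / 4) → (∀ i, ‖b i‖ ≤ δ / 4) →
      (∀ s : ℂ, |s.re| ≤ 1 → ‖G s‖ ≤ κ * ((1 + ‖s‖) ^ 29)⁻¹) →
      IsBoundedWeight (c₁ * T) (c₂ * T) W ω →
      ∀ z : ℂ, -(1 / 4) + δ / 2 ≤ z.re → z.re ≤ 1 → (∀ o, 1 / 8 ≤ ‖z - node a b o‖) →
        ‖contourNum a b G (piWeight a b ω) z / ∏ o, (z - node a b o)‖ ≤
          A * W * T ^ (1 + 3 * z.re) * (1 + z.im ^ 2)⁻¹ := by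
  obtain ⟨C₁, hC₁, h₁⟩ := exists_norm_regZ_le hδ (by linarith : δ ≤ 1 / 4)
  obtain ⟨C₂, hC₂, h₂⟩ := exists_norm_gWeight_le hc₁ hc₂
  refine ⟨C₁ * κ * Real.pi ^ 3 * C₂ * 8 ^ 10, by positivity, ?_⟩
  intro T W a b G ω hT hcT hW ha hb hG hω z hz hz1 hnode
  have hR := h₁ a b ha hb z hz
  have hGz := hG z (abs_le.2 ⟨by linarith, hz1⟩)
  have hg := h₂ T W a b ω hT hcT hW (fun i => (ha i).trans (by linarith))
    (fun i => (hb i).trans (by linarith)) hω z (by linarith) hz1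
  have hp := norm_pi_pow_cpow_le (s := z) (by linarith)
  have hprod := inv_pow_norm_prod_le (by norm_num) hnode
  have hcard : Fintype.card (Option (Fin 3 × Fin 3)) = 10 := by simp
  rw [hcard] at hprod
  have hTp : 0 ≤ T ^ (1 + 3 * z.re) := Real.rpow_nonneg hT.le _
  rw [div_eq_mul_inv, norm_mul, contourNum, piWeight, norm_div, norm_mul, norm_mul, norm_mul]
  calc ‖regZ a b z‖ * ‖G z‖ * (‖((Real.pi : ℂ) ^ 3) ^ (-z)‖ * ‖gWeight a b ω z‖) / ‖(2 ^ 9 : ℂ)‖ *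
        ‖(∏ o, (z - node a b o))⁻¹‖
      ≤ C₁ * (1 + ‖z‖) ^ 18 * (κ * ((1 + ‖z‖) ^ 29)⁻¹) *
        (Real.pi ^ 3 * (C₂ * W * T ^ (1 + 3 * z.re) * (1 + |z.im|) ^ 9)) / 1 * ((1 / 8) ^ 10)⁻¹ := by
        gcongr
        norm_num
    _ = C₁ * κ * Real.pi ^ 3 * C₂ * 8 ^ 10 * W * T ^ (1 + 3 * z.re) *
        ((1 + ‖z‖) ^ 18 * (1 + |z.im|) ^ 9 * ((1 + ‖z‖) ^ 29)⁻¹) := by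
        rw [div_one, one_div, inv_pow, inv_inv]; ring
    _ ≤ _ := by
        gcongr
        exact one_add_norm_pow_le z

lemma norm_lineIntegral_le {f : ℂ → ℂ} {σ M : ℝ}
    (hM : ∀ y : ℝ, ‖f (σ + y * I)‖ ≤ M * (1 + y ^ 2)⁻¹) : ‖lineIntegral σ f‖ ≤ M := by
  have hM0 : 0 ≤ M := by simpa using (norm_nonneg _).trans (hM 0)
  have h := norm_integral_le_of_norm_le (integrable_inv_one_add_sq.const_mul M)
    (Eventually.of_forall hM)
  rw [integral_const_mul, integral_univ_inv_one_add_sq] at h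
  have hpi := Real.pi_pos
  have e : ‖(1 / (2 * (Real.pi : ℂ)))‖ = 1 / (2 * Real.pi) := by
    rw [norm_div, norm_mul, norm_real, Real.norm_of_nonneg hpi.le]; simp
  rw [lineIntegral, norm_mul, e]
  calc 1 / (2 * Real.pi) * ‖∫ u : ℝ, f (σ + u * I)‖ ≤ 1 / (2 * Real.pi) * (M * Real.pi) := by gcongr
    _ = M / 2 := by field_simp
    _ ≤ M := by linarith

/-- The change of the residues when the weight is replaced by its main term. -/
lemma exists_norm_residueSum_sub_le {δ : ℝ} (hδ : 0 < δ) (hδ1 : δ ≤ 1 / 16) {c₁ c₂ : ℝ}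
    (hc₁ : 0 < c₁) (hc₂ : c₁ < c₂) {κ : ℝ} (hκ : 0 ≤ κ) :
    ∃ A : ℝ, 0 ≤ A ∧ ∃ T₁ : ℝ, ∀ (T W : ℝ) (a b : Fin 3 → ℂ) (G : ℂ → ℂ) (ω ω' : ℝ → ℂ), 1 ≤ T →
      T₁ ≤ T → 0 ≤ W → (∀ i, ‖a i‖ ≤ δ / 4) → (∀ i, ‖b i‖ ≤ δ / 4) →
      Function.Injective (node a b) → Differentiable ℂ G →
      (∀ s : ℂ, |s.re| ≤ 1 → ‖G s‖ ≤ κ * ((1 + ‖s‖) ^ 29)⁻¹) →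
      IsBoundedWeight (c₁ * T) (c₂ * T) W ω → IsBoundedWeight (c₁ * T) (c₂ * T) W ω' →
      (∀ t ∈ Set.Icc (c₁ * T) (c₂ * T), ‖ω t - ω' t‖ ≤ W / T) →
      ‖residueSum (node a b) (contourNum a b G (piWeight a b ω)) -
        residueSum (node a b) (contourNum a b G (mainWeight ω'))‖ ≤ A * W * T ^ (3 * δ) := by
  obtain ⟨C₁, hC₁, h₁⟩ := exists_norm_regZ_le hδ (by linarith : δ ≤ 1 / 4)
  obtain ⟨C₂, hC₂, T₁, h₂⟩ := exists_norm_gWeight_sub_mainWeight_le hc₁ hc₂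
  refine ⟨δ * (C₁ * 2 ^ 18 * κ * C₂ * ((δ / 2) ^ 10)⁻¹), by positivity, T₁, ?_⟩
  intro T W a b G ω ω' hT hT₁ hW ha hb hinj hGd hG hω hω' hd
  have hT0 : 0 < T := by linarith
  have ha' : ∀ i, ‖a i‖ ≤ 1 / 16 := fun i => (ha i).trans (by linarith)
  have hb' : ∀ i, ‖b i‖ ≤ 1 / 16 := fun i => (hb i).trans (by linarith)
  have hball : ∀ z ∈ Metric.closedBall (0 : ℂ) δ, ‖z‖ ≤ δ ∧ |z.re| ≤ δ := fun z hz => by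
    rw [mem_closedBall_zero_iff] at hz
    exact ⟨hz, (abs_re_le_norm z).trans hz⟩
  have e : ∀ z, contourNum a b G (piWeight a b ω) z - contourNum a b G (mainWeight ω') z =
      regZ a b z * G z * (piWeight a b ω z - mainWeight ω' z) / 2 ^ 9 := fun z => by
    rw [contourNum, contourNum]; ring
  rw [residueSum_sub]
  simp only [e]
  -- All nodes have norm at most `δ/4`, so on `|z| = δ` each factor `z - node` has norm at least
  -- `δ/2`, however close the nodes are to one another.
  rw [← circleIntegral_div_prod (r := δ) hinj ?_ ?_]
  · rw [← smul_eq_mul]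
    refine (circleIntegral.norm_two_pi_i_inv_smul_integral_le_of_norm_le_const hδ.le
      (C := C₁ * 2 ^ 18 * κ * C₂ * ((δ / 2) ^ 10)⁻¹ * W * T ^ (3 * δ)) fun z hz => ?_).trans
        (le_of_eq (by ring))
    have hzδ : ‖z‖ = δ := by simpa using hz
    obtain ⟨-, hzre⟩ := hball z (Metric.sphere_subset_closedBall hz)
    have hzre' := abs_le.1 hzre
    have hR := h₁ a b ha hb z (by linarith [hzre'.1])
    have hGz : ‖G z‖ ≤ κ := by
      refine (hG z (by linarith)).trans (mul_le_of_le_one_right hκ (inv_le_one_of_one_le₀ ?_))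
      exact one_le_pow₀ (by linarith [norm_nonneg z])
    have hX := h₂ T W δ a b ω ω' hT hT₁ hW (by linarith) ha' hb' hω hω' hd z hzδ.le
    have hprod := inv_pow_norm_prod_le (v := node a b) (z := z) (half_pos hδ) fun o => by
      have h1 := norm_sub_norm_le z (node a b o)
      have h2 := norm_node_le ha hb o
      linarith
    have hcard : Fintype.card (Option (Fin 3 × Fin 3)) = 10 := by simp
    rw [hcard] at hprod
    have hTp : 0 ≤ T ^ (3 * δ) := Real.rpow_nonneg hT0.le _
    rw [div_eq_mul_inv, norm_mul, norm_div, norm_mul, norm_mul]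
    have hX' : ‖piWeight a b ω z - mainWeight ω' z‖ ≤ C₂ * W * T ^ (3 * δ) := hX
    calc _ ≤ C₁ * (1 + 1) ^ 18 * κ * (C₂ * W * T ^ (3 * δ)) / 1 * ((δ / 2) ^ 10)⁻¹ := by
          gcongr
          · refine hR.trans ?_
            gcongr
            linarith
          · norm_num
      _ = _ := by rw [div_one]; norm_num; ring
  · intro o
    rw [mem_ball_zero_iff]
    linarith [norm_node_le ha hb o]
  · refine DifferentiableOn.div_const (((DifferentiableOn.mul ?_ hGd.differentiableOn)).mul
      (DifferentiableOn.sub ?_ ?_)) _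
    · refine (differentiableOn_regZ hδ ha hb).mono fun z hz => ?_
      change -(1 / 4) + δ / 2 < z.re
      linarith [(abs_le.1 (hball z hz).2).1]
    · refine (differentiableOn_piWeight ha' hb' hω).mono fun z hz => ?_
      change -(1 / 4) < z.re
      linarith [(abs_le.1 (hball z hz).2).1]
    · refine (differentiable_mainWeight (α := c₁ * T) (by positivity) hω').differentiableOn

lemma lineIntegrable_kernel_mul_piWeight {c₁ c₂ κ T W : ℝ} (hc₁ : 0 < c₁) (hc₂ : c₁ < c₂)
    (hT : 0 < T) (hcT : 1 ≤ c₁ * T) (hW : 0 ≤ W) {a b : Fin 3 → ℂ} (ha : ∀ i, ‖a i‖ ≤ 1 / 16)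
    (hb : ∀ i, ‖b i‖ ≤ 1 / 16) {G : ℂ → ℂ} (hGc : Continuous G)
    (hG : ∀ s : ℂ, |s.re| ≤ 1 → ‖G s‖ ≤ κ * ((1 + ‖s‖) ^ 29)⁻¹) {ω : ℝ → ℂ}
    (hω : IsBoundedWeight (c₁ * T) (c₂ * T) W ω) :
    LineIntegrable 1 fun s => G s / s * piWeight a b ω s := by
  obtain ⟨C, hC, h⟩ := exists_norm_gWeight_le hc₁ hc₂
  have hκ : 0 ≤ κ := by simpa using (norm_nonneg _).trans (hG 0 (by simp))
  have hre : ∀ y : ℝ, (((1 : ℝ) : ℂ) + y * I).re = 1 := fun y => by simp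
  have hne : ∀ y : ℝ, ((1 : ℝ) : ℂ) + y * I ≠ 0 := fun y h => by
    have := congrArg re h
    rw [hre] at this
    simp at this
  refine lineIntegrable_of_bound (M := κ * Real.pi ^ 3 * C * W * T ^ (4 : ℝ)) ?_ fun y => ?_
  · refine Continuous.mul (Continuous.div (by fun_prop) (by fun_prop) hne) ?_
    refine (differentiableOn_piWeight ha hb hω).continuousOn.comp_continuous (by fun_prop) fun y => ?_
    change -(1 / 4) < (((1 : ℝ) : ℂ) + y * I).re
    rw [hre]; norm_num
  · set z : ℂ := ((1 : ℝ) : ℂ) + y * I with hz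
    have hzre : z.re = 1 := hre y
    have hzim : z.im = y := by simp [hz]
    have hz1 : 1 ≤ ‖z‖ := by
      have := abs_re_le_norm z
      rwa [hzre, abs_one] at this
    have hGz := hG z (by rw [hzre]; simp)
    have hg := h T W a b ω hT hcT hW ha hb hω z (by rw [hzre]; norm_num) hzre.le
    have e4 : 1 + 3 * z.re = 4 := by rw [hzre]; norm_num
    rw [e4] at hg
    have hp := norm_pi_pow_cpow_le (s := z) (by rw [hzre]; norm_num)
    have hTp : 0 ≤ T ^ (4 : ℝ) := Real.rpow_nonneg hT.le _
    rw [norm_mul, norm_div, piWeight, norm_mul, ← hzim]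
    have hGz' : ‖G z‖ / ‖z‖ ≤ (1 + ‖z‖) ^ 18 * (κ * ((1 + ‖z‖) ^ 29)⁻¹) := by
      refine (div_le_self (norm_nonneg _) hz1).trans (hGz.trans ?_)
      refine le_mul_of_one_le_left (by positivity) (one_le_pow₀ (by linarith))
    calc _ ≤ (1 + ‖z‖) ^ 18 * (κ * ((1 + ‖z‖) ^ 29)⁻¹) *
          (Real.pi ^ 3 * (C * W * T ^ (4 : ℝ) * (1 + |z.im|) ^ 9)) := by gcongr
      _ = κ * Real.pi ^ 3 * C * W * T ^ (4 : ℝ) *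
          ((1 + ‖z‖) ^ 18 * (1 + |z.im|) ^ 9 * ((1 + ‖z‖) ^ 29)⁻¹) := by ring
      _ ≤ _ := by
          gcongr
          exact one_add_norm_pow_le z

/-- The asymptotic evaluation of the diagonal term for a bounded weight `ω`, with `ω` replaced in
the main terms by a close weight `ω'`. -/
lemma exists_diag₁_asymptotic {δ : ℝ} (hδ : 0 < δ) (hδ1 : δ ≤ 1 / 16) {c₁ c₂ : ℝ}
    (hc₁ : 0 < c₁) (hc₂ : c₁ < c₂) {κ : ℝ} (hκ : 0 ≤ κ) :
    ∃ A : ℝ, 0 ≤ A ∧ ∃ T₁ : ℝ, ∀ (T W : ℝ) (a b : Fin 3 → ℂ) (G : ℂ → ℂ) (ω ω' : ℝ → ℂ),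
      T₁ ≤ T → 0 ≤ W → (∀ i, ‖a i‖ ≤ δ / 4) → (∀ i, ‖b i‖ ≤ δ / 4) →
      (∀ i j, a i + b j ≠ 0) → Function.Injective (fun p : Fin 3 × Fin 3 => a p.1 + b p.2) →
      Differentiable ℂ G → G 0 = 1 →
      (∀ s : ℂ, |s.re| ≤ 1 → ‖G s‖ ≤ κ * ((1 + ‖s‖) ^ 29)⁻¹) →
      IsBoundedWeight (c₁ * T) (c₂ * T) W ω → IsBoundedWeight (c₁ * T) (c₂ * T) W ω' →
      (∀ t ∈ Set.Icc (c₁ * T) (c₂ * T), ‖ω t - ω' t‖ ≤ W / T) →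
      (∀ n, LineIntegrable 1 (diagIntegrand₁ a b G ω n)) ∧ Summable (diagTerm₁ a b G ω) ∧
      ‖diag₁ a b G ω - (calZ a b 0 * mainWeight ω' 0 +
        ∑ i : Fin 3, ∑ j : Fin 3, residue (fun s => calZ a b (2 * s)) ((-a i - b j) / 2) *
          (G ((-a i - b j) / 2) / ((-a i - b j) / 2)) * mainWeight ω' ((-a i - b j) / 2))‖ ≤
        A * W * T ^ (1 / 4 + 3 * δ) := by
  obtain ⟨A₁, hA₁, h₁⟩ := exists_norm_contourNum_div_le hδ hδ1 hc₁ hc₂ hκ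
  obtain ⟨A₂, hA₂, T₂, h₂⟩ := exists_norm_residueSum_sub_le hδ hδ1 hc₁ hc₂ hκ
  refine ⟨A₁ + A₂, by positivity, max (max 1 c₁⁻¹) T₂, ?_⟩
  intro T W a b G ω ω' hT hW ha hb hne hinj hGd hG0 hG hω hω' hd
  have hT1 : 1 ≤ T := (le_max_left _ _).trans ((le_max_left _ _).trans hT)
  have hT0 : 0 < T := by linarith
  have hcT : 1 ≤ c₁ * T := by
    have : c₁⁻¹ ≤ T := (le_max_right _ _).trans ((le_max_left _ _).trans hT)
    calc 1 = c₁ * c₁⁻¹ := (mul_inv_cancel₀ hc₁.ne').symm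
      _ ≤ c₁ * T := by gcongr
  have hT₂ : T₂ ≤ T := (le_max_right _ _).trans hT
  have ha' : ∀ i, ‖a i‖ ≤ 1 / 16 := fun i => (ha i).trans (by linarith)
  have hb' : ∀ i, ‖b i‖ ≤ 1 / 16 := fun i => (hb i).trans (by linarith)
  have hbd := h₁ T W a b G ω hT0 hcT hW ha hb hG hω
  have hnode := norm_node_le ha hb
  have hre : ∀ o, |(node a b o).re| ≤ δ / 4 := fun o => (abs_re_le_norm _).trans (hnode o)
  set f : ℂ → ℂ := fun z => contourNum a b G (piWeight a b ω) z / ∏ o, (z - node a b o) with hf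
  set S : Set ℂ := {z | -(1 / 4) + δ / 2 < z.re} with hS
  -- The nodes lie within `δ/4 ≤ 1/64` of the origin, while these points are at distance at least
  -- `3/16` from it.
  have hfar : ∀ z : ℂ, (z.re = -(1 / 4) + δ ∨ z.re = 1 ∨ 1 ≤ |z.im|) →
      ∀ o, 1 / 8 ≤ ‖z - node a b o‖ := by
    intro z hz o
    have hr := abs_le.1 (hre o)
    rcases hz with h | h | h
    · refine le_trans ?_ (abs_re_le_norm _)
      rw [sub_re, h, abs_sub_comm]
      exact le_trans (by linarith [hr.1]) (le_abs_self _)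
    · refine le_trans ?_ (abs_re_le_norm _)
      rw [sub_re, h]
      exact le_trans (by linarith [hr.2]) (le_abs_self _)
    · have h1 := norm_sub_norm_le z (node a b o)
      have h2 := abs_im_le_norm z
      linarith [hnode o]
  -- The crude constant with `T^4` only justifies the shift; the sharp bound on the left line is
  -- established separately in `hline`.
  have hshift := lineIntegral_sub_lineIntegral (v := node a b) (Φ := contourNum a b G (piWeight a b ω))
    (σ₀ := -(1 / 4) + δ) (σ₁ := 1) (M := A₁ * W * T ^ (4 : ℝ)) (S := S) (node_injective hne hinj)
    (fun o => by linarith [(abs_le.1 (hre o)).1]) (fun o => by linarith [(abs_le.1 (hre o)).2])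
    (isOpen_lt continuous_const continuous_re)
    (fun z hz _ => by change _ < z.re; linarith)
    (by
      refine DifferentiableOn.div_const (((DifferentiableOn.mul (differentiableOn_regZ hδ ha hb)
        hGd.differentiableOn)).mul ((differentiableOn_piWeight ha' hb' hω).mono fun z hz => ?_)) _
      have h1 : -(1 / 4) + δ / 2 < z.re := hz
      change -(1 / 4) < z.re
      linarith)
    (fun z hz hz1 hc => by
      refine (hbd z (by linarith) hz1 (hfar z hc)).trans ?_
      gcongr
      linarith)
  obtain ⟨hI1, hI0, hdiff⟩ := hshift
  have hne1 : ∀ z : ℂ, z.re = 1 → ∀ p, z ≠ poleAt a b p := by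
    intro z hz p h
    have := hfar z (Or.inr (Or.inl hz)) (some p)
    rw [h] at this
    norm_num [node] at this
  obtain ⟨hn, hs, hdiag⟩ := diag₁_eq_lineIntegral (by linarith : δ ≤ 1) ha hb
    (lineIntegrable_kernel_mul_piWeight hc₁ hc₂ hT0 hcT hW ha' hb' hGd.continuous hG hω)
  refine ⟨hn, hs, ?_⟩
  have hdiag' : diag₁ a b G ω = lineIntegral 1 f := by
    rw [hdiag]
    exact lineIntegral_congr fun z hz => (contourNum_div_prod (X := piWeight a b ω) (hne1 z hz)).symm
  have hline : ‖lineIntegral (-(1 / 4) + δ) f‖ ≤ A₁ * W * T ^ (1 / 4 + 3 * δ) := by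
    refine norm_lineIntegral_le fun y => ?_
    set z : ℂ := ((-(1 / 4) + δ : ℝ) : ℂ) + y * I with hz
    have hzre : z.re = -(1 / 4) + δ := by simp [hz]
    have hzim : z.im = y := by simp [hz]
    have := hbd z (by linarith) (by linarith) (hfar z (Or.inl hzre))
    rwa [hzre, hzim, show 1 + 3 * (-(1 / 4) + δ) = 1 / 4 + 3 * δ by ring] at this
  have hres := h₂ T W a b G ω ω' hT1 hT₂ hW ha hb (node_injective hne hinj) hGd hG hω hω' hd
  rw [residueSum_contourNum hδ hδ1 ha hb hne hinj hG0 (X := mainWeight ω')] at hres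
  have hTle : T ^ (3 * δ) ≤ T ^ (1 / 4 + 3 * δ) :=
    Real.rpow_le_rpow_of_exponent_le hT1 (by linarith)
  rw [hdiag', eq_add_of_sub_eq hdiff, add_sub_right_comm]
  refine (norm_add_le _ _).trans ?_
  calc _ ≤ A₂ * W * T ^ (3 * δ) + A₁ * W * T ^ (1 / 4 + 3 * δ) := add_le_add hres hline
    _ ≤ A₂ * W * T ^ (1 / 4 + 3 * δ) + A₁ * W * T ^ (1 / 4 + 3 * δ) := by gcongr
    _ = _ := by ring

end SixthMoment

end

section

open Complex Filter Topology MeasureTheory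

namespace SixthMoment

/-! ### The weight of the second diagonal term -/

/-- Adding `s = -(a_i + b_i)` to `1/2 + a_i` gives `1/2 - b_i`, and vice versa, so the numerators
agree after a swap and the asymptotics of `gammaPair` apply to `X` as well. -/
lemma XFactor_eq_prod_gammaPair (a b : Fin 3 → ℂ) (t : ℝ) :
    XFactor a b t = (Real.pi : ℂ) ^ (∑ i, (a i + b i)) *
      ∏ i, gammaPair (1 / 2 + a i) (1 / 2 + b i) (-(a i + b i)) t := by
  rw [XFactor]
  congr 1
  refine Finset.prod_congr rfl fun i _ => ?_
  rw [gammaPair, mul_comm (Gamma ((1 / 2 - a i - I * t) / 2))]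
  congr 4 <;> ring

lemma norm_half_add_le {x : ℂ} (hx : ‖x‖ ≤ 1 / 16) : ‖1 / 2 + x‖ ≤ 1 := by
  refine (norm_add_le _ _).trans ?_
  norm_num
  linarith

lemma half_add_add_neg_re_pos {x y : ℂ} (hx : ‖x‖ ≤ 1 / 16) (hy : ‖y‖ ≤ 1 / 16) :
    0 < (1 / 2 + x).re + (-(x + y)).re ∧ 0 < (1 / 2 + y).re + (-(x + y)).re := by
  have h1 := abs_le.1 ((abs_re_le_norm x).trans hx)
  have h2 := abs_le.1 ((abs_re_le_norm y).trans hy)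
  simp only [add_re, neg_re, one_div, inv_re, re_ofNat, normSq_ofNat]
  constructor <;> linarith [h1.1, h2.1, h1.2, h2.2]

lemma exists_XFactor_eq :
    ∃ C : ℝ, 0 ≤ C ∧ ∀ (a b : Fin 3 → ℂ) (t : ℝ), (∀ i, ‖a i‖ ≤ 1 / 16) →
      (∀ i, ‖b i‖ ≤ 1 / 16) → 9 ≤ t →
      ∃ ρ : ℂ, ‖ρ‖ ≤ C / t ∧
        XFactor a b t = ((t / (2 * Real.pi) : ℝ) : ℂ) ^ (-∑ i, (a i + b i)) * exp ρ := by
  obtain ⟨C, hC, h⟩ := exists_gammaPair_eq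
  refine ⟨3 * C, by positivity, fun a b t ha hb ht => ?_⟩
  have ht0 : 0 < t := by linarith
  have key : ∀ i, ∃ ρ : ℂ, ‖ρ‖ ≤ C / t ∧
      gammaPair (1 / 2 + a i) (1 / 2 + b i) (-(a i + b i)) t =
        exp (-(a i + b i) * Real.log (t / 2) + ρ) := by
    intro i
    have h1 := (half_add_re_bounds (ha i)).1
    have h2 := (half_add_re_bounds (hb i)).1
    obtain ⟨h3, h4⟩ := half_add_add_neg_re_pos (ha i) (hb i)
    refine h _ _ _ t (norm_half_add_le (ha i)) (norm_half_add_le (hb i)) ?_ (by linarith)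
      (by linarith) h3 h4 ht
    rw [norm_neg]
    linarith [norm_add_le (a i) (b i), ha i, hb i]
  choose ρ hρ e using key
  refine ⟨∑ i, ρ i, ?_, ?_⟩
  · refine (norm_sum_le_of_le _ fun i _ => hρ i).trans (le_of_eq ?_)
    simp
    ring
  · have hb0 : ((t / (2 * Real.pi) : ℝ) : ℂ) ≠ 0 := by
      have : t / (2 * Real.pi) ≠ 0 := by positivity
      exact_mod_cast this
    have hl : Real.log (t / (2 * Real.pi)) = Real.log (t / 2) - Real.log Real.pi := by
      rw [← div_div, Real.log_div (by positivity) Real.pi_ne_zero]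
    rw [XFactor_eq_prod_gammaPair, Finset.prod_congr rfl fun i _ => e i, ← exp_sum,
      cpow_def_of_ne_zero (ofReal_ne_zero.2 Real.pi_ne_zero), cpow_def_of_ne_zero hb0,
      ← ofReal_log Real.pi_pos.le, ← ofReal_log (by positivity), hl, ← exp_add, ← exp_add]
    congr 1
    simp only [Fin.sum_univ_three]
    push_cast
    ring

lemma continuousAt_XFactor {a b : Fin 3 → ℂ} (ha : ∀ i, ‖a i‖ ≤ 1 / 16) (hb : ∀ i, ‖b i‖ ≤ 1 / 16)
    (t : ℝ) : ContinuousAt (XFactor a b) t := by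
  rw [show XFactor a b = _ from funext (XFactor_eq_prod_gammaPair a b)]
  refine continuousAt_const.mul (tendsto_finsetProd _ fun i _ => ?_)
  have h1 := (half_add_re_bounds (ha i)).1
  have h2 := (half_add_re_bounds (hb i)).1
  obtain ⟨h3, h4⟩ := half_add_add_neg_re_pos (ha i) (hb i)
  have h5 := continuousAt_gammaPair (u := 1 / 2 + a i) (v := 1 / 2 + b i) (p := (-(a i + b i), t))
    (by linarith) (by linarith) h3 h4
  exact ContinuousAt.comp (f := fun t : ℝ => (-(a i + b i), t)) h5 (by fun_prop)

lemma norm_sum_shift_le {a b : Fin 3 → ℂ} {r : ℝ} (ha : ∀ i, ‖a i‖ ≤ r) (hb : ∀ i, ‖b i‖ ≤ r) :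
    ‖∑ i, (a i + b i)‖ ≤ 6 * r := by
  refine (norm_sum_le_of_le _ fun i _ => (norm_add_le _ _).trans (add_le_add (ha i) (hb i))).trans
    (le_of_eq ?_)
  simp
  ring

/-- A power of `t / 2π` with exponent `O(1 / log T)` is bounded. -/
lemma norm_cpow_shift_le {c T t : ℝ} (hc : 0 ≤ c) (hT : 1 < T) (ht : 1 ≤ t / (2 * Real.pi))
    (htT : t ≤ T ^ 2) {x : ℂ} (hx : ‖x‖ ≤ 6 * (c / Real.log T)) :
    ‖((t / (2 * Real.pi) : ℝ) : ℂ) ^ x‖ ≤ Real.exp (12 * c) := by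
  have hlog : 0 < Real.log T := Real.log_pos hT
  have hpos : 0 < t / (2 * Real.pi) := by linarith
  have ht0 : 0 < t := by
    by_contra h
    have := div_nonpos_of_nonpos_of_nonneg (not_lt.1 h) (by positivity : 0 ≤ 2 * Real.pi)
    linarith
  have hle : t / (2 * Real.pi) ≤ t := div_le_self ht0.le (by linarith [Real.pi_gt_three])
  have h2 : Real.log (t / (2 * Real.pi)) ≤ 2 * Real.log T := by
    have := Real.log_le_log hpos (hle.trans htT)
    rwa [Real.log_pow] at this
  have h1 : 0 ≤ Real.log (t / (2 * Real.pi)) := Real.log_nonneg ht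
  rw [norm_cpow_eq_rpow_re_of_pos hpos, Real.rpow_def_of_pos hpos, Real.exp_le_exp]
  calc Real.log (t / (2 * Real.pi)) * x.re
      ≤ Real.log (t / (2 * Real.pi)) * (6 * (c / Real.log T)) :=
        mul_le_mul_of_nonneg_left ((re_le_norm x).trans hx) h1
    _ ≤ 2 * Real.log T * (6 * (c / Real.log T)) := by gcongr
    _ = 12 * c := by field_simp; ring

/-- This supplies the pair of nearby weights with which the asymptotic formula for the first
diagonal term is applied to the second one. -/
lemma exists_isBoundedWeight_XFactor_mul {c c₁ c₂ : ℝ} (hc : 0 ≤ c) (hc₁ : 0 < c₁) :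
    ∃ B : ℝ, 0 ≤ B ∧ ∃ T₁ : ℝ, ∀ (T m : ℝ) (a b : Fin 3 → ℂ) (ω : ℝ → ℂ), 1 < T → T₁ ≤ T → 0 ≤ m →
      (∀ i, ‖a i‖ ≤ 1 / 16) → (∀ i, ‖b i‖ ≤ 1 / 16) → (∀ i, ‖a i‖ ≤ c / Real.log T) →
      (∀ i, ‖b i‖ ≤ c / Real.log T) → IsBoundedWeight (c₁ * T) (c₂ * T) m ω →
      IsBoundedWeight (c₁ * T) (c₂ * T) (B * m) (fun t => XFactor a b t * ω t) ∧
      IsBoundedWeight (c₁ * T) (c₂ * T) (B * m)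
        (fun t => ((t / (2 * Real.pi) : ℝ) : ℂ) ^ (-∑ i, (a i + b i)) * ω t) ∧
      ∀ t ∈ Set.Icc (c₁ * T) (c₂ * T), ‖XFactor a b t * ω t -
        ((t / (2 * Real.pi) : ℝ) : ℂ) ^ (-∑ i, (a i + b i)) * ω t‖ ≤ B * m / T := by
  obtain ⟨C, hC, h⟩ := exists_XFactor_eq
  set D := Real.exp (12 * c) with hD
  have hD0 : 0 < D := Real.exp_pos _
  -- Here `D` bounds the power of `t/2π`, `3` bounds `‖exp ρ‖` and `2C/c₁` bounds `T ‖exp ρ - 1‖`.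
  -- The condition `T ≥ c₂` ensures `t ≤ T²` on the support.
  refine ⟨D * (3 + 2 * (C / c₁)), by positivity, max ((9 + C) / c₁) c₂, ?_⟩
  intro T m a b ω hT1 hT hm ha hb hac hbc hω
  have hT0 : 0 < T := by linarith
  have hcT : 9 + C ≤ c₁ * T := by
    have := (le_max_left _ _).trans hT
    rw [div_le_iff₀ hc₁] at this; linarith
  have hc₂T : c₂ * T ≤ T ^ 2 := by
    rw [sq]
    exact mul_le_mul_of_nonneg_right ((le_max_right _ _).trans hT) hT0.le
  set x : ℂ := -∑ i, (a i + b i) with hx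
  have hxn : ‖x‖ ≤ 6 * (c / Real.log T) := by
    rw [hx, norm_neg]
    exact norm_sum_shift_le hac hbc
  have hpow : ∀ t ∈ Set.Icc (c₁ * T) (c₂ * T), ‖((t / (2 * Real.pi) : ℝ) : ℂ) ^ x‖ ≤ D := by
    intro t ht
    have ht9 : 9 + C ≤ t := hcT.trans ht.1
    refine norm_cpow_shift_le hc hT1 ?_ (ht.2.trans hc₂T) hxn
    rw [one_le_div (by positivity)]
    linarith [Real.pi_le_four]
  have key : ∀ t ∈ Set.Icc (c₁ * T) (c₂ * T), ∃ ρ : ℂ, ‖ρ‖ ≤ C / c₁ / T ∧ ‖ρ‖ ≤ 1 ∧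
      XFactor a b t = ((t / (2 * Real.pi) : ℝ) : ℂ) ^ x * exp ρ := by
    intro t ht
    have ht9 : 9 + C ≤ t := hcT.trans ht.1
    have ht0 : 0 < t := by linarith
    obtain ⟨ρ, hρ, e⟩ := h a b t ha hb (by linarith)
    refine ⟨ρ, hρ.trans ?_, hρ.trans ((div_le_one ht0).2 (by linarith)), e⟩
    rw [div_div]
    exact div_le_div_of_nonneg_left hC (by positivity) ht.1
  have hCc : 0 ≤ C / c₁ := by positivity
  have h3 : D * 3 * m ≤ D * (3 + 2 * (C / c₁)) * m := by gcongr; linarith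
  refine ⟨⟨?_, support_mul_subset_right hω.support_subset, fun t ht => ?_⟩,
    ⟨?_, support_mul_subset_right hω.support_subset, fun t ht => ?_⟩, fun t ht => ?_⟩
  · exact ContinuousOn.mul (fun t _ => (continuousAt_XFactor ha hb t).continuousWithinAt)
      hω.continuousOn
  · obtain ⟨ρ, -, hρ1, e⟩ := key t ht
    have he : ‖exp ρ‖ ≤ 3 := by
      have := norm_exp_sub_one_le hρ1
      have h4 := norm_sub_norm_le (exp ρ) 1
      rw [norm_one] at h4
      linarith
    rw [e, norm_mul, norm_mul]
    refine le_trans ?_ h3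
    exact mul_le_mul (mul_le_mul (hpow t ht) he (norm_nonneg _) hD0.le) (hω.norm_le t ht)
      (norm_nonneg _) (by positivity)
  · refine ContinuousOn.mul ?_ hω.continuousOn
    refine ContinuousOn.cpow (by fun_prop) (by fun_prop) fun t ht => ?_
    refine Or.inl ?_
    rw [ofReal_re]
    exact div_pos (by linarith [ht.1]) (by positivity)
  · rw [norm_mul]
    refine le_trans ?_ h3
    refine mul_le_mul ((hpow t ht).trans ?_) (hω.norm_le t ht) (norm_nonneg _) (by positivity)
    linarith
  · obtain ⟨ρ, hρ, hρ1, e⟩ := key t ht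
    have he : ‖exp ρ - 1‖ ≤ 2 * (C / c₁ / T) := (norm_exp_sub_one_le hρ1).trans (by linarith)
    rw [e, show ((t / (2 * Real.pi) : ℝ) : ℂ) ^ x * exp ρ * ω t -
      ((t / (2 * Real.pi) : ℝ) : ℂ) ^ x * ω t =
      ((t / (2 * Real.pi) : ℝ) : ℂ) ^ x * (exp ρ - 1) * ω t by ring, norm_mul, norm_mul]
    calc _ ≤ D * (2 * (C / c₁ / T)) * m :=
          mul_le_mul (mul_le_mul (hpow t ht) he (norm_nonneg _) hD0.le) (hω.norm_le t ht)
            (norm_nonneg _) (by positivity)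
      _ = D * (2 * (C / c₁)) * m / T := by ring
      _ ≤ _ := by gcongr; linarith

lemma diagIntegrand₂_eq (a b : Fin 3 → ℂ) (G : ℂ → ℂ) (ω : ℝ → ℂ) (n : ℕ) :
    diagIntegrand₂ a b G ω n = diagIntegrand₁ (-b) (-a) G (fun t => XFactor a b t * ω t) n := by
  ext s
  rw [diagIntegrand₂, diagIntegrand₁]
  congr 2
  ext t
  ring

lemma diagTerm₂_eq (a b : Fin 3 → ℂ) (G : ℂ → ℂ) (ω : ℝ → ℂ) :
    diagTerm₂ a b G ω = diagTerm₁ (-b) (-a) G (fun t => XFactor a b t * ω t) := by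
  ext n
  rw [diagTerm₂, diagTerm₁, diagIntegrand₂_eq]

lemma diag₂_eq (a b : Fin 3 → ℂ) (G : ℂ → ℂ) (ω : ℝ → ℂ) :
    diag₂ a b G ω = diag₁ (-b) (-a) G (fun t => XFactor a b t * ω t) := by
  rw [diag₂, diag₁, diagTerm₂_eq]

lemma mainWeight_cpow_mul {α β m : ℝ} (hα : 0 < α) {ω : ℝ → ℂ} (hω : IsBoundedWeight α β m ω)
    (x s : ℂ) : mainWeight (fun t => ((t / (2 * Real.pi) : ℝ) : ℂ) ^ x * ω t) s =
      ∫ t : ℝ, ω t * ((t / (2 * Real.pi) : ℝ) : ℂ) ^ (x + 3 * s) := by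
  rw [mainWeight]
  congr 1
  ext t
  by_cases h : ω t = 0
  · simp [h]
  have ht : 0 < t / (2 * Real.pi) := div_pos (hα.trans_le (hω.support_subset h).1) (by positivity)
  rw [cpow_add _ _ (by exact_mod_cast ht.ne')]
  ring

lemma IsWeight.isBoundedWeight {c₁ c₂ M₀ T T₀ : ℝ} {M : ℕ → ℝ} {ω : ℝ → ℂ}
    (h : IsWeight c₁ c₂ M₀ M T T₀ ω) : IsBoundedWeight (c₁ * T) (c₂ * T) |M 0| ω where
  continuousOn := h.smooth.continuous.continuousOn
  support_subset := h.support_subset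
  norm_le t _ := by
    have := h.deriv_bound 0 t
    simp only [iteratedDeriv_zero, CharP.cast_eq_zero, neg_zero, Real.rpow_zero, mul_one] at this
    exact this.trans (le_abs_self _)

lemma IsKernel.norm_le {K : ℝ → ℝ → ℝ} {G : ℂ → ℂ} (h : IsKernel K G) (s : ℂ) (hs : |s.re| ≤ 1) :
    ‖G s‖ ≤ |K 1 29| * ((1 + ‖s‖) ^ 29)⁻¹ := by
  have := h.decay 1 one_pos 29 (by norm_num) s hs
  rw [Real.rpow_neg (by positivity)] at this
  have e : (1 + ‖s‖) ^ (29 : ℝ) = (1 + ‖s‖) ^ 29 := by exact_mod_cast Real.rpow_natCast _ 29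
  rw [e] at this
  refine this.trans ?_
  gcongr
  exact le_abs_self _

end SixthMoment

end

/-! ### The two diagonal terms. -/

open SixthMoment in
theorem proposition2 (ε : ℝ) (hε : 0 < ε) (c c₁ c₂ M₀ : ℝ) (hc : 0 < c) (hc₁ : 0 < c₁)
    (hc₂ : c₁ < c₂) (M : ℕ → ℝ) (K : ℝ → ℝ → ℝ) :
    ∃ C : ℝ, 0 < C ∧ ∃ Tε : ℝ, 1 < Tε ∧ ∀ T : ℝ, Tε ≤ T →
      ∀ a b : Fin 3 → ℂ,
        (∀ i, ‖a i‖ ≤ c / Real.log T) → (∀ j, ‖b j‖ ≤ c / Real.log T) →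
        (∀ i j, a i + b j ≠ 0) →
        Function.Injective (fun p : Fin 3 × Fin 3 => a p.1 + b p.2) →
      ∀ G : ℂ → ℂ, IsKernel K G →
      ∀ (T₀ : ℝ) (ω : ℝ → ℂ), IsWeight c₁ c₂ M₀ M T T₀ ω →
        -- the analytic continuations exist, and the diagonal terms converge absolutely
        (IsContinuation a b (calZ a b) ∧ IsContinuation (-b) (-a) (calZ (-b) (-a))) ∧
        ((∀ n, LineIntegrable 1 (diagIntegrand₁ a b G ω n)) ∧
          Summable (diagTerm₁ a b G ω)) ∧
        ((∀ n, LineIntegrable 1 (diagIntegrand₂ a b G ω n)) ∧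
          Summable (diagTerm₂ a b G ω)) ∧
        -- the first diagonal term
        ‖diag₁ a b G ω -
            ((∫ t : ℝ, calZ a b 0 * ω t) +
              ∑ i : Fin 3, ∑ j : Fin 3,
                residue (fun s => calZ a b (2 * s)) ((-a i - b j) / 2) *
                  (G ((-a i - b j) / 2) / ((-a i - b j) / 2)) *
                  ∫ t : ℝ, ω t * ((t / (2 * Real.pi) : ℝ) : ℂ) ^ (-(3 / 2) * (a i + b j)))‖
          ≤ C * T ^ (1 / 4 + ε) ∧
        -- the second diagonal term
        ‖diag₂ a b G ω -
            ((∫ t : ℝ, ((t / (2 * Real.pi) : ℝ) : ℂ) ^ (-∑ k : Fin 3, (a k + b k)) *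
                calZ (-b) (-a) 0 * ω t) +
              ∑ i : Fin 3, ∑ j : Fin 3,
                residue (fun s => calZ (-b) (-a) (2 * s)) ((a i + b j) / 2) *
                  (G ((a i + b j) / 2) / ((a i + b j) / 2)) *
                  ∫ t : ℝ, ω t * ((t / (2 * Real.pi) : ℝ) : ℂ) ^
                    (-(∑ k : Fin 3, (a k + b k)) + 3 / 2 * (a i + b j)))‖
          ≤ C * T ^ (1 / 4 + ε) := by
  -- The contour argument loses `T^{3δ}`, hence `3δ ≤ ε`. The threshold `exp(4c/δ)` for `T` chosen
  -- below makes the shifts at most `δ/4`.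
  set δ : ℝ := min (ε / 3) (1 / 16) with hδdef
  have hδ : 0 < δ := lt_min (by linarith) (by norm_num)
  have hδ1 : δ ≤ 1 / 16 := min_le_right _ _
  have hδε : 1 / 4 + 3 * δ ≤ 1 / 4 + ε := by linarith [min_le_left (ε / 3) (1 / 16 : ℝ)]
  obtain ⟨A, hA, T₁, hmain⟩ := exists_diag₁_asymptotic hδ hδ1 hc₁ hc₂ (abs_nonneg (K 1 29))
  obtain ⟨B, hB, T₂, hX⟩ := exists_isBoundedWeight_XFactor_mul (c₂ := c₂) hc.le hc₁
  refine ⟨A * ((1 + B) * |M 0|) + 1, by positivity,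
    max (max 2 (Real.exp (4 * c / δ))) (max T₁ T₂), ?_, ?_⟩
  · exact lt_of_lt_of_le one_lt_two ((le_max_left _ _).trans (le_max_left _ _))
  intro T hT a b ha hb hne hinj G hG T₀ ω hω
  have hT1 : 1 < T :=
    lt_of_lt_of_le one_lt_two (((le_max_left _ _).trans (le_max_left _ _)).trans hT)
  have hT0 : 0 < T := by linarith
  have hTe : Real.exp (4 * c / δ) ≤ T := ((le_max_right _ _).trans (le_max_left _ _)).trans hT
  have hT₁ : T₁ ≤ T := ((le_max_left _ _).trans (le_max_right _ _)).trans hT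
  have hT₂ : T₂ ≤ T := ((le_max_right _ _).trans (le_max_right _ _)).trans hT
  have hcl : c / Real.log T ≤ δ / 4 := by
    have h1 : 4 * c / δ ≤ Real.log T := (Real.le_log_iff_exp_le hT0).2 hTe
    rw [div_le_iff₀ (Real.log_pos hT1)]
    rw [div_le_iff₀ hδ] at h1
    linarith
  have ha4 : ∀ i, ‖a i‖ ≤ δ / 4 := fun i => (ha i).trans hcl
  have hb4 : ∀ i, ‖b i‖ ≤ δ / 4 := fun i => (hb i).trans hcl
  have ha4' : ∀ i, ‖(-a) i‖ ≤ δ / 4 := fun i => by simpa using ha4 i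
  have hb4' : ∀ i, ‖(-b) i‖ ≤ δ / 4 := fun i => by simpa using hb4 i
  have hbw := hω.isBoundedWeight
  obtain ⟨hw1, hw2, hw3⟩ := hX T |M 0| a b ω hT1 hT₂ (abs_nonneg _)
    (fun i => (ha4 i).trans (by linarith)) (fun i => (hb4 i).trans (by linarith)) ha hb hbw
  have hne' : ∀ i j, (-b) i + (-a) j ≠ 0 := fun i j h => hne j i (by
    simp only [Pi.neg_apply] at h
    linear_combination -h)
  have hinj' : Function.Injective fun p : Fin 3 × Fin 3 => (-b) p.1 + (-a) p.2 := by
    intro p q h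
    simp only [Pi.neg_apply] at h
    have := @hinj p.swap q.swap (by
      change a p.2 + b p.1 = a q.2 + b q.1
      linear_combination -h)
    exact Prod.swap_injective this
  obtain ⟨hn1, hs1, hd1⟩ := hmain T |M 0| a b G ω ω hT₁ (abs_nonneg _) ha4 hb4 hne hinj hG.entire
    hG.map_zero hG.norm_le hbw hbw fun t _ => by
      rw [sub_self, norm_zero]; positivity
  obtain ⟨hn2, hs2, hd2⟩ := hmain T (B * |M 0|) (-b) (-a) G _ _ hT₁ (by positivity) hb4' ha4' hne'
    hinj' hG.entire hG.map_zero hG.norm_le hw1 hw2 hw3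
  have hTle : T ^ (1 / 4 + 3 * δ) ≤ T ^ (1 / 4 + ε) :=
    Real.rpow_le_rpow_of_exponent_le hT1.le hδε
  have hα : 0 < c₁ * T := by positivity
  refine ⟨⟨isContinuation_calZ (isContinuation_eulerZ hδ (by linarith) ha4 hb4),
    isContinuation_calZ (isContinuation_eulerZ hδ (by linarith) hb4' ha4')⟩, ⟨hn1, hs1⟩,
    ⟨fun n => by rw [diagIntegrand₂_eq]; exact hn2 n, by rw [diagTerm₂_eq]; exact hs2⟩, ?_, ?_⟩
  · have e0 : (∫ t : ℝ, calZ a b 0 * ω t) = calZ a b 0 * mainWeight ω 0 := by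
      rw [MeasureTheory.integral_const_mul, mainWeight]
      simp
    have e1 : ∀ i j, (∫ t : ℝ, ω t * ((t / (2 * Real.pi) : ℝ) : ℂ) ^ (-(3 / 2) * (a i + b j))) =
        mainWeight ω ((-a i - b j) / 2) := by
      intro i j
      rw [mainWeight, show 3 * ((-a i - b j) / 2) = -(3 / 2) * (a i + b j) by ring]
      simp only [mul_comm]
    simp only [e0, e1]
    refine hd1.trans ?_
    have h1 : A * |M 0| ≤ A * ((1 + B) * |M 0|) + 1 := by
      nlinarith [mul_nonneg (mul_nonneg hA hB) (abs_nonneg (M 0))]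
    exact mul_le_mul h1 hTle (Real.rpow_nonneg hT0.le _) (by positivity)
  · set x : ℂ := -∑ k : Fin 3, (a k + b k) with hx
    have e0 : (∫ t : ℝ, ((t / (2 * Real.pi) : ℝ) : ℂ) ^ x * calZ (-b) (-a) 0 * ω t) =
        calZ (-b) (-a) 0 * mainWeight (fun t => ((t / (2 * Real.pi) : ℝ) : ℂ) ^ x * ω t) 0 := by
      rw [mainWeight, ← MeasureTheory.integral_const_mul]
      congr 1
      ext t
      rw [mul_zero, Complex.cpow_zero]
      ring
    have e1 : ∀ i j, (∫ t : ℝ, ω t * ((t / (2 * Real.pi) : ℝ) : ℂ) ^ (x + 3 / 2 * (a i + b j))) =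
        mainWeight (fun t => ((t / (2 * Real.pi) : ℝ) : ℂ) ^ x * ω t) ((a i + b j) / 2) := by
      intro i j
      rw [mainWeight_cpow_mul hα hbw, show x + 3 * ((a i + b j) / 2) = x + 3 / 2 * (a i + b j) by ring]
    have e2 : ∀ i j, (-(-b) j - (-a) i) / 2 = (a i + b j) / 2 := fun i j => by
      simp only [Pi.neg_apply]; ring
    -- For the shifts `-b`, `-a` the double sum runs over the index of `b` first; the swap restores
    -- the order `i, j`.
    rw [Finset.sum_comm] at hd2
    simp only [e2] at hd2
    simp only [e0, e1]
    rw [diag₂_eq]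
    refine hd2.trans ?_
    have h1 : A * (B * |M 0|) ≤ A * ((1 + B) * |M 0|) + 1 := by
      nlinarith [mul_nonneg hA (abs_nonneg (M 0))]
    exact mul_le_mul h1 hTle (Real.rpow_nonneg hT0.le _) (by positivity)
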